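/- Linear regression under covariate shift. Let \(\Lambda=\mathrm{diag}(\lambda_1,\dots,\lambda_d)\) with \(\lambda_1\ge\dots\ge\lambda_d>0\), \(M=\mathrm{diag}(m_1,\dots,m_d)\) and \(w\in\mathbb R^d\) satisfy, with fixed constants \(0<c_1\), \(0<c_2\), \[c_1 i^{-a}\le\lambda_i\le c_2 i^{-a},\qquad c_1\lambda_i^{1-s}\le m_i\le c_2\lambda_i^{1-s},\qquad c_1 i^{-(1+r)a/2}\le w_i\le c_2 i^{-(1+r)a/2}\qquad(1\le i\le d),\] and put \(S=\Lambda\), \(T=ww^\top\). Let \(\mathcal P=\mathcal P_{\sigma,\psi}(M,S,T)\) be the class of pairs of probability laws \((P,Q)\) of \((x,y)\in\mathbb R^d\times\mathbb R\) (source and target), with finite second moments, such that: \(P\) and \(Q\) have the same conditional law of \(y\) given \(x\); \(\mathbb E_P[xx^\top]=S\) and \(\mathbb E_Q[xx^\top]=T\); some \(w^*\) with \((w^*)^\top Mw^*\le1\) minimizes both \(v\mapsto\mathbb E_P(y-\langle v,x\rangle)^2\) and \(v\mapsto\mathbb E_Q(y-\langle v,x\rangle)^2\); \(\mathbb E_P[xx^\top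 Axx^\top]\preceq\psi\,\mathrm{tr}(SA)\,S\) for every positive semidefinite \(A\); and \(\mathbb E_P[(y-\langle w^*,x\rangle)^2xx^\top]\preceq\sigma^2S\). Given \(n\) i.i.d. observations from \(P\), an estimator \(\hat w\) (possibly randomized) has worst-case target risk \(\mathcal R_n(\hat w)=\sup_{\mathcal P}\mathbb E\|\hat w-w^*\|_T^2\), where \(\|u\|_T^2=u^\top Tu\); let \(\mathcal R_n^*=\inf_{\hat w}\mathcal R_n(\hat w)\). ASGD with parameters \((\delta,\gamma,\alpha,\beta)\) starts from \(w_0=v_0=0\) and makes one pass over the data, in \(L=\lfloor\log_2n\rfloor\) stages of \(\lfloor n/L\rfloor\) iterations each; in stage \(\ell=1,\dots,L\) the iteration that uses the observation \((x_i,y_i)\) is \[u=\alpha w_{i-1}+(1-\alpha)v_{i-1},\quad g=(\langle x_i,u\rangle-y_i)x_i,\quad w_i=u-\tfrac{\delta}{4^{\ell-1}}g,\quad v_i=\beta u+(1-\beta)v_{i-1}-\tfrac{\gamma}{4^{\ell-1}}g,\] and the output is the last \(w_i\). Vanilla SGD with step size \(\gamma\) starts from \(w_0=0\) and uses \(w_i=w_{i-1}-\frac{\gamma}{4^{\ell-1}}(\langle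 x_i,w_{i-1}\rangle-y_i)x_i\) with the same stages (this is ASGD with \(\delta=\gamma\)). Theorem (rank-one structure). Let \(a>1\), \(r>\max\{\frac1a-2,\ \frac1a-s\}\), \(\sigma>0\), \(\psi\ge1\). (1) If \(s\ge1\), there are step sizes \(\gamma_n>0\), depending only on \(n\) and on \(a,s,r,c_1,c_2,\sigma,\psi\), such that vanilla SGD is minimax optimal up to logarithmic factors: there are \(C,p,N\), depending only on \(a,s,r,c_1,c_2,\sigma,\psi\), such that for every \(d\), all \(\lambda,m,w\) as above and all \(n\ge N\), \(\mathcal R_n(\text{SGD})\le C(\ln n)^p\,\mathcal R_n^*\). (2) If \(\frac a{2a-1}<s<1\), there are parameters \(0<\delta_n\le\gamma_n\) and \(\alpha_n,\beta_n\in(0,1)\), depending only on \(n\) and on \(a,s,r,c_1,c_2,\sigma,\psi\), such that ASGD is minimax optimal up to logarithmic factors in the same sense. -/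

import Mathlib

open MeasureTheory ProbabilityTheory Matrix
open scoped ENNReal

noncomputable section

namespace CovShift

/-- The type of one observation `(x, y)`, with covariate `x ∈ ℝ^d` and response `y ∈ ℝ`. -/
abbrev Obs (d : ℕ) : Type := (Fin d → ℝ) × ℝ

/-- Entrywise expectation `E_P[F]` of a matrix-valued function of an observation. -/
def matExp {d : ℕ} (P : Measure (Obs d)) (F : Obs d → Matrix (Fin d) (Fin d) ℝ) :
    Matrix (Fin d) (Fin d) ℝ :=
  Matrix.of fun i j => ∫ z, F z i j ∂P

/-- The population risk `(1/2) E_P (y - ⟨w, x⟩)²`. -/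
def popRisk {d : ℕ} (P : Measure (Obs d)) (w : Fin d → ℝ) : ℝ :=
  (1 / 2) * ∫ z, (z.2 - w ⬝ᵥ z.1) ^ 2 ∂P

/-- `‖u‖_A² = uᵀ A u`. -/
def sqNorm {d : ℕ} (A : Matrix (Fin d) (Fin d) ℝ) (u : Fin d → ℝ) : ℝ :=
  u ⬝ᵥ (A *ᵥ u)

/-- `P` is a probability law on `ℝ^d × ℝ` with finite second moments and `E_P[x xᵀ] = A`. -/
structure HasCovariance {d : ℕ} (P : Measure (Obs d)) (A : Matrix (Fin d) (Fin d) ℝ) : Prop where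
  prob : IsProbabilityMeasure P
  memLp_x : ∀ i, MemLp (fun z : Obs d => z.1 i) 2 P
  memLp_y : MemLp (fun z : Obs d => z.2) 2 P
  cov : matExp P (fun z => vecMulVec z.1 z.1) = A

/-- The covariate shift problem class. `P` is the source law, `Q` the target law, `wstar` the best
regressor: it lies in the ellipsoid `‖wstar‖_M² ≤ 1` and minimizes the source risk as well as the
target risk; the covariances of `P`, `Q` are `S`, `T`; the conditional law of `y` given `x` is
the same in both domains; and the source law satisfies the fourth moment bound with constant `ψ`
and the noise bound with constant `σ²`. -/
structure MemClass {d : ℕ} (σ ψ : ℝ) (M S T : Matrix (Fin d) (Fin d) ℝ)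
    (P Q : Measure (Obs d)) (wstar : Fin d → ℝ) : Prop where
  source : HasCovariance P S
  target : HasCovariance Q T
  covariateShift : ∃ κ : Kernel (Fin d → ℝ) ℝ, IsMarkovKernel κ ∧
    P = P.fst ⊗ₘ κ ∧ Q = Q.fst ⊗ₘ κ
  ellipsoid : sqNorm M wstar ≤ 1
  source_min : ∀ w, popRisk P wstar ≤ popRisk P w
  target_min : ∀ w, popRisk Q wstar ≤ popRisk Q w
  fourth_integrable : ∀ i, Integrable (fun z : Obs d => z.1 i ^ 4) P
  /-- `E_P[x xᵀ A x xᵀ] ⪯ ψ tr(S A) S` for every positive semidefinite `A`. -/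
  fourth_moment : ∀ A : Matrix (Fin d) (Fin d) ℝ, A.PosSemidef →
    ((ψ * (S * A).trace) • S
      - matExp P (fun z => vecMulVec z.1 z.1 * A * vecMulVec z.1 z.1)).PosSemidef
  noise_integrable : ∀ i, Integrable (fun z : Obs d => (z.2 - z.1 ⬝ᵥ wstar) ^ 2 * z.1 i ^ 2) P
  /-- `E_P[ε² x xᵀ] ⪯ σ² S` with `ε = y - xᵀ wstar`. -/
  noise : (σ ^ 2 • S
      - matExp P (fun z => (z.2 - z.1 ⬝ᵥ wstar) ^ 2 • vecMulVec z.1 z.1)).PosSemidef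

/-- A randomized estimator from `n` observations: a measurable function of the data and of an
auxiliary random element `ξ ∼ law` that is independent of the data. -/
structure RandEstimator (d n : ℕ) where
  Ξ : Type
  [mΞ : MeasurableSpace Ξ]
  law : Measure Ξ
  prob : IsProbabilityMeasure law
  toFun : (Fin n → Obs d) × Ξ → (Fin d → ℝ)
  measurable : Measurable toFun

attribute [instance] RandEstimator.mΞ

/-- Worst-case target excess risk `sup E ‖ŵ - w*‖_T²` over the problem class, for an estimator `f`
that is a function of `n` i.i.d. source observations. -/
def worstRisk {d n : ℕ} (σ ψ : ℝ) (M S T : Matrix (Fin d) (Fin d) ℝ)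
    (f : (Fin n → Obs d) → (Fin d → ℝ)) : ℝ≥0∞ :=
  ⨆ (P : Measure (Obs d)) (Q : Measure (Obs d)) (wstar : Fin d → ℝ)
    (_ : MemClass σ ψ M S T P Q wstar),
    ∫⁻ D, ENNReal.ofReal (sqNorm T (f D - wstar)) ∂(Measure.pi fun _ : Fin n => P)

/-- Worst-case target excess risk of a randomized estimator. -/
def randWorstRisk {d n : ℕ} (σ ψ : ℝ) (M S T : Matrix (Fin d) (Fin d) ℝ)
    (e : RandEstimator d n) : ℝ≥0∞ :=
  ⨆ (P : Measure (Obs d)) (Q : Measure (Obs d)) (wstar : Fin d → ℝ)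
    (_ : MemClass σ ψ M S T P Q wstar),
    ∫⁻ D, ENNReal.ofReal (sqNorm T (e.toFun D - wstar))
      ∂((Measure.pi fun _ : Fin n => P).prod e.law)

/-- The minimax target excess risk over all randomized estimators from `n` observations. -/
def minimaxRisk {d : ℕ} (σ ψ : ℝ) (M S T : Matrix (Fin d) (Fin d) ℝ) (n : ℕ) : ℝ≥0∞ :=
  ⨅ e : RandEstimator d n, randWorstRisk σ ψ M S T e

/-- Number of stages `⌊log₂ n⌋` of the step size schedule. -/
def numStages (n : ℕ) : ℕ := Nat.log 2 n

/-- Number of iterations `⌊n / ⌊log₂ n⌋⌋` in each stage. -/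
def stageLen (n : ℕ) : ℕ := n / numStages n

/-- The iterates `(w_i, v_i)` of accelerated SGD started at `w_0 = v_0 = 0`. The step sizes `δ`
and `γ` are divided by `4` after each stage; observation number `i` (counted from `0`) is used
once, in stage number `i / stageLen n` (counted from `0`). -/
def asgdIter {d n : ℕ} (δ γ α β : ℝ) (D : Fin n → Obs d) : ℕ → (Fin d → ℝ) × (Fin d → ℝ)
  | 0 => (0, 0)
  | i + 1 =>
    let w := (asgdIter δ γ α β D i).1
    let v := (asgdIter δ γ α β D i).2
    if h : i < n then
      let x := (D ⟨i, h⟩).1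
      let y := (D ⟨i, h⟩).2
      let u := α • w + (1 - α) • v
      let g := (x ⬝ᵥ u - y) • x
      (u - (δ / 4 ^ (i / stageLen n)) • g,
        β • u + (1 - β) • v - (γ / 4 ^ (i / stageLen n)) • g)
    else (w, v)

/-- The output of accelerated SGD after all the stages. -/
def asgd {d n : ℕ} (δ γ α β : ℝ) (D : Fin n → Obs d) : Fin d → ℝ :=
  (asgdIter δ γ α β D (numStages n * stageLen n)).1

/-- The iterates of vanilla SGD started at `w_0 = 0`, with the same step size schedule. -/
def sgdIter {d n : ℕ} (γ : ℝ) (D : Fin n → Obs d) : ℕ → (Fin d → ℝ)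
  | 0 => 0
  | i + 1 =>
    let w := sgdIter γ D i
    if h : i < n then
      let x := (D ⟨i, h⟩).1
      let y := (D ⟨i, h⟩).2
      w - (γ / 4 ^ (i / stageLen n)) • ((x ⬝ᵥ w - y) • x)
    else w

/-- The output of vanilla SGD after all the stages. -/
def sgd {d n : ℕ} (γ : ℝ) (D : Fin n → Obs d) : Fin d → ℝ :=
  sgdIter γ D (numStages n * stageLen n)

/-- `x_i ≍ y_i` with explicit constants: `c₁ y_i ≤ x_i ≤ c₂ y_i` for all `i`. -/
def Comparable {d : ℕ} (c₁ c₂ : ℝ) (x y : Fin d → ℝ) : Prop :=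
  ∀ i, c₁ * y i ≤ x i ∧ x i ≤ c₂ * y i

/-- The power law `i ^ e`, `i = 1, …, d`. -/
def powerLaw (d : ℕ) (e : ℝ) : Fin d → ℝ := fun i => ((i : ℝ) + 1) ^ e

/-- A family of estimators (one for each dimension `d` and sample size `n`) is minimax optimal up
to logarithmic factors for rank-one targets: its worst-case risk is at most `C (ln n)^p` times the
minimax risk for all large `n`, where `C`, `p` and the threshold on `n` depend only on
`a, s, r, c₁, c₂, σ, ψ` and not on the dimension or on the instance. The instances are
`S = diag(λ)`, `M = diag(m)`, `T = w wᵀ` with `λ` non-increasing, `λ_i ≍ i^{-a}`,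
`m_i ≍ λ_i^{1-s}` and `w_i ≍ i^{-(1+r)a/2}`. -/
def RankOneOptimalUpToLog (a s r c₁ c₂ σ ψ : ℝ)
    (alg : ∀ d n : ℕ, (Fin n → Obs d) → (Fin d → ℝ)) : Prop :=
  ∃ (C p : ℝ) (N : ℕ), 0 < C ∧
    ∀ (d : ℕ) (lam m w : Fin d → ℝ), Antitone lam →
      Comparable c₁ c₂ lam (powerLaw d (-a)) →
      Comparable c₁ c₂ m (fun i => lam i ^ (1 - s)) →
      Comparable c₁ c₂ w (powerLaw d (-((1 + r) * a / 2))) →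
      ∀ n : ℕ, N ≤ n →
        worstRisk σ ψ (diagonal m) (diagonal lam) (vecMulVec w w) (alg d n)
          ≤ ENNReal.ofReal (C * Real.log n ^ p) *
            minimaxRisk σ ψ (diagonal m) (diagonal lam) (vecMulVec w w) n

end CovShift

end

open MeasureTheory ProbabilityTheory Matrix
open scoped ENNReal

noncomputable section

namespace CovShift

/-! Both sides of the comparison reduce to the one sum A = Σ w_j² / (m_j + nλ_j).

Lower bound. If h lies in the ellipsoid and n‖h‖_S² ≤ σ², the Gaussian responses with regressors h
and -h cannot be told apart from n observations, so the minimax risk is at least (w·h)²/8. The best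
h gives a multiple of A (`MemClass.minimaxRisk_ge`, `MemClass.minimaxRisk_diagonal_ge`).

Upper bound. Since T has rank one, the risk is the second moment of a single linear functional of
the error. Pulled back through the steps, it splits into its value on the noiseless trajectory and
the responses to the noise of each step. As S is diagonal, the noiseless recursion decouples into
two-dimensional ones, and the noise of step τ has second moment at most ν_τ S, without cross terms
(`MemClass.lintegral_errFunctional_le`). The level ν_τ involves the source error, which obeys a
linear Volterra inequality; when its kernel has mass at most 1/(4ψ), the ν_τ sum to O(n)
(`MemClass.sum_noise_level_le`).

In one direction with eigenvalue λ, the Lyapunov function `pot` contracts by 1 - β if γλ > 2β and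
does not increase otherwise. With β = (ln n)³/n a single stage in the fast regime gains a factor
n^(-5), while the decay of the step sizes puts every direction in the slow regime by the last stage.
So in resolved directions (nλ^s ≥ 1) the final response to a unit of noise is O(β/λ), up to a
negligible term.

Balance. The terms m ≍ λ^(1-s) and nλ cross at nλ^s = 1, and γ ≍ n^(1/s-1) puts the threshold γλ =
2β there up to logarithms. Resolved noise then costs about 1/(nλ) and slow bias about 1/m, both of
order 1/(m + nλ) up to logarithms. Unresolved noise is summed as a tail and compared with the block
of directions at the resolution, which uses r > 1/a - 2 (`exists_tail_le_block`).

The kernel mass contains Σ_j min(γλ_j, 2βγ/δ). It is small when some θ satisfies 1/a < θ < 2 - 1/s,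
that is, when s > a/(2a-1). For s ≥ 1 the tuning has δ = γ, and the accelerated iteration is vanilla
SGD. -/

/-! ### Moments of the source law -/

/-- The quadratic form of an entrywise expectation is the expectation of the quadratic forms. -/
lemma dotProduct_matExp_mulVec {d : ℕ} {P : Measure (Obs d)}
    {F : Obs d → Matrix (Fin d) (Fin d) ℝ}
    (hF : ∀ i j, Integrable (fun z => F z i j) P) (e k : Fin d → ℝ) :
    e ⬝ᵥ (matExp P F *ᵥ k) = ∫ z, e ⬝ᵥ (F z *ᵥ k) ∂P := by
  have h1 : ∀ i j, Integrable (fun z => e i * (F z i j * k j)) P := fun i j =>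
    ((hF i j).mul_const _).const_mul _
  simp only [dotProduct, mulVec, matExp, of_apply, Finset.mul_sum]
  rw [integral_finsetSum _ fun i _ => integrable_finsetSum _ fun j _ => h1 i j]
  refine Finset.sum_congr rfl fun i _ => ?_
  rw [integral_finsetSum _ fun j _ => h1 i j]
  refine Finset.sum_congr rfl fun j _ => ?_
  rw [integral_const_mul, integral_mul_const]

lemma HasCovariance.memLp_dotProduct {d : ℕ} {P : Measure (Obs d)}
    {A : Matrix (Fin d) (Fin d) ℝ} (hP : HasCovariance P A) (k : Fin d → ℝ) :
    MemLp (fun z : Obs d => k ⬝ᵥ z.1) 2 P := by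
  simp only [dotProduct]
  exact memLp_finsetSum _ fun i _ => (hP.memLp_x i).const_mul _

lemma dotProduct_vecMulVec_mulVec {d : ℕ} (e k x : Fin d → ℝ) :
    e ⬝ᵥ (vecMulVec x x *ᵥ k) = (e ⬝ᵥ x) * (k ⬝ᵥ x) := by
  simp only [dotProduct, mulVec, vecMulVec_apply]
  rw [Finset.sum_mul_sum]
  simp only [Finset.mul_sum]
  exact Finset.sum_congr rfl fun i _ => Finset.sum_congr rfl fun j _ => by ring

lemma sqNorm_vecMulVec {d : ℕ} (w u : Fin d → ℝ) : sqNorm (vecMulVec w w) u = (w ⬝ᵥ u) ^ 2 := by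
  rw [sqNorm, dotProduct_vecMulVec_mulVec, dotProduct_comm u w, sq]

lemma sqNorm_diagonal {d : ℕ} (lam u : Fin d → ℝ) :
    sqNorm (diagonal lam) u = ∑ i, lam i * u i ^ 2 := by
  simp only [sqNorm, mulVec_diagonal, dotProduct]
  exact Finset.sum_congr rfl fun i _ => by ring

lemma HasCovariance.integral_mul {d : ℕ} {P : Measure (Obs d)}
    {A : Matrix (Fin d) (Fin d) ℝ} (hP : HasCovariance P A) (e k : Fin d → ℝ) :
    ∫ z, (e ⬝ᵥ z.1) * (k ⬝ᵥ z.1) ∂P = e ⬝ᵥ (A *ᵥ k) := by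
  rw [← hP.cov, dotProduct_matExp_mulVec]
  · simp only [dotProduct_vecMulVec_mulVec]
  · intro i j
    exact (hP.memLp_x i).integrable_mul (hP.memLp_x j)

lemma HasCovariance.integral_sq {d : ℕ} {P : Measure (Obs d)}
    {A : Matrix (Fin d) (Fin d) ℝ} (hP : HasCovariance P A) (k : Fin d → ℝ) :
    ∫ z, (k ⬝ᵥ z.1) ^ 2 ∂P = sqNorm A k := by
  simp only [sq, hP.integral_mul, sqNorm]

lemma HasCovariance.memLp_residual {d : ℕ} {P : Measure (Obs d)}
    {A : Matrix (Fin d) (Fin d) ℝ} (hP : HasCovariance P A) (w : Fin d → ℝ) :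
    MemLp (fun z : Obs d => z.2 - w ⬝ᵥ z.1) 2 P :=
  hP.memLp_y.sub (hP.memLp_dotProduct w)

/-- A minimizer of the population risk satisfies the normal equations. -/
lemma HasCovariance.integral_residual_mul {d : ℕ} {P : Measure (Obs d)}
    {A : Matrix (Fin d) (Fin d) ℝ} (hP : HasCovariance P A) {w : Fin d → ℝ}
    (hw : ∀ v, popRisk P w ≤ popRisk P v) (k : Fin d → ℝ) :
    ∫ z, (z.2 - w ⬝ᵥ z.1) * (k ⬝ᵥ z.1) ∂P = 0 := by
  set c := ∫ z, (z.2 - w ⬝ᵥ z.1) * (k ⬝ᵥ z.1) ∂P with hc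
  set q := ∫ z, (k ⬝ᵥ z.1) ^ 2 ∂P with hq
  have hr := hP.memLp_residual w
  have hk := hP.memLp_dotProduct k
  have key : ∀ t : ℝ, 0 ≤ t ^ 2 * q - 2 * t * c := by
    intro t
    have h := hw (w + t • k)
    have e : ∀ z : Obs d, (z.2 - (w + t • k) ⬝ᵥ z.1) ^ 2 =
        (z.2 - w ⬝ᵥ z.1) ^ 2 + (t ^ 2 * (k ⬝ᵥ z.1) ^ 2
          - 2 * t * ((z.2 - w ⬝ᵥ z.1) * (k ⬝ᵥ z.1))) := by
      intro z
      rw [add_dotProduct, smul_dotProduct, smul_eq_mul]; ring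
    simp only [popRisk, e] at h
    have i1 := hr.integrable_sq
    have i2 := hk.integrable_sq.const_mul (t ^ 2)
    have i3 : Integrable (fun z : Obs d => 2 * t * ((z.2 - w ⬝ᵥ z.1) * (k ⬝ᵥ z.1))) P :=
      (hr.integrable_mul hk).const_mul (2 * t)
    have i4 : Integrable (fun z : Obs d => t ^ 2 * (k ⬝ᵥ z.1) ^ 2
        - 2 * t * ((z.2 - w ⬝ᵥ z.1) * (k ⬝ᵥ z.1))) P := i2.sub i3
    rw [integral_add i1 i4, integral_sub i2 i3, integral_const_mul,
      integral_const_mul] at h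
    linarith
  have hq0 : 0 ≤ q := integral_nonneg fun z => sq_nonneg _
  -- The minimizer of the quadratic would be t = c / q; the shift by 1 covers q = 0.
  have h1 := key (c / (q + 1))
  have h2 : (c / (q + 1)) ^ 2 * q - 2 * (c / (q + 1)) * c
      = - (c ^ 2 * (q + 2)) / (q + 1) ^ 2 := by
    field_simp; ring
  rw [h2] at h1
  have h3 : c ^ 2 * (q + 2) ≤ 0 := by
    by_contra hcon
    push Not at hcon
    have : - (c ^ 2 * (q + 2)) / (q + 1) ^ 2 < 0 := div_neg_of_neg_of_pos (by linarith) (by positivity)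
    linarith
  have h4 : c ^ 2 ≤ 0 := by
    nlinarith [sq_nonneg c]
  exact pow_eq_zero_iff two_ne_zero |>.1 (le_antisymm h4 (sq_nonneg c))

section MemClass

variable {d : ℕ} {σ ψ : ℝ} {M S T : Matrix (Fin d) (Fin d) ℝ} {P Q : Measure (Obs d)}
  {wstar : Fin d → ℝ}

lemma integrable_mul_of_sq {α : Type*} {_ : MeasurableSpace α} {μ : Measure α} {f g : α → ℝ}
    (hfm : AEStronglyMeasurable f μ) (hgm : AEStronglyMeasurable g μ)
    (hf : Integrable (fun x => f x ^ 2) μ) (hg : Integrable (fun x => g x ^ 2) μ) :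
    Integrable (fun x => f x * g x) μ :=
  ((memLp_two_iff_integrable_sq hfm).2 hf).integrable_mul ((memLp_two_iff_integrable_sq hgm).2 hg)

/-- Cauchy–Schwarz extends integrability from coordinate fourth powers to all mixed quartics, so the
integrals in the fourth moment bound are genuine and not default zeros. -/
lemma integrable_quartic (hi : ∀ i, Integrable (fun z : Obs d => z.1 i ^ 4) P) (e k : Fin d → ℝ) :
    Integrable (fun z : Obs d => (e ⬝ᵥ z.1) ^ 2 * (k ⬝ᵥ z.1) ^ 2) P := by
  have hm : ∀ i, Measurable fun z : Obs d => z.1 i := fun i => by fun_prop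
  have hsq : ∀ i j, MemLp (fun z : Obs d => z.1 i * z.1 j) 2 P := by
    intro i j
    have hij : Measurable fun z : Obs d => z.1 i * z.1 j := (hm i).mul (hm j)
    refine (memLp_two_iff_integrable_sq hij.aestronglyMeasurable).2 ?_
    have := integrable_mul_of_sq (f := fun z : Obs d => z.1 i ^ 2) (g := fun z => z.1 j ^ 2) (μ := P)
      ((hm i).pow_const 2).aestronglyMeasurable ((hm j).pow_const 2).aestronglyMeasurable
      (by simpa only [← pow_mul] using hi i) (by simpa only [← pow_mul] using hi j)
    simpa only [mul_pow] using this
  have hek : MemLp (fun z : Obs d => (e ⬝ᵥ z.1) * (k ⬝ᵥ z.1)) 2 P := by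
    have : (fun z : Obs d => (e ⬝ᵥ z.1) * (k ⬝ᵥ z.1)) =
        fun z => ∑ i, ∑ j, e i * k j * (z.1 i * z.1 j) := by
      ext z
      simp only [dotProduct, Finset.sum_mul_sum]
      exact Finset.sum_congr rfl fun i _ => Finset.sum_congr rfl fun j _ => by ring
    rw [this]
    exact memLp_finsetSum _ fun i _ => memLp_finsetSum _ fun j _ => (hsq i j).const_mul _
  simpa only [mul_pow] using hek.integrable_sq

/-- This is the fourth moment bound for A = e eᵀ, tested on the vector k. -/
lemma MemClass.integral_quartic_le (h : MemClass σ ψ M S T P Q wstar) (e k : Fin d → ℝ) :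
    ∫ z, (e ⬝ᵥ z.1) ^ 2 * (k ⬝ᵥ z.1) ^ 2 ∂P ≤ ψ * sqNorm S e * sqNorm S k := by
  have hA : (vecMulVec e e).PosSemidef := by
    simpa using posSemidef_vecMulVec_self_star e
  have hF : ∀ z : Obs d, vecMulVec z.1 z.1 * vecMulVec e e * vecMulVec z.1 z.1
      = (e ⬝ᵥ z.1) ^ 2 • vecMulVec z.1 z.1 := by
    intro z
    rw [vecMulVec_mul_vecMulVec, vecMulVec_smul, smul_mul_assoc, vecMulVec_mul_vecMulVec,
      vecMulVec_smul, smul_smul, dotProduct_comm z.1 e, sq]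
  have h0 := (h.fourth_moment _ hA).dotProduct_mulVec_nonneg k
  rw [star_trivial, sub_mulVec, dotProduct_sub, dotProduct_matExp_mulVec] at h0
  · simp only [hF, smul_mulVec, dotProduct_smul, smul_eq_mul, dotProduct_vecMulVec_mulVec,
      ← sq] at h0
    have htr : (S * vecMulVec e e).trace = sqNorm S e := by
      rw [mul_vecMulVec, trace_vecMulVec, sqNorm, dotProduct_comm]
    rw [htr] at h0
    change 0 ≤ ψ * sqNorm S e * sqNorm S k - _ at h0
    linarith
  · intro i j
    have hm : ∀ i, Measurable fun z : Obs d => z.1 i := fun i => by fun_prop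
    have hme : ∀ i, Measurable fun z : Obs d => (e ⬝ᵥ z.1) * z.1 i := fun i => by
      simp only [dotProduct]; fun_prop
    have hs : ∀ i, Integrable (fun z : Obs d => ((e ⬝ᵥ z.1) * z.1 i) ^ 2) P := by
      intro i
      have := integrable_quartic h.fourth_integrable e (Pi.single i 1)
      simpa [mul_pow] using this
    have := integrable_mul_of_sq (hme i).aestronglyMeasurable (hme j).aestronglyMeasurable
      (hs i) (hs j)
    refine this.congr (ae_of_all _ fun z => ?_)
    simp only [hF, Matrix.smul_apply, vecMulVec_apply, smul_eq_mul]
    ring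

lemma MemClass.integrable_noise (h : MemClass σ ψ M S T P Q wstar) (k : Fin d → ℝ) :
    Integrable (fun z : Obs d => (z.2 - wstar ⬝ᵥ z.1) ^ 2 * (k ⬝ᵥ z.1) ^ 2) P := by
  have hm : ∀ i, Measurable fun z : Obs d => (z.2 - z.1 ⬝ᵥ wstar) * z.1 i := fun i => by
    simp only [dotProduct]; fun_prop
  have hz : ∀ i, MemLp (fun z : Obs d => (z.2 - z.1 ⬝ᵥ wstar) * z.1 i) 2 P := fun i =>
    (memLp_two_iff_integrable_sq (hm i).aestronglyMeasurable).2 <| by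
      simpa only [mul_pow] using h.noise_integrable i
  have : MemLp (fun z : Obs d => (z.2 - wstar ⬝ᵥ z.1) * (k ⬝ᵥ z.1)) 2 P := by
    have e : (fun z : Obs d => (z.2 - wstar ⬝ᵥ z.1) * (k ⬝ᵥ z.1)) =
        fun z => ∑ i, k i * ((z.2 - z.1 ⬝ᵥ wstar) * z.1 i) := by
      ext z
      rw [dotProduct_comm wstar]
      simp only [dotProduct, Finset.mul_sum]
      exact Finset.sum_congr rfl fun i _ => by ring
    rw [e]
    exact memLp_finsetSum _ fun i _ => (hz i).const_mul _
  simpa only [mul_pow] using this.integrable_sq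

lemma MemClass.integral_noise_le (h : MemClass σ ψ M S T P Q wstar) (k : Fin d → ℝ) :
    ∫ z, (z.2 - wstar ⬝ᵥ z.1) ^ 2 * (k ⬝ᵥ z.1) ^ 2 ∂P ≤ σ ^ 2 * sqNorm S k := by
  have h0 := h.noise.dotProduct_mulVec_nonneg k
  rw [star_trivial, sub_mulVec, dotProduct_sub, dotProduct_matExp_mulVec] at h0
  · simp only [smul_mulVec, dotProduct_smul, smul_eq_mul, dotProduct_vecMulVec_mulVec, ← sq] at h0
    change 0 ≤ σ ^ 2 * sqNorm S k - _ at h0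
    simp only [dotProduct_comm _ wstar] at h0
    linarith
  · intro i j
    have hm : ∀ i, Measurable fun z : Obs d => (z.2 - z.1 ⬝ᵥ wstar) * z.1 i := fun i => by
      simp only [dotProduct]; fun_prop
    have := integrable_mul_of_sq (hm i).aestronglyMeasurable (hm j).aestronglyMeasurable
      (by simpa only [mul_pow] using h.noise_integrable i)
      (by simpa only [mul_pow] using h.noise_integrable j)
    refine this.congr (ae_of_all _ fun z => ?_)
    simp only [Matrix.smul_apply, vecMulVec_apply, smul_eq_mul]
    ring

/-- Second moment bound for one stochastic gradient step with the past held fixed: the stochastic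
gradient at `wstar + e` has mean `S e` and its fluctuation adds at most
`(2σ² + 2ψ‖e‖_S²) ‖k‖_S²` in the direction `k`. -/
lemma MemClass.lintegral_step_le (h : MemClass σ ψ M S T P Q wstar) (e k : Fin d → ℝ) (L : ℝ) :
    ∫⁻ z, ENNReal.ofReal ((L + k ⬝ᵥ (S *ᵥ e)
        - ((e ⬝ᵥ z.1) - (z.2 - wstar ⬝ᵥ z.1)) * (k ⬝ᵥ z.1)) ^ 2) ∂P
      ≤ ENNReal.ofReal (L ^ 2 + (2 * σ ^ 2 + 2 * ψ * sqNorm S e) * sqNorm S k) := by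
  have := h.source.prob
  have he := h.source.memLp_dotProduct e
  have hk := h.source.memLp_dotProduct k
  have hr := h.source.memLp_residual wstar
  set Y : Obs d → ℝ := fun z => ((e ⬝ᵥ z.1) - (z.2 - wstar ⬝ᵥ z.1)) * (k ⬝ᵥ z.1) with hY
  have hYi : Integrable Y P := (he.sub hr).integrable_mul hk
  have i1 := integrable_quartic h.fourth_integrable e k
  have i2 := h.integrable_noise k
  have hYle : ∀ z, Y z ^ 2 ≤ 2 * ((e ⬝ᵥ z.1) ^ 2 * (k ⬝ᵥ z.1) ^ 2)
      + 2 * ((z.2 - wstar ⬝ᵥ z.1) ^ 2 * (k ⬝ᵥ z.1) ^ 2) := by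
    intro z
    have := mul_nonneg (sq_nonneg ((e ⬝ᵥ z.1) + (z.2 - wstar ⬝ᵥ z.1))) (sq_nonneg (k ⬝ᵥ z.1))
    simp only [hY]
    nlinarith
  have hYsq : Integrable (fun z => Y z ^ 2) P := by
    refine ((i1.const_mul 2).add (i2.const_mul 2)).mono' (hYi.aestronglyMeasurable.pow 2)
      (ae_of_all _ fun z => ?_)
    rw [Real.norm_of_nonneg (sq_nonneg _)]
    exact hYle z
  have hEY : ∫ z, Y z ∂P = k ⬝ᵥ (S *ᵥ e) := by
    have : ∀ z, Y z = (k ⬝ᵥ z.1) * (e ⬝ᵥ z.1) - (z.2 - wstar ⬝ᵥ z.1) * (k ⬝ᵥ z.1) := by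
      intro z; simp only [hY]; ring
    simp only [this]
    have j1 : Integrable (fun z : Obs d => (k ⬝ᵥ z.1) * (e ⬝ᵥ z.1)) P := hk.integrable_mul he
    have j2 : Integrable (fun z : Obs d => (z.2 - wstar ⬝ᵥ z.1) * (k ⬝ᵥ z.1)) P :=
      hr.integrable_mul hk
    rw [integral_sub j1 j2, h.source.integral_mul,
      h.source.integral_residual_mul h.source_min, sub_zero]
  have hEY2 : ∫ z, Y z ^ 2 ∂P ≤ (2 * σ ^ 2 + 2 * ψ * sqNorm S e) * sqNorm S k := by
    calc ∫ z, Y z ^ 2 ∂P ≤ ∫ z, (2 * ((e ⬝ᵥ z.1) ^ 2 * (k ⬝ᵥ z.1) ^ 2)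
          + 2 * ((z.2 - wstar ⬝ᵥ z.1) ^ 2 * (k ⬝ᵥ z.1) ^ 2)) ∂P :=
          integral_mono hYsq ((i1.const_mul 2).add (i2.const_mul 2)) hYle
      _ ≤ _ := by
          rw [integral_add (i1.const_mul 2) (i2.const_mul 2), integral_const_mul,
            integral_const_mul]
          linarith [h.integral_quartic_le e k, h.integral_noise_le k]
  set c := k ⬝ᵥ (S *ᵥ e)
  change ∫⁻ z, ENNReal.ofReal ((L + c - Y z) ^ 2) ∂P ≤ _
  have hexp : ∀ z, (L + c - Y z) ^ 2 = (L + c) ^ 2 - 2 * (L + c) * Y z + Y z ^ 2 := fun z => by ring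
  have i3 : Integrable (fun z => (L + c) ^ 2 - 2 * (L + c) * Y z) P :=
    (integrable_const _).sub (hYi.const_mul _)
  rw [← ofReal_integral_eq_lintegral_ofReal]
  · refine ENNReal.ofReal_le_ofReal ?_
    simp only [hexp]
    rw [integral_add i3 hYsq, integral_sub (integrable_const _) (hYi.const_mul _),
      integral_const_mul, hEY]
    simp only [integral_const, probReal_univ, one_smul]
    -- Because Y has mean c, the expansion leaves L² - c² + E Y², and -c² is dropped.
    nlinarith [sq_nonneg c]
  · simp only [hexp]
    exact i3.add hYsq
  · exact ae_of_all _ fun z => sq_nonneg _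

end MemClass

/-! ### Propagation of second moments through the iteration -/

/-- One step of noiseless accelerated gradient descent in an eigendirection with eigenvalue `lam`. -/
def coordStep (α β δ γ lam : ℝ) (x : ℝ × ℝ) : ℝ × ℝ :=
  ((1 - δ * lam) * (α * x.1 + (1 - α) * x.2),
    (β - γ * lam) * (α * x.1 + (1 - α) * x.2) + (1 - β) * x.2)

/-- The trajectory of `coordStep` that is at `x` up to time `s`. -/
def traj (α β : ℝ) (δ γ : ℕ → ℝ) (lam : ℝ) (s : ℕ) (x : ℝ × ℝ) : ℕ → ℝ × ℝ
  | 0 => x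
  | t + 1 => if s ≤ t then coordStep α β (δ t) (γ t) lam (traj α β δ γ lam s x t) else x

lemma traj_of_le {α β : ℝ} {δ γ : ℕ → ℝ} {lam : ℝ} {s : ℕ} {x : ℝ × ℝ} {t : ℕ} (h : t ≤ s) :
    traj α β δ γ lam s x t = x := by
  cases t with
  | zero => rfl
  | succ t => rw [traj, if_neg (by omega)]

lemma traj_succ {α β : ℝ} {δ γ : ℕ → ℝ} {lam : ℝ} {s : ℕ} {x : ℝ × ℝ} {t : ℕ} (h : s ≤ t) :
    traj α β δ γ lam s x (t + 1) = coordStep α β (δ t) (γ t) lam (traj α β δ γ lam s x t) := by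
  rw [traj, if_pos h]

/-- Fubini in one observation. It plays the role of conditioning on the past: iterates that do not
depend on observation i stay fixed under the inner integral. -/
lemma lintegral_pi_update {n : ℕ} {X : Type*} [MeasurableSpace X] (P : Measure X)
    [IsProbabilityMeasure P] (i : Fin n) {F : (Fin n → X) → ℝ≥0∞} (hF : Measurable F) :
    ∫⁻ D, F D ∂(Measure.pi fun _ : Fin n => P) =
      ∫⁻ D, ∫⁻ z, F (Function.update D i z) ∂P ∂(Measure.pi fun _ : Fin n => P) := by
  have hG : Measurable fun D => ∫⁻ z, F (Function.update D i z) ∂P := by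
    have : Measurable fun p : (Fin n → X) × X => F (Function.update p.1 i p.2) := by
      apply hF.comp
      rw [measurable_pi_iff]
      intro j
      by_cases hj : j = i
      · subst hj; simpa using measurable_snd
      · simp only [Function.update_of_ne hj]
        fun_prop
    exact this.lintegral_prod_right'
  refine lintegral_eq_of_lmarginal_eq {i} hF hG ?_
  ext D
  rw [lmarginal_singleton, lmarginal_singleton]
  simp [Function.update_idem]

lemma measurable_asgdIter {d n : ℕ} (δ γ α β : ℝ) (t : ℕ) :
    Measurable fun D : Fin n → Obs d => asgdIter δ γ α β D t := by
  induction t with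
  | zero => exact measurable_const
  | succ t ih =>
    simp only [asgdIter]
    split_ifs with h
    · have h1 := ih.fst
      have h2 := ih.snd
      have hx : Measurable fun D : Fin n → Obs d => (D ⟨t, h⟩).1 := by fun_prop
      have hy : Measurable fun D : Fin n → Obs d => (D ⟨t, h⟩).2 := by fun_prop
      have hu : Measurable fun D : Fin n → Obs d =>
          α • (asgdIter δ γ α β D t).1 + (1 - α) • (asgdIter δ γ α β D t).2 := by fun_prop
      have hd : Measurable fun D : Fin n → Obs d => (D ⟨t, h⟩).1 ⬝ᵥ
          (α • (asgdIter δ γ α β D t).1 + (1 - α) • (asgdIter δ γ α β D t).2) := by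
        simp only [dotProduct]
        exact Finset.measurable_sum _ fun j _ =>
          ((measurable_pi_apply j).comp hx).mul ((measurable_pi_apply j).comp hu)
      fun_prop
    · exact ih.fst.prodMk ih.snd

/-- Iterate t uses only the observations numbered below t. -/
lemma asgdIter_update {d n : ℕ} (δ γ α β : ℝ) (D : Fin n → Obs d) (i : Fin n) (z : Obs d) {t : ℕ}
    (ht : t ≤ i) :
    asgdIter δ γ α β (Function.update D i z) t = asgdIter δ γ α β D t := by
  induction t with
  | zero => rfl
  | succ t ih =>
    have hne : ∀ h : t < n, (⟨t, h⟩ : Fin n) ≠ i := fun h he => by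
      have := congrArg Fin.val he
      simp only at this
      omega
    simp only [asgdIter]
    rw [ih (by omega)]
    split_ifs with h
    · rw [Function.update_of_ne (hne h)]
    · rfl

/-- The point at which accelerated SGD evaluates its stochastic gradient. -/
def queryPoint {d n : ℕ} (δ γ α β : ℝ) (D : Fin n → Obs d) (t : ℕ) : Fin d → ℝ :=
  α • (asgdIter δ γ α β D t).1 + (1 - α) • (asgdIter δ γ α β D t).2

/-- A linear functional of the error of the iterates. -/
def errFunctional {d n : ℕ} (δ γ α β : ℝ) (wstar p q : Fin d → ℝ) (t : ℕ) (D : Fin n → Obs d) : ℝ :=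
  ∑ j, (p j * ((asgdIter δ γ α β D t).1 j - wstar j)
    + q j * ((asgdIter δ γ α β D t).2 j - wstar j))

lemma measurable_errFunctional {d n : ℕ} (δ γ α β : ℝ) (wstar p q : Fin d → ℝ) (t : ℕ) :
    Measurable (errFunctional (n := n) δ γ α β wstar p q t) := by
  have h := measurable_asgdIter (d := d) (n := n) δ γ α β t
  have h1 := fun j => (measurable_pi_apply j).comp h.fst
  have h2 := fun j => (measurable_pi_apply j).comp h.snd
  exact Finset.measurable_sum _ fun j _ =>
    (((h1 j).sub_const _).const_mul _).add (((h2 j).sub_const _).const_mul _)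

/-- The adjoint of one step, acting on linear functionals of the error. -/
lemma errFunctional_succ {d n : ℕ} (δ γ α β : ℝ) (lam wstar p q : Fin d → ℝ) {t : ℕ} (ht : t < n)
    (D : Fin n → Obs d) (z : Obs d) :
    errFunctional δ γ α β wstar p q (t + 1) (Function.update D ⟨t, ht⟩ z) =
      errFunctional δ γ α β wstar
        (fun j => (p j * (1 - δ / 4 ^ (t / stageLen n) * lam j)
          + q j * (β - γ / 4 ^ (t / stageLen n) * lam j)) * α)
        (fun j => (p j * (1 - δ / 4 ^ (t / stageLen n) * lam j)
          + q j * (β - γ / 4 ^ (t / stageLen n) * lam j)) * (1 - α) + q j * (1 - β)) t D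
      + (fun j => p j * (δ / 4 ^ (t / stageLen n)) + q j * (γ / 4 ^ (t / stageLen n))) ⬝ᵥ
          (diagonal lam *ᵥ (queryPoint δ γ α β D t - wstar))
      - ((queryPoint δ γ α β D t - wstar) ⬝ᵥ z.1 - (z.2 - wstar ⬝ᵥ z.1)) *
        ((fun j => p j * (δ / 4 ^ (t / stageLen n)) + q j * (γ / 4 ^ (t / stageLen n))) ⬝ᵥ z.1) := by
  set dt := δ / 4 ^ (t / stageLen n)
  set gt := γ / 4 ^ (t / stageLen n)
  have hG : (queryPoint δ γ α β D t - wstar) ⬝ᵥ z.1 - (z.2 - wstar ⬝ᵥ z.1)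
      = z.1 ⬝ᵥ queryPoint δ γ α β D t - z.2 := by
    rw [sub_dotProduct, dotProduct_comm z.1]; ring
  rw [hG]
  have hstep : asgdIter δ γ α β (Function.update D ⟨t, ht⟩ z) (t + 1) =
      (queryPoint δ γ α β D t - dt • ((z.1 ⬝ᵥ queryPoint δ γ α β D t - z.2) • z.1),
       β • queryPoint δ γ α β D t + (1 - β) • (asgdIter δ γ α β D t).2
        - gt • ((z.1 ⬝ᵥ queryPoint δ γ α β D t - z.2) • z.1)) := by
    rw [asgdIter, asgdIter_update _ _ _ _ _ _ _ le_rfl]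
    simp only [dif_pos ht, Function.update_self]
    rfl
  simp only [errFunctional, hstep]
  generalize z.1 ⬝ᵥ queryPoint δ γ α β D t - z.2 = G
  simp only [mulVec_diagonal, dotProduct]
  rw [Finset.mul_sum, ← Finset.sum_add_distrib, ← Finset.sum_sub_distrib]
  refine Finset.sum_congr rfl fun j _ => ?_
  simp only [queryPoint, Pi.sub_apply, Pi.add_apply, Pi.smul_apply, smul_eq_mul]
  ring

/-- Propagation of second moments: a linear functional of the error splits into the noiseless
trajectory and the responses to the gradient noise of each step. -/
lemma MemClass.lintegral_errFunctional_le {d : ℕ} {σ ψ : ℝ} {M T : Matrix (Fin d) (Fin d) ℝ}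
    {P Q : Measure (Obs d)} {lam wstar : Fin d → ℝ}
    (h : MemClass σ ψ M (diagonal lam) T P Q wstar) (hlam : ∀ j, 0 ≤ lam j) (hψ : 0 ≤ ψ)
    {n : ℕ} (δ γ α β : ℝ) (ν : ℕ → ℝ) (hν0 : ∀ t, 0 ≤ ν t) (t : ℕ) (ht : t ≤ n)
    (hν : ∀ τ < t, ∫⁻ D, ENNReal.ofReal (2 * σ ^ 2 + 2 * ψ * sqNorm (diagonal lam)
      (queryPoint δ γ α β D τ - wstar)) ∂(Measure.pi fun _ : Fin n => P) ≤ ENNReal.ofReal (ν τ))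
    (p q : Fin d → ℝ) :
    ∫⁻ D, ENNReal.ofReal (errFunctional δ γ α β wstar p q t D ^ 2)
        ∂(Measure.pi fun _ : Fin n => P) ≤
      ENNReal.ofReal ((∑ j,
          (p j * (traj α β (fun t => δ / 4 ^ (t / stageLen n)) (fun t => γ / 4 ^ (t / stageLen n))
              (lam j) 0 (-wstar j, -wstar j) t).1
          + q j * (traj α β (fun t => δ / 4 ^ (t / stageLen n)) (fun t => γ / 4 ^ (t / stageLen n))
              (lam j) 0 (-wstar j, -wstar j) t).2)) ^ 2
        + ∑ τ ∈ Finset.range t, ν τ * ∑ j, lam j *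
          (p j * (traj α β (fun t => δ / 4 ^ (t / stageLen n)) (fun t => γ / 4 ^ (t / stageLen n))
              (lam j) (τ + 1) (δ / 4 ^ (τ / stageLen n), γ / 4 ^ (τ / stageLen n)) t).1
          + q j * (traj α β (fun t => δ / 4 ^ (t / stageLen n)) (fun t => γ / 4 ^ (t / stageLen n))
              (lam j) (τ + 1) (δ / 4 ^ (τ / stageLen n), γ / 4 ^ (τ / stageLen n)) t).2) ^ 2) := by
  have := h.source.prob
  induction t generalizing p q with
  | zero =>
    simp [errFunctional, asgdIter, traj]
  | succ t ih =>
    set K : Fin d → ℝ := fun j => p j * (1 - δ / 4 ^ (t / stageLen n) * lam j)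
          + q j * (β - γ / 4 ^ (t / stageLen n) * lam j) with hK
    set k : Fin d → ℝ :=
      fun j => p j * (δ / 4 ^ (t / stageLen n)) + q j * (γ / 4 ^ (t / stageLen n)) with hk
    -- The coefficients p, q are general in the induction because the hypothesis is applied to the
    -- functional pulled back by one step.
    have hIH := ih (by omega) (fun τ hτ => hν τ (by omega)) (fun j => K j * α)
      (fun j => K j * (1 - α) + q j * (1 - β))
    have hmeas : Measurable fun D : Fin n → Obs d =>
        ENNReal.ofReal (errFunctional δ γ α β wstar p q (t + 1) D ^ 2) :=
      ((measurable_errFunctional δ γ α β wstar p q (t + 1)).pow_const 2).ennreal_ofReal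
    have hkk : 0 ≤ sqNorm (diagonal lam) k := by
      rw [sqNorm_diagonal]
      exact Finset.sum_nonneg fun j _ => mul_nonneg (hlam j) (sq_nonneg _)
    rw [lintegral_pi_update P ⟨t, ht⟩ hmeas]
    calc _ ≤ ∫⁻ D, (ENNReal.ofReal (errFunctional δ γ α β wstar (fun j => K j * α)
            (fun j => K j * (1 - α) + q j * (1 - β)) t D ^ 2)
          + ENNReal.ofReal (2 * σ ^ 2 + 2 * ψ * sqNorm (diagonal lam)
            (queryPoint δ γ α β D t - wstar)) * ENNReal.ofReal (sqNorm (diagonal lam) k))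
            ∂(Measure.pi fun _ : Fin n => P) := by
          refine lintegral_mono fun D => ?_
          simp only [errFunctional_succ δ γ α β lam wstar p q ht D]
          refine (h.lintegral_step_le _ _ _).trans ?_
          have hV : 0 ≤ sqNorm (diagonal lam) (queryPoint δ γ α β D t - wstar) := by
            rw [sqNorm_diagonal]
            exact Finset.sum_nonneg fun j _ => mul_nonneg (hlam j) (sq_nonneg _)
          rw [← ENNReal.ofReal_mul (by positivity), ← ENNReal.ofReal_add (by positivity)
            (by positivity)]
      _ = ∫⁻ D, ENNReal.ofReal (errFunctional δ γ α β wstar (fun j => K j * α)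
            (fun j => K j * (1 - α) + q j * (1 - β)) t D ^ 2) ∂(Measure.pi fun _ : Fin n => P)
          + (∫⁻ D, ENNReal.ofReal (2 * σ ^ 2 + 2 * ψ * sqNorm (diagonal lam)
            (queryPoint δ γ α β D t - wstar)) ∂(Measure.pi fun _ : Fin n => P)) *
            ENNReal.ofReal (sqNorm (diagonal lam) k) := by
          rw [lintegral_add_left, lintegral_mul_const' _ _ ENNReal.ofReal_ne_top]
          exact ((measurable_errFunctional δ γ α β wstar _ _ t).pow_const 2).ennreal_ofReal
      _ ≤ _ := by
          refine (add_le_add hIH (mul_le_mul_left (hν t (by omega)) _)).trans ?_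
          rw [← ENNReal.ofReal_mul (hν0 t), ← ENNReal.ofReal_add]
          · refine ENNReal.ofReal_le_ofReal (le_of_eq ?_)
            rw [Finset.sum_range_succ, add_assoc]
            congr 1
            · congr 1
              refine Finset.sum_congr rfl fun j _ => ?_
              -- Duality: the pulled-back functional at time t equals the original functional at
              -- time t + 1 along the same trajectory.
              rw [traj_succ (Nat.zero_le t)]
              simp only [coordStep, hK]
              ring
            · congr 1
              · refine Finset.sum_congr rfl fun τ hτ => ?_
                have hτ' : τ + 1 ≤ t := Finset.mem_range.1 hτ
                congr 1
                refine Finset.sum_congr rfl fun j _ => ?_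
                rw [traj_succ hτ']
                simp only [coordStep, hK]
                ring
              · congr 1
                rw [sqNorm_diagonal]
                refine Finset.sum_congr rfl fun j _ => ?_
                rw [traj_of_le le_rfl]
          · refine add_nonneg (sq_nonneg _) (Finset.sum_nonneg fun τ _ =>
              mul_nonneg (hν0 τ) (Finset.sum_nonneg fun j _ => mul_nonneg (hlam j) (sq_nonneg _)))
          · exact mul_nonneg (hν0 t) hkk

/-! ### The Lyapunov function in one eigendirection -/

/-- Conditions on the parameters of accelerated gradient descent (with `α = 1 - β`) in an
eigendirection with eigenvalue `lam`. -/
structure StepParams (β δ γ lam : ℝ) : Prop where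
  beta_pos : 0 < β
  beta_le : β ≤ 1 / 2
  delta_pos : 0 < δ
  delta_le : δ ≤ γ
  momentum : 4 * γ * β ≤ δ
  lam_pos : 0 < lam
  delta_lam : δ * lam ≤ 1

lemma StepParams.gamma_pos {β δ γ lam : ℝ} (h : StepParams β δ γ lam) : 0 < γ :=
  h.delta_pos.trans_le h.delta_le

/-- The conditions are homogeneous in (δ, γ) or improve as δ shrinks, so they persist in later
stages. -/
lemma StepParams.div {β δ γ lam : ℝ} (h : StepParams β δ γ lam) {c : ℝ} (hc : 1 ≤ c) :
    StepParams β (δ / c) (γ / c) lam where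
  beta_pos := h.beta_pos
  beta_le := h.beta_le
  delta_pos := div_pos h.delta_pos (by linarith)
  delta_le := div_le_div_of_nonneg_right h.delta_le (by linarith)
  momentum := by
    rw [show 4 * (γ / c) * β = 4 * γ * β / c by ring]
    exact div_le_div_of_nonneg_right h.momentum (by linarith)
  lam_pos := h.lam_pos
  delta_lam := (mul_le_mul_of_nonneg_right (div_le_self h.delta_pos.le hc) h.lam_pos.le).trans
    h.delta_lam

/-- The query point in one coordinate. -/
def look (α : ℝ) (x : ℝ × ℝ) : ℝ := α * x.1 + (1 - α) * x.2

/-- Weight of the first component in the potential. -/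
def potWeight (β γ lam : ℝ) : ℝ := if 2 * β < γ * lam then γ * lam / β else 1

/-- Lyapunov function of accelerated gradient descent in an eigendirection. -/
def pot (β γ lam : ℝ) (x : ℝ × ℝ) : ℝ := (1 - β) * potWeight β γ lam * x.1 ^ 2 + x.2 ^ 2

lemma one_le_potWeight {β γ lam : ℝ} (hβ : 0 < β) : 1 ≤ potWeight β γ lam := by
  unfold potWeight
  split_ifs with h
  · rw [le_div_iff₀ hβ]; linarith
  · exact le_rfl

/-- The weight jumps up, from 1 to at least 2, as γλ crosses 2β. Hence a decrease of the step size
between stages can only lower the potential. -/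
lemma potWeight_mono {β γ γ' lam : ℝ} (hβ : 0 < β) (hlam : 0 < lam) (h : γ ≤ γ') :
    potWeight β γ lam ≤ potWeight β γ' lam := by
  have h1 : γ * lam ≤ γ' * lam := mul_le_mul_of_nonneg_right h hlam.le
  by_cases h2 : 2 * β < γ * lam
  · rw [potWeight, potWeight, if_pos h2, if_pos (h2.trans_le h1)]
    exact div_le_div_of_nonneg_right h1 hβ.le
  · rw [potWeight, if_neg h2]
    exact one_le_potWeight hβ

lemma pot_mono {β γ γ' lam : ℝ} (hβ : 0 < β) (hβ' : β ≤ 1 / 2) (hlam : 0 < lam) (h : γ ≤ γ')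
    (x : ℝ × ℝ) : pot β γ lam x ≤ pot β γ' lam x := by
  have h1 := mul_le_mul_of_nonneg_left (potWeight_mono hβ hlam h) (by linarith : 0 ≤ 1 - β)
  have h2 := mul_le_mul_of_nonneg_right h1 (sq_nonneg x.1)
  unfold pot
  linarith

lemma pot_nonneg {β γ lam : ℝ} (hβ : 0 < β) (hβ' : β ≤ 1 / 2) (x : ℝ × ℝ) :
    0 ≤ pot β γ lam x := by
  have h1 : 0 ≤ (1 - β) * potWeight β γ lam :=
    mul_nonneg (by linarith) (by linarith [one_le_potWeight (γ := γ) (lam := lam) hβ])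
  have h2 := mul_nonneg h1 (sq_nonneg x.1)
  unfold pot
  linarith [sq_nonneg x.2]

/-- Convexity of the square, with weights 1 - β and β; `h3` is the Jensen gap. -/
lemma sq_look_le_pot {β γ lam : ℝ} (hβ : 0 < β) (hβ' : β ≤ 1 / 2) (x : ℝ × ℝ) :
    look (1 - β) x ^ 2 ≤ pot β γ lam x := by
  have h1 : (1 - β) * 1 ≤ (1 - β) * potWeight β γ lam :=
    mul_le_mul_of_nonneg_left (one_le_potWeight hβ) (by linarith)
  have h2 := mul_le_mul_of_nonneg_right h1 (sq_nonneg x.1)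
  have h3 : 0 ≤ β * (1 - β) * (x.1 - x.2) ^ 2 :=
    mul_nonneg (mul_nonneg hβ.le (by linarith)) (sq_nonneg _)
  have h4 : 0 ≤ (1 - β) * x.2 ^ 2 := mul_nonneg (by linarith) (sq_nonneg _)
  unfold pot look
  nlinarith

lemma sq_fst_le_pot {β γ lam : ℝ} (hβ : 0 < β) (hβ' : β ≤ 1 / 2) (x : ℝ × ℝ) :
    x.1 ^ 2 ≤ 2 * pot β γ lam x := by
  have h1 : (1 / 2 : ℝ) * 1 ≤ (1 - β) * potWeight β γ lam :=
    mul_le_mul (by linarith) (one_le_potWeight hβ) (by norm_num) (by linarith)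
  have h2 := mul_le_mul_of_nonneg_right h1 (sq_nonneg x.1)
  unfold pot
  linarith [sq_nonneg x.2]

/-- In the accelerated regime the potential contracts. -/
lemma StepParams.pot_coordStep_high {β δ γ lam : ℝ} (h : StepParams β δ γ lam)
    (hh : 2 * β < γ * lam) (x : ℝ × ℝ) :
    pot β γ lam (coordStep (1 - β) β δ γ lam x) ≤ (1 - β) * pot β γ lam x
      - 1 / 2 * (γ * lam + (1 - β) * (γ * lam) / β * (δ * lam)) * look (1 - β) x ^ 2 := by
  have hβ := h.beta_pos
  have hβ' := h.beta_le
  have hw : potWeight β γ lam = γ * lam / β := if_pos hh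
  have he0 : 0 ≤ δ * lam := (mul_pos h.delta_pos h.lam_pos).le
  have he1 := h.delta_lam
  have hGe : 4 * (γ * lam) * β ≤ δ * lam := by nlinarith [h.momentum, h.lam_pos]
  unfold pot coordStep look
  rw [hw]
  generalize γ * lam = G at *
  generalize δ * lam = e at *
  obtain ⟨w, v⟩ := x
  simp only
  -- The weight a of w² satisfies βa = (1 - β)G, exactly what cancels the cross term u·v in the
  -- sum-of-squares identity `hid`.
  obtain ⟨a, ha⟩ : ∃ a, a = (1 - β) * (G / β) := ⟨_, rfl⟩
  have hab : β * a = (1 - β) * G := by rw [ha]; field_simp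
  have ha' : (1 - β) * G / β = a := by rw [ha]; ring
  rw [ha', ← ha]
  obtain ⟨u, hu⟩ : ∃ u, u = (1 - β) * w + (1 - (1 - β)) * v := ⟨_, rfl⟩
  rw [← hu]
  have hG : 0 < G := by linarith
  have ha0 : 0 < a := by rw [ha]; exact mul_pos (by linarith) (div_pos hG hβ)
  -- The momentum condition 4Gβ ≤ e enters here: the dissipation ae of the w-step must absorb the G²
  -- produced by the v-step.
  have hae : 2 * G ^ 2 ≤ a * e := by
    have h1 : β * (2 * G ^ 2) ≤ β * (a * e) := by
      have : β * (a * e) = (1 - β) * G * e := by rw [← hab]; ring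
      rw [this]
      have h2 : (1 / 2) * G * (4 * G * β) ≤ (1 - β) * G * e :=
        mul_le_mul (mul_le_mul_of_nonneg_right (by linarith) hG.le) hGe (by positivity)
          (mul_nonneg (by linarith) hG.le)
      linarith
    exact le_of_mul_le_mul_left h1 hβ
  -- Here G/2 ≥ β by the fast regime, and ae(3/2 - e) ≥ ae/2 ≥ G².
  have hc : 0 ≤ 1 / 2 * G - β + β * G + a * e * (3 / 2 - e) - G ^ 2 := by
    have h1 : a * e * (1 / 2) ≤ a * e * (3 / 2 - e) :=
      mul_le_mul_of_nonneg_left (by linarith) (mul_nonneg ha0.le he0)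
    have h2 : 0 ≤ β * G := (mul_pos hβ hG).le
    linarith
  have t1 : 0 ≤ β * (1 - β) * (u - v) ^ 2 :=
    mul_nonneg (mul_nonneg hβ.le (by linarith)) (sq_nonneg _)
  have t2 : 0 ≤ a * (1 - β) * (u - w) ^ 2 :=
    mul_nonneg (mul_nonneg ha0.le (by linarith)) (sq_nonneg _)
  have t3 := mul_nonneg hc (sq_nonneg u)
  have hid : (1 - β) * (a * w ^ 2 + v ^ 2) - 1 / 2 * (G + a * e) * u ^ 2
      - (a * ((1 - e) * u) ^ 2 + ((β - G) * u + (1 - β) * v) ^ 2)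
      = β * (1 - β) * (u - v) ^ 2 + a * (1 - β) * (u - w) ^ 2
        + (1 / 2 * G - β + β * G + a * e * (3 / 2 - e) - G ^ 2) * u ^ 2 := by
    linear_combination (-2 * a * u) * hu + (u ^ 2 - 2 * u * v) * hab
  linarith

/-- Below the accelerated regime the potential does not increase. -/
lemma StepParams.pot_coordStep_low {β δ γ lam : ℝ} (h : StepParams β δ γ lam)
    (hh : ¬ 2 * β < γ * lam) (x : ℝ × ℝ) :
    pot β γ lam (coordStep (1 - β) β δ γ lam x) ≤ pot β γ lam x := by
  have hβ := h.beta_pos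
  have hβ' := h.beta_le
  have hw : potWeight β γ lam = 1 := if_neg hh
  have he0 : 0 ≤ δ * lam := (mul_pos h.delta_pos h.lam_pos).le
  have he1 := h.delta_lam
  have hG : 0 < γ * lam := mul_pos h.gamma_pos h.lam_pos
  unfold pot coordStep
  rw [hw]
  generalize γ * lam = G at *
  generalize δ * lam = e at *
  obtain ⟨w, v⟩ := x
  simp only
  obtain ⟨u, hu⟩ : ∃ u, u = (1 - β) * w + (1 - (1 - β)) * v := ⟨_, rfl⟩
  rw [← hu]
  have hu2 : u ^ 2 ≤ (1 - β) * w ^ 2 + β * v ^ 2 := by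
    have : 0 ≤ β * (1 - β) * (w - v) ^ 2 :=
      mul_nonneg (mul_nonneg hβ.le (by linarith)) (sq_nonneg _)
    rw [hu]; nlinarith
  have h1 : ((1 - e) * u) ^ 2 ≤ u ^ 2 := by
    rw [mul_pow]
    exact mul_le_of_le_one_left (sq_nonneg _) (by nlinarith)
  have h2 : ((β - G) * u + (1 - β) * v) ^ 2 ≤ β * u ^ 2 + (1 - β) * v ^ 2 := by
    have hB : (β - G) ^ 2 ≤ β ^ 2 := by nlinarith
    -- This holds exactly for 0 ≤ G ≤ 2β and dictates the threshold 2β.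
    have hB1 : |β - G| ≤ β := by rw [abs_le]; constructor <;> linarith
    have h3 : (β - G) * (2 * (u * v)) ≤ β * (u ^ 2 + v ^ 2) := by
      calc (β - G) * (2 * (u * v)) ≤ |(β - G) * (2 * (u * v))| := le_abs_self _
        _ = |β - G| * |2 * (u * v)| := abs_mul _ _
        _ ≤ β * (u ^ 2 + v ^ 2) := by
          refine mul_le_mul hB1 ?_ (abs_nonneg _) hβ.le
          rw [abs_le]
          constructor <;> nlinarith [sq_nonneg (u + v), sq_nonneg (u - v)]
    have h4 := mul_le_mul_of_nonneg_right hB (sq_nonneg u)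
    have h5 := mul_le_mul_of_nonneg_left h3 (by linarith : 0 ≤ 1 - β)
    nlinarith
  have h6 : (1 - β) * 1 * ((1 - e) * u) ^ 2 ≤ (1 - β) * u ^ 2 := by
    rw [mul_one]
    exact mul_le_mul_of_nonneg_left h1 (by linarith)
  nlinarith

/-! ### Decay of the potential along trajectories -/

section Traj

variable {β lam : ℝ} {δ γ : ℕ → ℝ} {s : ℕ} {x : ℝ × ℝ}

lemma pot_traj_succ_le (hp : ∀ t, StepParams β (δ t) (γ t) lam) (hγ : Antitone γ) {t : ℕ}
    (ht : s ≤ t) :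
    pot β (γ (t + 1)) lam (traj (1 - β) β δ γ lam s x (t + 1))
      ≤ pot β (γ t) lam (traj (1 - β) β δ γ lam s x t) := by
  have hβ := (hp 0).beta_pos
  have hβ' := (hp 0).beta_le
  rw [traj_succ ht]
  refine (pot_mono hβ hβ' (hp 0).lam_pos (hγ t.le_succ) _).trans ?_
  by_cases hh : 2 * β < γ t * lam
  · refine ((hp t).pot_coordStep_high hh _).trans ?_
    have h1 := mul_le_mul_of_nonneg_right (by linarith : 1 - β ≤ 1)
      (pot_nonneg (γ := γ t) (lam := lam) hβ hβ' (traj (1 - β) β δ γ lam s x t))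
    have h2 : 0 ≤ 1 / 2 * (γ t * lam + (1 - β) * (γ t * lam) / β * (δ t * lam)) *
        look (1 - β) (traj (1 - β) β δ γ lam s x t) ^ 2 := by
      have := (hp t).gamma_pos
      have := (hp t).delta_pos
      have := (hp t).lam_pos
      have : 0 < 1 - β := by linarith
      positivity
    linarith
  · exact (hp t).pot_coordStep_low hh _

lemma pot_traj_le (hp : ∀ t, StepParams β (δ t) (γ t) lam) (hγ : Antitone γ) {t t' : ℕ}
    (ht : s ≤ t) (htt : t ≤ t') :
    pot β (γ t') lam (traj (1 - β) β δ γ lam s x t')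
      ≤ pot β (γ t) lam (traj (1 - β) β δ γ lam s x t) := by
  induction t', htt using Nat.le_induction with
  | base => exact le_rfl
  | succ k hk ih => exact (pot_traj_succ_le hp hγ (ht.trans hk)).trans ih

lemma pot_traj_contract (hp : ∀ t, StepParams β (δ t) (γ t) lam) (hγ : Antitone γ) {t : ℕ}
    (ht : s ≤ t) (k : ℕ) (hh : ∀ i < k, 2 * β < γ (t + i) * lam) :
    pot β (γ (t + k)) lam (traj (1 - β) β δ γ lam s x (t + k))
      ≤ (1 - β) ^ k * pot β (γ t) lam (traj (1 - β) β δ γ lam s x t) := by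
  have hβ := (hp 0).beta_pos
  have hβ' := (hp 0).beta_le
  induction k with
  | zero => simp
  | succ k ih =>
    have ih := ih fun i hi => hh i (by omega)
    rw [← add_assoc, traj_succ (by omega)]
    refine (pot_mono hβ hβ' (hp 0).lam_pos (hγ (t + k).le_succ) _).trans ?_
    refine ((hp _).pot_coordStep_high (hh k k.lt_succ_self) _).trans ?_
    have h1 := mul_le_mul_of_nonneg_left ih (by linarith : 0 ≤ 1 - β)
    have h2 : 0 ≤ 1 / 2 * (γ (t + k) * lam + (1 - β) * (γ (t + k) * lam) / β * (δ (t + k) * lam)) *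
        look (1 - β) (traj (1 - β) β δ γ lam s x (t + k)) ^ 2 := by
      have := (hp (t + k)).gamma_pos
      have := (hp (t + k)).delta_pos
      have := (hp (t + k)).lam_pos
      have : 0 < 1 - β := by linarith
      positivity
    rw [pow_succ' (1 - β) k]
    linarith

/-- The dissipation term of `StepParams.pot_coordStep_high`, telescoped over time. -/
lemma sum_sq_look_le (hp : ∀ t, StepParams β (δ t) (γ t) lam) (hγ : Antitone γ) {t t' : ℕ}
    (ht : s ≤ t) (htt : t ≤ t') {m : ℝ}
    (hh : ∀ i ∈ Finset.Ico t t', 2 * β < γ i * lam)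
    (hm : ∀ i ∈ Finset.Ico t t',
      m ≤ 1 / 2 * (γ i * lam + (1 - β) * (γ i * lam) / β * (δ i * lam))) :
    m * ∑ i ∈ Finset.Ico t t', look (1 - β) (traj (1 - β) β δ γ lam s x i) ^ 2
      ≤ pot β (γ t) lam (traj (1 - β) β δ γ lam s x t) := by
  have hβ := (hp 0).beta_pos
  have hβ' := (hp 0).beta_le
  have key : m * ∑ i ∈ Finset.Ico t t', look (1 - β) (traj (1 - β) β δ γ lam s x i) ^ 2
      + pot β (γ t') lam (traj (1 - β) β δ γ lam s x t')
      ≤ pot β (γ t) lam (traj (1 - β) β δ γ lam s x t) := by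
    induction t', htt using Nat.le_induction with
    | base => simp
    | succ k hk ih =>
      have ih := ih (fun i hi => hh i (Finset.Ico_subset_Ico_right k.le_succ hi))
        (fun i hi => hm i (Finset.Ico_subset_Ico_right k.le_succ hi))
      have hkm : k ∈ Finset.Ico t (k + 1) := Finset.mem_Ico.2 ⟨hk, k.lt_succ_self⟩
      rw [Finset.sum_Ico_succ_top hk, traj_succ (ht.trans hk)]
      have h0 := (pot_mono hβ hβ' (hp 0).lam_pos (hγ k.le_succ)
        (coordStep (1 - β) β (δ k) (γ k) lam (traj (1 - β) β δ γ lam s x k))).trans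
        ((hp k).pot_coordStep_high (hh k hkm) _)
      have h1 := mul_le_mul_of_nonneg_right (by linarith : 1 - β ≤ 1)
        (pot_nonneg (γ := γ k) (lam := lam) hβ hβ' (traj (1 - β) β δ γ lam s x k))
      have h2 := mul_le_mul_of_nonneg_right (hm k hkm)
        (sq_nonneg (look (1 - β) (traj (1 - β) β δ γ lam s x k)))
      linarith
  linarith [pot_nonneg (γ := γ t') (lam := lam) hβ hβ' (traj (1 - β) β δ γ lam s x t')]

end Traj

/-! ### Responses to noise and bias under the stagewise step sizes -/

section Stages

variable {β δ γ lam : ℝ} {K : ℕ}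

lemma StepParams.stage (h : StepParams β δ γ lam) (K t : ℕ) :
    StepParams β (δ / 4 ^ (t / K)) (γ / 4 ^ (t / K)) lam :=
  h.div (one_le_pow₀ (by norm_num))

lemma antitone_stage {γ : ℝ} (hγ : 0 ≤ γ) (K : ℕ) : Antitone fun t : ℕ => γ / 4 ^ (t / K) := by
  intro s t hst
  exact div_le_div_of_nonneg_left hγ (by positivity)
    (pow_le_pow_right₀ (by norm_num) (Nat.div_le_div_right hst))

/-- The potential right after a kick by the noise of step `τ`. -/
lemma StepParams.pot_kick_le (h : StepParams β δ γ lam) (K τ : ℕ) :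
    pot β (γ / 4 ^ ((τ + 1) / K)) lam
      (traj (1 - β) β (fun t => δ / 4 ^ (t / K)) (fun t => γ / 4 ^ (t / K)) lam (τ + 1)
        (δ / 4 ^ (τ / K), γ / 4 ^ (τ / K)) (τ + 1)) ≤
    pot β (γ / 4 ^ (τ / K)) lam (δ / 4 ^ (τ / K), γ / 4 ^ (τ / K)) := by
  rw [traj_of_le le_rfl]
  exact pot_mono h.beta_pos h.beta_le h.lam_pos (antitone_stage h.gamma_pos.le K τ.le_succ) _

/-- Kicks are sorted at 8β, not at the threshold 2β: the factor 4 keeps a kick above 8β in the fast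
regime throughout the next stage as well. -/
lemma StepParams.pot_self_le_of_le (h : StepParams β δ γ lam) (h8 : γ * lam ≤ 8 * β) :
    pot β γ lam (δ, γ) ≤ 9 * γ ^ 2 := by
  have hβ := h.beta_pos
  have h1 : (1 - β) * potWeight β γ lam ≤ 8 := by
    have : potWeight β γ lam ≤ 8 := by
      unfold potWeight
      split_ifs
      · rwa [div_le_iff₀ hβ]
      · norm_num
    nlinarith [one_le_potWeight (γ := γ) (lam := lam) hβ]
  have h2 : δ ^ 2 ≤ γ ^ 2 := pow_le_pow_left₀ h.delta_pos.le h.delta_le 2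
  unfold pot
  simp only
  nlinarith [mul_le_mul_of_nonneg_right h1 (sq_nonneg δ)]

/-- The two components of the kick contribute at most γδ/β each, the first through δλ ≤ 1 and the
second through the momentum condition. -/
lemma StepParams.pot_self_high (h : StepParams β δ γ lam) (hh : 2 * β < γ * lam) :
    pot β γ lam (δ, γ) ≤ 2 * γ * δ / β := by
  have hβ := h.beta_pos
  have hβ' := h.beta_le
  have hγ := h.gamma_pos
  have hδ := h.delta_pos
  unfold pot
  rw [potWeight, if_pos hh]
  simp only
  rw [le_div_iff₀ hβ]
  have e : ((1 - β) * (γ * lam / β) * δ ^ 2 + γ ^ 2) * β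
      = (1 - β) * (γ * δ) * (δ * lam) + γ * (γ * β) := by
    field_simp
  rw [e]
  have h1 : (1 - β) * (γ * δ) * (δ * lam) ≤ 1 * (γ * δ) * 1 := by
    refine mul_le_mul ?_ h.delta_lam (mul_pos hδ h.lam_pos).le (by positivity)
    exact mul_le_mul_of_nonneg_right (by linarith) (by positivity)
  have h2 : γ * (γ * β) ≤ γ * δ := by
    refine mul_le_mul_of_nonneg_left ?_ hγ.le
    nlinarith [h.momentum, mul_pos hγ hβ]
  linarith

/-- Kick energy against dissipation in the accelerated regime. -/
lemma StepParams.sq_mul_pot_self_le (h : StepParams β δ γ lam) (hh : 2 * β < γ * lam) :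
    lam ^ 2 * pot β γ lam (δ, γ) ≤ (δ * lam + min (γ * lam) (2 * β * γ / δ)) *
      (γ * lam + (1 - β) * (γ * lam) / β * (δ * lam)) := by
  have hβ := h.beta_pos
  have hβ' := h.beta_le
  have hγ := h.gamma_pos
  have hδ := h.delta_pos
  have hl := h.lam_pos
  have hα : 0 < 1 - β := by linarith
  unfold pot
  rw [potWeight, if_pos hh]
  simp only
  set D := (1 - β) * (γ * lam) / β * (δ * lam) with hD
  have hD0 : 0 < D := by positivity
  have hG0 : 0 < γ * lam := by positivity
  have h1 : lam ^ 2 * ((1 - β) * (γ * lam / β) * δ ^ 2) = δ * lam * D := by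
    rw [hD]; ring
  -- Either dissipation term alone pays for γ²λ². Keeping the smaller cost permits the later
  -- interpolation between γλ and 2βγ/δ.
  have h2 : lam ^ 2 * γ ^ 2 ≤ min (γ * lam) (2 * β * γ / δ) * (γ * lam + D) := by
    rcases min_choice (γ * lam) (2 * β * γ / δ) with hm | hm <;> rw [hm]
    · nlinarith
    · have h3 : lam ^ 2 * γ ^ 2 ≤ 2 * β * γ / δ * D := by
        have : 2 * β * γ / δ * D = 2 * (1 - β) * (lam ^ 2 * γ ^ 2) := by
          rw [hD]; field_simp
        rw [this]
        nlinarith [mul_pos (pow_pos hl 2) (pow_pos hγ 2)]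
      have : 0 ≤ 2 * β * γ / δ * (γ * lam) := by positivity
      linarith
  rw [mul_add, h1, add_mul]
  have : 0 ≤ δ * lam * (γ * lam) := by positivity
  linarith

variable (h : StepParams β δ γ lam)
include h

/-- Two full stages after a kick in the accelerated regime the potential is small. -/
lemma StepParams.pot_kick_contract (hK : 0 < K) {τ t : ℕ} (h8 : 8 * β < γ / 4 ^ (τ / K) * lam)
    (ht : (τ / K + 2) * K ≤ t) :
    pot β (γ / 4 ^ (t / K)) lam
      (traj (1 - β) β (fun t => δ / 4 ^ (t / K)) (fun t => γ / 4 ^ (t / K)) lam (τ + 1)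
        (δ / 4 ^ (τ / K), γ / 4 ^ (τ / K)) t) ≤ (1 - β) ^ K * (2 * γ * δ / β) := by
  have hβ := h.beta_pos
  have hβ' := h.beta_le
  have hγ := h.gamma_pos
  have hδ := h.delta_pos
  set l := τ / K with hl
  have hτ : τ + 1 ≤ (l + 1) * K := by
    have := Nat.lt_div_mul_add hK (a := τ)
    rw [← hl] at this
    linarith
  have hA := antitone_stage (K := K) hγ.le
  have hp := fun t => h.stage K t
  have e1 : (l + 2) * K = (l + 1) * K + K := by ring
  refine (pot_traj_le hp hA (by omega) ht).trans ?_
  rw [e1]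
  -- A kick may come anywhere in stage l, so stage l + 1 is the first whole stage after it; there γ
  -- is four times smaller, and `h8` still gives the fast regime.
  refine (pot_traj_contract hp hA hτ K ?_).trans ?_
  · intro i hi
    have : ((l + 1) * K + i) / K = l + 1 := by
      rw [add_comm, Nat.add_mul_div_right _ _ hK, Nat.div_eq_of_lt hi, zero_add]
    rw [this, pow_succ, ← div_div, div_mul_eq_mul_div, lt_div_iff₀ (by norm_num)]
    linarith
  · refine mul_le_mul_of_nonneg_left ?_ (pow_nonneg (by linarith) _)
    refine (pot_traj_le hp hA le_rfl hτ).trans ((h.pot_kick_le K τ).trans ?_)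
    refine ((hp τ).pot_self_high (by linarith)).trans ?_
    refine div_le_div_of_nonneg_right ?_ hβ.le
    have h4 : (1 : ℝ) ≤ 4 ^ (τ / K) := one_le_pow₀ (by norm_num)
    have := mul_le_mul (div_le_self hγ.le h4) (div_le_self hδ.le h4) (by positivity) hγ.le
    linarith

/-- Total response at the query points to the noise of one step. -/
lemma StepParams.sum_kick_le (hK : 0 < K) {n N : ℕ} (hN : N ≤ n) (τ : ℕ) :
    lam ^ 2 * ∑ t ∈ Finset.Ico (τ + 1) N, look (1 - β)
      (traj (1 - β) β (fun t => δ / 4 ^ (t / K)) (fun t => γ / 4 ^ (t / K)) lam (τ + 1)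
        (δ / 4 ^ (τ / K), γ / 4 ^ (τ / K)) t) ^ 2
    ≤ 32 * (δ * lam) + (32 + 288 * (n * β)) * min (γ * lam) (2 * β * γ / δ)
      + lam ^ 2 * (n * ((1 - β) ^ K * (2 * γ * δ / β))) := by
  have hβ := h.beta_pos
  have hβ' := h.beta_le
  have hγ := h.gamma_pos
  have hδ := h.delta_pos
  have hl := h.lam_pos
  have hα : 0 < 1 - β := by linarith
  have hA := antitone_stage (K := K) hγ.le
  have hp := fun t => h.stage K t
  have hn : (N : ℝ) ≤ n := by exact_mod_cast hN
  have hn0 : (0 : ℝ) ≤ n := n.cast_nonneg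
  have h4 : (1 : ℝ) ≤ 4 ^ (τ / K) := one_le_pow₀ (by norm_num)
  have hgg : γ / 4 ^ (τ / K) ≤ γ := div_le_self hγ.le h4
  have hdd : δ / 4 ^ (τ / K) ≤ δ := div_le_self hδ.le h4
  have hg0 : 0 < γ / 4 ^ (τ / K) := by positivity
  have hd0 : 0 < δ / 4 ^ (τ / K) := by positivity
  have hmin0 : 0 ≤ min (γ * lam) (2 * β * γ / δ) := le_min (by positivity) (by positivity)
  have htail0 : 0 ≤ (n : ℝ) * ((1 - β) ^ K * (2 * γ * δ / β)) := by positivity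
  set f : ℕ → ℝ := fun t => look (1 - β)
      (traj (1 - β) β (fun t => δ / 4 ^ (t / K)) (fun t => γ / 4 ^ (t / K)) lam (τ + 1)
        (δ / 4 ^ (τ / K), γ / 4 ^ (τ / K)) t) ^ 2 with hf
  have hf0 : ∀ t, 0 ≤ f t := fun t => sq_nonneg _
  change lam ^ 2 * ∑ t ∈ Finset.Ico (τ + 1) N, f t ≤ _
  by_cases h8 : γ / 4 ^ (τ / K) * lam ≤ 8 * β
  · have hb : ∀ t ∈ Finset.Ico (τ + 1) N, f t ≤ 9 * (γ / 4 ^ (τ / K)) ^ 2 := by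
      intro t ht
      exact (sq_look_le_pot hβ hβ' _).trans ((pot_traj_le hp hA le_rfl
        (Finset.mem_Ico.1 ht).1).trans ((h.pot_kick_le K τ).trans
          ((hp τ).pot_self_le_of_le h8)))
    have hs := Finset.sum_le_card_nsmul _ _ _ hb
    rw [nsmul_eq_mul, Nat.card_Ico] at hs
    have hc : ((N - (τ + 1) : ℕ) : ℝ) ≤ n := by exact_mod_cast (Nat.sub_le _ _).trans hN
    set g := γ / 4 ^ (τ / K)
    have h1 : ∑ t ∈ Finset.Ico (τ + 1) N, f t ≤ n * (9 * g ^ 2) :=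
      hs.trans (mul_le_mul_of_nonneg_right hc (by positivity))
    have hgl : 0 < g * lam := by positivity
    have h2 : (g * lam) ^ 2 ≤ 32 * β * min (γ * lam) (2 * β * γ / δ) := by
      have a1 : (g * lam) ^ 2 ≤ 8 * β * (g * lam) := by
        rw [sq]; exact mul_le_mul_of_nonneg_right h8 hgl.le
      have a2 : g * lam ≤ γ * lam := mul_le_mul_of_nonneg_right hgg hl.le
      have a3 : 1 ≤ γ / δ := by rw [le_div_iff₀ hδ]; linarith [h.delta_le]
      have a4 : 2 * β * γ / δ = 2 * β * (γ / δ) := by ring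
      have a5 : g * lam ≤ 4 * (2 * β * γ / δ) := by
        rw [a4]; nlinarith
      have a6 : g * lam ≤ 4 * min (γ * lam) (2 * β * γ / δ) := by
        rcases min_choice (γ * lam) (2 * β * γ / δ) with hm | hm <;> rw [hm] <;> nlinarith
      nlinarith
    calc lam ^ 2 * ∑ t ∈ Finset.Ico (τ + 1) N, f t ≤ lam ^ 2 * (n * (9 * g ^ 2)) :=
          mul_le_mul_of_nonneg_left h1 (by positivity)
      _ = 9 * n * (g * lam) ^ 2 := by ring
      _ ≤ 9 * n * (32 * β * min (γ * lam) (2 * β * γ / δ)) :=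
          mul_le_mul_of_nonneg_left h2 (by positivity)
      _ ≤ _ := by
        have b1 : 0 ≤ lam ^ 2 * (n * ((1 - β) ^ K * (2 * γ * δ / β))) := by positivity
        have b2 : 0 ≤ δ * lam := by positivity
        nlinarith
  · push Not at h8
    set l := τ / K with hl'
    -- Up to t1 the response is summed by dissipation; after t1 a whole stage of contraction makes
    -- each term negligible.
    set t1 := (l + 2) * K with ht1
    have hτ : τ + 1 ≤ (l + 1) * K := by
      have := Nat.lt_div_mul_add hK (a := τ)
      rw [← hl'] at this
      linarith
    have hτ1 : τ + 1 ≤ t1 := hτ.trans (Nat.mul_le_mul_right _ (by omega))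
    have hstage : ∀ i ∈ Finset.Ico (τ + 1) t1, γ / 4 ^ l ≤ 4 * (γ / 4 ^ (i / K)) ∧
        δ / 4 ^ l ≤ 4 * (δ / 4 ^ (i / K)) := by
      intro i hi
      have hi' : i / K ≤ l + 1 := by
        have : i / K < l + 2 := (Nat.div_lt_iff_lt_mul hK).2 (Finset.mem_Ico.1 hi).2
        omega
      have hp4 : (4 : ℝ) ^ (i / K) ≤ 4 ^ l * 4 := by
        rw [← pow_succ]; exact pow_le_pow_right₀ (by norm_num) hi'
      have gen : ∀ c : ℝ, 0 < c → c / 4 ^ l ≤ 4 * (c / 4 ^ (i / K)) := by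
        intro c hc
        rw [← mul_div_assoc, div_le_div_iff₀ (by positivity) (by positivity)]
        nlinarith
      exact ⟨gen γ hγ, gen δ hδ⟩
    set g := γ / 4 ^ l
    set e := δ / 4 ^ l
    have hfirst : lam ^ 2 * ∑ t ∈ Finset.Ico (τ + 1) t1, f t
        ≤ 32 * (e * lam + min (g * lam) (2 * β * g / e)) := by
      -- Before t1 both step sizes are at least a quarter of their values at the kick, so the
      -- dissipation rate, at most quadratic in them, loses a factor 16 at most: 1/32 = 1/2 · 1/16.
      set m := 1 / 32 * (g * lam + (1 - β) * (g * lam) / β * (e * lam)) with hm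
      have hm0 : 0 < m := by positivity
      have hs : m * ∑ t ∈ Finset.Ico (τ + 1) t1, f t ≤ pot β g lam (e, g) := by
        refine (sum_sq_look_le hp hA le_rfl hτ1 ?_ ?_).trans (h.pot_kick_le K τ)
        · intro i hi
          have := mul_le_mul_of_nonneg_right (hstage i hi).1 hl.le
          linarith
        · intro i hi
          obtain ⟨s1, s2⟩ := hstage i hi
          have s1' := mul_le_mul_of_nonneg_right s1 hl.le
          have s2' := mul_le_mul_of_nonneg_right s2 hl.le
          have s3 : (1 - β) * (g * lam) / β * (e * lam) ≤
              16 * ((1 - β) * (γ / 4 ^ (i / K) * lam) / β * (δ / 4 ^ (i / K) * lam)) := by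
            have : (1 - β) * (g * lam) / β * (e * lam) ≤
              (1 - β) * (4 * (γ / 4 ^ (i / K)) * lam) / β * (4 * (δ / 4 ^ (i / K)) * lam) := by
              gcongr
            refine this.trans (le_of_eq (by ring))
          have s4 : 0 < γ / 4 ^ (i / K) * lam := by positivity
          simp only [hm]
          linarith
      have h2 := (hp τ).sq_mul_pot_self_le (by linarith)
      change lam ^ 2 * pot β g lam (e, g) ≤ _ at h2
      have h3 : m * (lam ^ 2 * ∑ t ∈ Finset.Ico (τ + 1) t1, f t) ≤
          m * (32 * (e * lam + min (g * lam) (2 * β * g / e))) := by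
        calc m * (lam ^ 2 * ∑ t ∈ Finset.Ico (τ + 1) t1, f t)
            = lam ^ 2 * (m * ∑ t ∈ Finset.Ico (τ + 1) t1, f t) := by ring
          _ ≤ lam ^ 2 * pot β g lam (e, g) := mul_le_mul_of_nonneg_left hs (by positivity)
          _ ≤ _ := h2
          _ = _ := by rw [hm]; ring
      exact le_of_mul_le_mul_left h3 hm0
    -- The maximum covers runs that end before t1, where this range is empty.
    have hsecond : ∑ t ∈ Finset.Ico t1 (max N t1), f t ≤ n * ((1 - β) ^ K * (2 * γ * δ / β)) := by
      have hb : ∀ t ∈ Finset.Ico t1 (max N t1), f t ≤ (1 - β) ^ K * (2 * γ * δ / β) := fun t ht =>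
        (sq_look_le_pot hβ hβ' _).trans
          (h.pot_kick_contract hK h8 (Finset.mem_Ico.1 ht).1)
      have hs := Finset.sum_le_card_nsmul _ _ _ hb
      rw [nsmul_eq_mul, Nat.card_Ico] at hs
      have hc : ((max N t1 - t1 : ℕ) : ℝ) ≤ n := by
        have : max N t1 - t1 ≤ n := by omega
        exact_mod_cast this
      exact hs.trans (mul_le_mul_of_nonneg_right hc (by positivity))
    have hsplit : ∑ t ∈ Finset.Ico (τ + 1) N, f t ≤
        ∑ t ∈ Finset.Ico (τ + 1) t1, f t + ∑ t ∈ Finset.Ico t1 (max N t1), f t := by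
      rw [Finset.sum_Ico_consecutive _ hτ1 (le_max_right _ _)]
      exact Finset.sum_le_sum_of_subset_of_nonneg
        (Finset.Ico_subset_Ico_right (le_max_left _ _)) fun t _ _ => hf0 t
    have hge : 2 * β * g / e = 2 * β * γ / δ := by
      simp only [g, e]; field_simp
    have hmm : min (g * lam) (2 * β * g / e) ≤ min (γ * lam) (2 * β * γ / δ) := by
      rw [hge]
      exact min_le_min_right _ (mul_le_mul_of_nonneg_right hgg hl.le)
    have hel : e * lam ≤ δ * lam := mul_le_mul_of_nonneg_right hdd hl.le
    have h5 := mul_le_mul_of_nonneg_left hsplit (by positivity : 0 ≤ lam ^ 2)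
    have h6 := mul_le_mul_of_nonneg_left hsecond (by positivity : 0 ≤ lam ^ 2)
    have h7 : 0 ≤ n * β * min (γ * lam) (2 * β * γ / δ) := by positivity
    rw [mul_add] at h5
    linarith

/-- Final response to the noise of one step: small stage step size. -/
lemma StepParams.sq_final_kick_le {N τ : ℕ} (hτ : τ < N)
    (h8 : γ / 4 ^ (τ / K) * lam ≤ 8 * β) :
    (traj (1 - β) β (fun t => δ / 4 ^ (t / K)) (fun t => γ / 4 ^ (t / K)) lam (τ + 1)
        (δ / 4 ^ (τ / K), γ / 4 ^ (τ / K)) N).1 ^ 2 ≤ 18 * (γ / 4 ^ (τ / K)) ^ 2 := by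
  have hA := antitone_stage (K := K) h.gamma_pos.le
  have hp := fun t => h.stage K t
  have h1 := (pot_traj_le hp hA le_rfl hτ).trans ((h.pot_kick_le K τ).trans
    ((hp τ).pot_self_le_of_le h8))
  have h2 := sq_fst_le_pot (γ := γ / 4 ^ (N / K)) (lam := lam) h.beta_pos h.beta_le
    (traj (1 - β) β (fun t => δ / 4 ^ (t / K)) (fun t => γ / 4 ^ (t / K)) lam (τ + 1)
        (δ / 4 ^ (τ / K), γ / 4 ^ (τ / K)) N)
  linarith

/-- Final response to the noise of one step when the last stage has a small step size. -/
lemma StepParams.sq_final_kick_le' (hK : 0 < K) {L τ : ℕ} (hτ : τ < L * K)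
    (hlast : γ / 4 ^ (L - 1) * lam ≤ 2 * β) :
    (traj (1 - β) β (fun t => δ / 4 ^ (t / K)) (fun t => γ / 4 ^ (t / K)) lam (τ + 1)
        (δ / 4 ^ (τ / K), γ / 4 ^ (τ / K)) (L * K)).1 ^ 2 ≤
      18 * (8 * β / lam) ^ 2 + (1 - β) ^ K * (4 * γ * δ / β) := by
  have hβ := h.beta_pos
  have hγ := h.gamma_pos
  have hδ := h.delta_pos
  have hl := h.lam_pos
  have hα : 0 < 1 - β := by linarith [h.beta_le]
  by_cases h8 : γ / 4 ^ (τ / K) * lam ≤ 8 * β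
  · refine (h.sq_final_kick_le hτ h8).trans ?_
    have h1 : γ / 4 ^ (τ / K) ≤ 8 * β / lam := by rwa [le_div_iff₀ hl]
    have h2 : (γ / 4 ^ (τ / K)) ^ 2 ≤ (8 * β / lam) ^ 2 := pow_le_pow_left₀ (by positivity) h1 2
    have : 0 ≤ (1 - β) ^ K * (4 * γ * δ / β) := by positivity
    linarith
  · push Not at h8
    -- A kick above 8β cannot come in the last stage, where γλ is at most 2β; so a whole stage
    -- follows it before the end.
    have hL : τ / K + 2 ≤ L := by
      by_contra hcon
      push Not at hcon
      have h1 : L - 1 ≤ τ / K := Nat.sub_le_iff_le_add.2 (Nat.lt_succ_iff.1 hcon)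
      have h2 : γ / 4 ^ (τ / K) ≤ γ / 4 ^ (L - 1) := div_le_div_of_nonneg_left hγ.le (by positivity)
        (pow_le_pow_right₀ (by norm_num) h1)
      have h3 := mul_le_mul_of_nonneg_right h2 hl.le
      linarith
    have h1 := h.pot_kick_contract hK h8 (Nat.mul_le_mul_right K hL)
    have h2 := sq_fst_le_pot (γ := γ / 4 ^ (L * K / K)) (lam := lam) hβ h.beta_le
      (traj (1 - β) β (fun t => δ / 4 ^ (t / K)) (fun t => γ / 4 ^ (t / K)) lam (τ + 1)
        (δ / 4 ^ (τ / K), γ / 4 ^ (τ / K)) (L * K))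
    have h3 : (1 - β) ^ K * (4 * γ * δ / β) = 2 * ((1 - β) ^ K * (2 * γ * δ / β)) := by ring
    have : 0 ≤ 18 * (8 * β / lam) ^ 2 := by positivity
    linarith

omit h in
lemma pot_init_zero {c : ℝ} :
    pot β (γ / 4 ^ (0 / K)) lam (traj (1 - β) β (fun t => δ / 4 ^ (t / K))
      (fun t => γ / 4 ^ (t / K)) lam 0 (c, c) 0) = ((1 - β) * potWeight β γ lam + 1) * c ^ 2 := by
  simp only [Nat.zero_div, pow_zero, div_one, traj, pot]
  ring

/-- Noiseless error in a direction that is not accelerated. -/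
lemma StepParams.pot_bias_low (hh : ¬ 2 * β < γ * lam) (c : ℝ) (t : ℕ) :
    pot β (γ / 4 ^ (t / K)) lam (traj (1 - β) β (fun t => δ / 4 ^ (t / K))
      (fun t => γ / 4 ^ (t / K)) lam 0 (c, c) t) ≤ 2 * c ^ 2 := by
  have hA := antitone_stage (K := K) h.gamma_pos.le
  have hp := fun t => h.stage K t
  refine (pot_traj_le hp hA le_rfl (Nat.zero_le t)).trans ?_
  rw [pot_init_zero, potWeight, if_neg hh]
  nlinarith [sq_nonneg c, h.beta_pos]

lemma StepParams.pot_init_high (hh : 2 * β < γ * lam) (c : ℝ) :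
    pot β (γ / 4 ^ (0 / K)) lam (traj (1 - β) β (fun t => δ / 4 ^ (t / K))
      (fun t => γ / 4 ^ (t / K)) lam 0 (c, c) 0) ≤ 3 / 2 * (γ * lam / β) * c ^ 2 := by
  rw [pot_init_zero, potWeight, if_pos hh]
  refine mul_le_mul_of_nonneg_right ?_ (sq_nonneg c)
  have h1 : 2 < γ * lam / β := by rwa [lt_div_iff₀ h.beta_pos]
  nlinarith [h.beta_pos]

/-- Noiseless error in an accelerated direction after the first stage. -/
lemma StepParams.pot_bias_high (hh : 2 * β < γ * lam) (c : ℝ) {t : ℕ} (ht : K ≤ t) :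
    pot β (γ / 4 ^ (t / K)) lam (traj (1 - β) β (fun t => δ / 4 ^ (t / K))
      (fun t => γ / 4 ^ (t / K)) lam 0 (c, c) t)
      ≤ (1 - β) ^ K * (3 / 2 * (γ * lam / β) * c ^ 2) := by
  have hA := antitone_stage (K := K) h.gamma_pos.le
  have hp := fun t => h.stage K t
  refine (pot_traj_le hp hA (Nat.zero_le K) ht).trans ?_
  have h1 := pot_traj_contract (s := 0) (x := (c, c)) hp hA le_rfl K (fun i hi => by
    rw [zero_add, Nat.div_eq_of_lt hi, pow_zero, div_one]; exact hh)
  rw [zero_add] at h1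
  refine h1.trans ?_
  exact mul_le_mul_of_nonneg_left (h.pot_init_high hh c)
    (pow_nonneg (by linarith [h.beta_le]) _)

/-- Total noiseless error at the query points. -/
lemma StepParams.sum_bias_le (hK : 0 < K) {n N : ℕ} (hN : N ≤ n) (c : ℝ) :
    ∑ t ∈ Finset.range N, look (1 - β) (traj (1 - β) β (fun t => δ / 4 ^ (t / K))
      (fun t => γ / 4 ^ (t / K)) lam 0 (c, c) t) ^ 2
      ≤ (2 * n + 3 / β + n * ((1 - β) ^ K * (3 / 2 * (γ * lam / β)))) * c ^ 2 := by
  have hβ := h.beta_pos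
  have hβ' := h.beta_le
  have hγ := h.gamma_pos
  have hδ := h.delta_pos
  have hl := h.lam_pos
  have hα : 0 < 1 - β := by linarith
  have hA := antitone_stage (K := K) hγ.le
  have hp := fun t => h.stage K t
  have hn0 : (0 : ℝ) ≤ n := n.cast_nonneg
  set f : ℕ → ℝ := fun t => look (1 - β) (traj (1 - β) β (fun t => δ / 4 ^ (t / K))
      (fun t => γ / 4 ^ (t / K)) lam 0 (c, c) t) ^ 2 with hf
  have hf0 : ∀ t, 0 ≤ f t := fun t => sq_nonneg _
  change ∑ t ∈ Finset.range N, f t ≤ _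
  have hr0 : 0 ≤ (1 - β) ^ K * (3 / 2 * (γ * lam / β)) := by positivity
  by_cases hh : 2 * β < γ * lam
  -- The initial potential is O(γλ/β) c² and the dissipation rate is at least γλ/2, so γλ cancels
  -- and 3/β remains.
  · have hfirst : ∑ t ∈ Finset.Ico 0 K, f t ≤ 3 / β * c ^ 2 := by
      have hs : 1 / 2 * (γ * lam) * ∑ t ∈ Finset.Ico 0 K, f t ≤ 3 / 2 * (γ * lam / β) * c ^ 2 := by
        refine (sum_sq_look_le hp hA le_rfl (Nat.zero_le K) ?_ ?_).trans (h.pot_init_high hh c)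
        · intro i hi
          rw [Nat.div_eq_of_lt (Finset.mem_Ico.1 hi).2, pow_zero, div_one]
          exact hh
        · intro i hi
          rw [Nat.div_eq_of_lt (Finset.mem_Ico.1 hi).2, pow_zero, div_one, div_one]
          have : 0 ≤ (1 - β) * (γ * lam) / β * (δ * lam) := by positivity
          linarith
      have e : 3 / 2 * (γ * lam / β) * c ^ 2 = 1 / 2 * (γ * lam) * (3 / β * c ^ 2) := by
        field_simp
      rw [e] at hs
      exact le_of_mul_le_mul_left hs (by positivity)
    have hsecond : ∑ t ∈ Finset.Ico K (max N K), f t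
        ≤ n * ((1 - β) ^ K * (3 / 2 * (γ * lam / β) * c ^ 2)) := by
      have hb : ∀ t ∈ Finset.Ico K (max N K), f t
          ≤ (1 - β) ^ K * (3 / 2 * (γ * lam / β) * c ^ 2) := fun t ht =>
        (sq_look_le_pot hβ hβ' _).trans
          (h.pot_bias_high hh c (Finset.mem_Ico.1 ht).1)
      have hs := Finset.sum_le_card_nsmul _ _ _ hb
      rw [nsmul_eq_mul, Nat.card_Ico] at hs
      have hc : ((max N K - K : ℕ) : ℝ) ≤ n := by
        have : max N K - K ≤ n := by omega
        exact_mod_cast this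
      exact hs.trans (mul_le_mul_of_nonneg_right hc (by positivity))
    have hsplit : ∑ t ∈ Finset.range N, f t ≤
        ∑ t ∈ Finset.Ico 0 K, f t + ∑ t ∈ Finset.Ico K (max N K), f t := by
      rw [Finset.sum_Ico_consecutive _ (Nat.zero_le K) (le_max_right _ _), Finset.range_eq_Ico]
      exact Finset.sum_le_sum_of_subset_of_nonneg
        (Finset.Ico_subset_Ico_right (le_max_left _ _)) fun t _ _ => hf0 t
    have : 0 ≤ n * c ^ 2 := by positivity
    nlinarith
  · have hb : ∀ t ∈ Finset.range N, f t ≤ 2 * c ^ 2 := fun t _ =>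
      (sq_look_le_pot hβ hβ' _).trans (h.pot_bias_low hh c t)
    have hs := Finset.sum_le_card_nsmul _ _ _ hb
    rw [nsmul_eq_mul, Finset.card_range] at hs
    have hn : (N : ℝ) ≤ n := by exact_mod_cast hN
    have h1 : (N : ℝ) * (2 * c ^ 2) ≤ n * (2 * c ^ 2) :=
      mul_le_mul_of_nonneg_right hn (by positivity)
    have h2 : 0 ≤ 3 / β * c ^ 2 := by positivity
    have h3 : 0 ≤ n * ((1 - β) ^ K * (3 / 2 * (γ * lam / β))) * c ^ 2 := by positivity
    nlinarith

end Stages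

/-! ### Source error and upper bound for the target risk -/

lemma numStages_mul_stageLen_le (n : ℕ) : numStages n * stageLen n ≤ n :=
  Nat.mul_div_le n (numStages n)

lemma measurable_queryPoint {d n : ℕ} (δ γ α β : ℝ) (t : ℕ) :
    Measurable fun D : Fin n → Obs d => queryPoint δ γ α β D t := by
  have h := measurable_asgdIter (d := d) (n := n) δ γ α β t
  have h1 := h.fst
  have h2 := h.snd
  unfold queryPoint
  fun_prop

/-- The mean source error at the query point. -/
def meanSqErr {d : ℕ} (n : ℕ) (P : Measure (Obs d)) (lam wstar : Fin d → ℝ) (δ γ α β : ℝ) (t : ℕ) :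
    ℝ≥0∞ :=
  ∫⁻ D, ENNReal.ofReal (sqNorm (diagonal lam) (queryPoint δ γ α β D t - wstar))
    ∂(Measure.pi fun _ : Fin n => P)

/-- Each coordinate of the query point error is an `errFunctional` with p = α e_j and q = (1 - α)
e_j, so the propagation bound applies to it. -/
lemma meanSqErr_eq_sum {d : ℕ} (n : ℕ) (P : Measure (Obs d)) {lam : Fin d → ℝ}
    (hlam : ∀ j, 0 ≤ lam j) (wstar : Fin d → ℝ) (δ γ α β : ℝ) (t : ℕ) :
    meanSqErr n P lam wstar δ γ α β t = ∑ j, ENNReal.ofReal (lam j) *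
      ∫⁻ D, ENNReal.ofReal (errFunctional δ γ α β wstar (Pi.single j α) (Pi.single j (1 - α)) t D ^ 2)
        ∂(Measure.pi fun _ : Fin n => P) := by
  have hE : ∀ (D : Fin n → Obs d) j,
      errFunctional δ γ α β wstar (Pi.single j α) (Pi.single j (1 - α)) t D
        = (queryPoint δ γ α β D t - wstar) j := by
    intro D j
    simp only [errFunctional, Pi.single_apply, ite_mul, zero_mul, Finset.sum_add_distrib,
      Finset.sum_ite_eq', Finset.mem_univ, if_true, queryPoint, Pi.sub_apply, Pi.add_apply,
      Pi.smul_apply, smul_eq_mul]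
    ring
  unfold meanSqErr
  simp only [hE, sqNorm_diagonal]
  have hm : ∀ j, Measurable fun D : Fin n → Obs d =>
      ENNReal.ofReal ((queryPoint δ γ α β D t - wstar) j ^ 2) := fun j =>
    ((((measurable_pi_apply j).comp (measurable_queryPoint δ γ α β t)).sub_const _).pow_const
      2).ennreal_ofReal
  calc _ = ∫⁻ D, ∑ j, ENNReal.ofReal (lam j) *
        ENNReal.ofReal ((queryPoint δ γ α β D t - wstar) j ^ 2)
          ∂(Measure.pi fun _ : Fin n => P) := by
        refine lintegral_congr fun D => ?_
        rw [ENNReal.ofReal_sum_of_nonneg fun j _ => mul_nonneg (hlam j) (sq_nonneg _)]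
        exact Finset.sum_congr rfl fun j _ => ENNReal.ofReal_mul (hlam j)
    _ = _ := by
        rw [lintegral_finsetSum _ fun j _ => (hm j).const_mul _]
        exact Finset.sum_congr rfl fun j _ => lintegral_const_mul _ (hm j)

section Risk

variable {d : ℕ} {σ ψ : ℝ} {M T : Matrix (Fin d) (Fin d) ℝ}
    {P Q : Measure (Obs d)} {lam wstar : Fin d → ℝ}

lemma lintegral_noise_level {n : ℕ} [IsProbabilityMeasure P] (hlam : ∀ j, 0 ≤ lam j) (hψ : 0 ≤ ψ)
    (δ γ α β : ℝ) {t : ℕ} (hfin : meanSqErr n P lam wstar δ γ α β t ≠ ⊤) :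
    ∫⁻ D, ENNReal.ofReal (2 * σ ^ 2 + 2 * ψ * sqNorm (diagonal lam)
      (queryPoint δ γ α β D t - wstar)) ∂(Measure.pi fun _ : Fin n => P)
      ≤ ENNReal.ofReal (2 * σ ^ 2 + 2 * ψ * (meanSqErr n P lam wstar δ γ α β t).toReal) := by
  have hV : ∀ D : Fin n → Obs d,
      0 ≤ sqNorm (diagonal lam) (queryPoint δ γ α β D t - wstar) := by
    intro D
    rw [sqNorm_diagonal]
    exact Finset.sum_nonneg fun j _ => mul_nonneg (hlam j) (sq_nonneg _)
  have e : ∀ D : Fin n → Obs d, ENNReal.ofReal (2 * σ ^ 2 + 2 * ψ * sqNorm (diagonal lam)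
      (queryPoint δ γ α β D t - wstar)) = ENNReal.ofReal (2 * σ ^ 2) + ENNReal.ofReal (2 * ψ) *
        ENNReal.ofReal (sqNorm (diagonal lam) (queryPoint δ γ α β D t - wstar)) := by
    intro D
    rw [← ENNReal.ofReal_mul (by positivity), ← ENNReal.ofReal_add (by positivity)
      (mul_nonneg (by positivity) (hV D))]
  simp only [e]
  rw [lintegral_add_left measurable_const, lintegral_const_mul' _ _ ENNReal.ofReal_ne_top,
    lintegral_const, measure_univ, mul_one]
  change _ + _ * meanSqErr n P lam wstar δ γ α β t ≤ _
  rw [ENNReal.ofReal_add (by positivity) (by positivity), ENNReal.ofReal_mul (by positivity :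
    (0 : ℝ) ≤ 2 * ψ), ENNReal.ofReal_toReal hfin]

/-- The mean source error is finite and obeys a linear Volterra inequality. -/
lemma MemClass.meanSqErr_le (h : MemClass σ ψ M (diagonal lam) T P Q wstar)
    (hlam : ∀ j, 0 ≤ lam j) (hψ : 0 ≤ ψ) {n : ℕ} (δ γ α β : ℝ) (t : ℕ) (ht : t ≤ n) :
    meanSqErr n P lam wstar δ γ α β t ≠ ⊤ ∧
    (meanSqErr n P lam wstar δ γ α β t).toReal ≤ ∑ j, lam j *
      (look α (traj α β (fun t => δ / 4 ^ (t / stageLen n)) (fun t => γ / 4 ^ (t / stageLen n))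
        (lam j) 0 (-wstar j, -wstar j) t) ^ 2
      + ∑ τ ∈ Finset.range t,
        (2 * σ ^ 2 + 2 * ψ * (meanSqErr n P lam wstar δ γ α β τ).toReal) * (lam j *
          look α (traj α β (fun t => δ / 4 ^ (t / stageLen n)) (fun t => γ / 4 ^ (t / stageLen n))
          (lam j) (τ + 1) (δ / 4 ^ (τ / stageLen n), γ / 4 ^ (τ / stageLen n)) t) ^ 2)) := by
  have := h.source.prob
  -- The noise levels at earlier times enter as real numbers, so finiteness of all earlier errors
  -- must be carried along.
  induction t using Nat.strong_induction_on with
  | _ t ih =>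
  have hle : meanSqErr n P lam wstar δ γ α β t ≤ ENNReal.ofReal (∑ j, lam j *
      (look α (traj α β (fun t => δ / 4 ^ (t / stageLen n)) (fun t => γ / 4 ^ (t / stageLen n))
        (lam j) 0 (-wstar j, -wstar j) t) ^ 2
      + ∑ τ ∈ Finset.range t,
        (2 * σ ^ 2 + 2 * ψ * (meanSqErr n P lam wstar δ γ α β τ).toReal) * (lam j *
          look α (traj α β (fun t => δ / 4 ^ (t / stageLen n)) (fun t => γ / 4 ^ (t / stageLen n))
          (lam j) (τ + 1) (δ / 4 ^ (τ / stageLen n), γ / 4 ^ (τ / stageLen n)) t) ^ 2)) ) := by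
    rw [meanSqErr_eq_sum n P hlam, ENNReal.ofReal_sum_of_nonneg]
    · refine Finset.sum_le_sum fun j _ => ?_
      rw [ENNReal.ofReal_mul (hlam j)]
      refine mul_le_mul_right ((h.lintegral_errFunctional_le hlam hψ δ γ α β _
        (fun τ => ?_) t ht (fun τ hτ => lintegral_noise_level hlam hψ δ γ α β
          (ih τ hτ (by omega)).1) _ _).trans (ENNReal.ofReal_le_ofReal (le_of_eq ?_))) _
      · positivity
      · congr 1
        · congr 1
          rw [Finset.sum_eq_single j]
          · simp only [Pi.single_eq_same, look]
          · intro i _ hi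
            simp [Pi.single_eq_of_ne hi]
          · simp
        · refine Finset.sum_congr rfl fun τ _ => ?_
          congr 1
          rw [Finset.sum_eq_single j]
          · simp only [Pi.single_eq_same, look]
          · intro i _ hi
            simp [Pi.single_eq_of_ne hi]
          · simp
    · intro j _
      refine mul_nonneg (hlam j) (add_nonneg (sq_nonneg _) (Finset.sum_nonneg fun τ _ => ?_))
      have := hlam j
      positivity
  refine ⟨ne_top_of_le_ne_top ENNReal.ofReal_ne_top hle, ?_⟩
  refine ENNReal.toReal_le_of_le_ofReal (Finset.sum_nonneg fun j _ => ?_) hle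
  refine mul_nonneg (hlam j) (add_nonneg (sq_nonneg _) (Finset.sum_nonneg fun τ _ => ?_))
  have := hlam j
  positivity

/-- If the step sizes are small enough, the gradient noise stays at a constant level on average. -/
lemma MemClass.sum_noise_level_le (h : MemClass σ ψ M (diagonal lam) T P Q wstar) (hψ : 0 < ψ)
    {n : ℕ} {δ γ β : ℝ} (hK : 0 < stageLen n) (hp : ∀ j, StepParams β δ γ (lam j))
    (hstab : ∑ j, (32 * (δ * lam j) + (32 + 288 * (n * β)) * min (γ * lam j) (2 * β * γ / δ)
      + lam j ^ 2 * (n * ((1 - β) ^ stageLen n * (2 * γ * δ / β)))) ≤ 1 / (4 * ψ))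
    (hbias : ∀ j, 2 * n + 3 / β + n * ((1 - β) ^ stageLen n * (3 / 2 * (γ * lam j / β))) ≤ 6 * n)
    {R : ℝ} (hR : ∑ j, lam j * wstar j ^ 2 ≤ R) :
    ∑ t ∈ Finset.range (numStages n * stageLen n),
      (2 * σ ^ 2 + 2 * ψ * (meanSqErr n P lam wstar δ γ (1 - β) β t).toReal)
      ≤ (4 * σ ^ 2 + 24 * ψ * R) * n := by
  have hlam : ∀ j, 0 ≤ lam j := fun j => (hp j).lam_pos.le
  set N := numStages n * stageLen n with hN
  have hNn : N ≤ n := numStages_mul_stageLen_le n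
  set e : ℕ → ℝ := fun t => (meanSqErr n P lam wstar δ γ (1 - β) β t).toReal with he
  have he0 : ∀ t, 0 ≤ e t := fun t => ENNReal.toReal_nonneg
  set ν : ℕ → ℝ := fun t => 2 * σ ^ 2 + 2 * ψ * e t with hν
  have hν0 : ∀ t, 0 ≤ ν t := fun t => by have := he0 t; positivity
  set b : Fin d → ℕ → ℝ := fun j t => look (1 - β) (traj (1 - β) β
      (fun t => δ / 4 ^ (t / stageLen n)) (fun t => γ / 4 ^ (t / stageLen n))
        (lam j) 0 (-wstar j, -wstar j) t) ^ 2 with hb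
  set k : Fin d → ℕ → ℕ → ℝ := fun j τ t => look (1 - β) (traj (1 - β) β
      (fun t => δ / 4 ^ (t / stageLen n)) (fun t => γ / 4 ^ (t / stageLen n))
          (lam j) (τ + 1) (δ / 4 ^ (τ / stageLen n), γ / 4 ^ (τ / stageLen n)) t) ^ 2 with hk
  have h1 : ∀ t ∈ Finset.range N, e t ≤ ∑ j, lam j * b j t
      + ∑ τ ∈ Finset.range t, ν τ * ∑ j, lam j ^ 2 * k j τ t := by
    intro t ht
    have := (h.meanSqErr_le hlam hψ.le δ γ (1 - β) β t
      ((Finset.mem_range.1 ht).le.trans hNn)).2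
    refine this.trans (le_of_eq ?_)
    simp only [mul_add, Finset.sum_add_distrib, Finset.mul_sum]
    rw [Finset.sum_comm (s := Finset.range t)]
    congr 1
    exact Finset.sum_congr rfl fun j _ => Finset.sum_congr rfl fun τ _ => by
      simp only [hk, hν, he]; ring
  have h2 : ∑ t ∈ Finset.range N, ∑ j, lam j * b j t ≤ 6 * n * R := by
    rw [Finset.sum_comm]
    calc ∑ j, ∑ t ∈ Finset.range N, lam j * b j t
        ≤ ∑ j, 6 * n * (lam j * wstar j ^ 2) := by
          refine Finset.sum_le_sum fun j _ => ?_
          rw [← Finset.mul_sum]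
          have := ((hp j).sum_bias_le hK hNn (-wstar j)).trans
            (mul_le_mul_of_nonneg_right (hbias j) (sq_nonneg _))
          rw [neg_sq] at this
          have := mul_le_mul_of_nonneg_left this (hlam j)
          linarith
      _ ≤ 6 * n * R := by
          rw [← Finset.mul_sum]
          exact mul_le_mul_of_nonneg_left hR (by positivity)
  have h3 : ∑ t ∈ Finset.range N, ∑ τ ∈ Finset.range t, ν τ * ∑ j, lam j ^ 2 * k j τ t
      ≤ 1 / (4 * ψ) * ∑ τ ∈ Finset.range N, ν τ := by
    -- Summing over the response time first bounds each noise level's total effect by the kernel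
    -- mass in `hstab`.
    have hswap : ∑ t ∈ Finset.range N, ∑ τ ∈ Finset.range t, ν τ * ∑ j, lam j ^ 2 * k j τ t
        = ∑ τ ∈ Finset.range N, ∑ t ∈ Finset.Ico (τ + 1) N, ν τ * ∑ j, lam j ^ 2 * k j τ t := by
      refine Finset.sum_comm' fun t τ => ?_
      simp only [Finset.mem_range, Finset.mem_Ico]
      omega
    rw [hswap, Finset.mul_sum]
    refine Finset.sum_le_sum fun τ _ => ?_
    rw [← Finset.mul_sum, mul_comm]
    refine mul_le_mul_of_nonneg_right (le_trans ?_ hstab) (hν0 τ)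
    rw [Finset.sum_comm]
    refine Finset.sum_le_sum fun j _ => ?_
    rw [← Finset.mul_sum]
    exact (hp j).sum_kick_le hK hNn τ
  have h4 := Finset.sum_le_sum h1
  rw [Finset.sum_add_distrib] at h4
  have h5 : ∑ t ∈ Finset.range N, ν t = N * (2 * σ ^ 2) + 2 * ψ * ∑ t ∈ Finset.range N, e t := by
    simp only [hν]
    rw [Finset.sum_add_distrib, Finset.sum_const, Finset.card_range, nsmul_eq_mul,
      ← Finset.mul_sum]
  have h6 : (N : ℝ) * (2 * σ ^ 2) ≤ n * (2 * σ ^ 2) :=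
    mul_le_mul_of_nonneg_right (by exact_mod_cast hNn) (by positivity)
  have h7 : 2 * ψ * ∑ t ∈ Finset.range N, e t ≤
      2 * ψ * (6 * n * R + 1 / (4 * ψ) * ∑ τ ∈ Finset.range N, ν τ) :=
    mul_le_mul_of_nonneg_left (h4.trans (add_le_add h2 h3)) (by positivity)
  -- The mass 1/(4ψ) is chosen so that half of Σ ν appears on the right and is absorbed on the left.
  have h8 : 2 * ψ * (6 * n * R + 1 / (4 * ψ) * ∑ τ ∈ Finset.range N, ν τ)
      = 12 * ψ * n * R + 1 / 2 * ∑ τ ∈ Finset.range N, ν τ := by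
    field_simp; ring
  change ∑ t ∈ Finset.range N, ν t ≤ _
  linarith

/-- Target risk of accelerated SGD for a rank-one target, in terms of bounds `φ` for the noiseless
error and `V` for the responses to noise in each eigendirection. -/
lemma MemClass.lintegral_asgd_le {m w : Fin d → ℝ}
    (h : MemClass σ ψ (diagonal m) (diagonal lam) T P Q wstar) (hψ : 0 < ψ) (hm : ∀ j, 0 < m j)
    {n : ℕ} {δ γ β : ℝ} (hK : 0 < stageLen n) (hp : ∀ j, StepParams β δ γ (lam j))
    (hstab : ∑ j, (32 * (δ * lam j) + (32 + 288 * (n * β)) * min (γ * lam j) (2 * β * γ / δ)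
      + lam j ^ 2 * (n * ((1 - β) ^ stageLen n * (2 * γ * δ / β)))) ≤ 1 / (4 * ψ))
    (hbias : ∀ j, 2 * n + 3 / β + n * ((1 - β) ^ stageLen n * (3 / 2 * (γ * lam j / β))) ≤ 6 * n)
    {R : ℝ} (hR : ∑ j, lam j * wstar j ^ 2 ≤ R) (φ V : Fin d → ℝ)
    (hφ : ∀ j c, (traj (1 - β) β (fun t => δ / 4 ^ (t / stageLen n))
        (fun t => γ / 4 ^ (t / stageLen n)) (lam j) 0 (c, c)
        (numStages n * stageLen n)).1 ^ 2 ≤ φ j * c ^ 2)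
    (hV : ∀ j, ∀ τ < numStages n * stageLen n, (traj (1 - β) β
      (fun t => δ / 4 ^ (t / stageLen n)) (fun t => γ / 4 ^ (t / stageLen n)) (lam j) (τ + 1)
      (δ / 4 ^ (τ / stageLen n), γ / 4 ^ (τ / stageLen n)) (numStages n * stageLen n)).1 ^ 2
        ≤ V j) (hV0 : ∀ j, 0 ≤ V j) :
    ∫⁻ D, ENNReal.ofReal (sqNorm (vecMulVec w w) (asgd δ γ (1 - β) β D - wstar))
        ∂(Measure.pi fun _ : Fin n => P)
      ≤ ENNReal.ofReal (∑ j, w j ^ 2 *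
          (φ j / m j + lam j * V j * ((4 * σ ^ 2 + 24 * ψ * R) * n))) := by
  have := h.source.prob
  have hlam : ∀ j, 0 ≤ lam j := fun j => (hp j).lam_pos.le
  have hsum := h.sum_noise_level_le hψ hK hp hstab hbias hR
  set N := numStages n * stageLen n with hN
  have hNn : N ≤ n := numStages_mul_stageLen_le n
  have hφ0 : ∀ j, 0 ≤ φ j := fun j => by
    have := (sq_nonneg _).trans (hφ j 1)
    simpa using this
  have hE : ∀ D : Fin n → Obs d, sqNorm (vecMulVec w w) (asgd δ γ (1 - β) β D - wstar)
      = errFunctional δ γ (1 - β) β wstar w 0 N D ^ 2 := by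
    intro D
    rw [sqNorm_vecMulVec]
    simp [errFunctional, asgd, dotProduct, hN]
  simp only [hE]
  refine (h.lintegral_errFunctional_le hlam hψ.le δ γ (1 - β) β
    (fun t => 2 * σ ^ 2 + 2 * ψ * (meanSqErr n P lam wstar δ γ (1 - β) β t).toReal)
    (fun τ => by positivity) N hNn (fun τ hτ => lintegral_noise_level hlam hψ.le δ γ (1 - β) β
          (h.meanSqErr_le hlam hψ.le δ γ (1 - β) β τ (hτ.le.trans hNn)).1) w 0).trans
    (ENNReal.ofReal_le_ofReal ?_)
  simp only [Pi.zero_apply, zero_mul, add_zero]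
  simp only [mul_add, Finset.sum_add_distrib]
  refine add_le_add ?_ ?_
  -- Cauchy–Schwarz for the bias, pairing against Σ m_j (w*_j)² ≤ 1; this produces the factors φ_j /
  -- m_j.
  · have hcs := Finset.sum_sq_le_sum_mul_sum_of_sq_le_mul Finset.univ
      (r := fun j => w j * (traj (1 - β) β (fun t => δ / 4 ^ (t / stageLen n))
        (fun t => γ / 4 ^ (t / stageLen n)) (lam j) 0 (-wstar j, -wstar j) N).1)
      (f := fun j => m j * wstar j ^ 2) (g := fun j => w j ^ 2 * (φ j / m j))
      (fun j _ => mul_nonneg (hm j).le (sq_nonneg _))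
      (fun j _ => mul_nonneg (sq_nonneg _) (div_nonneg (hφ0 j) (hm j).le)) (fun j _ => by
        have h1 := mul_le_mul_of_nonneg_left (hφ j (-wstar j)) (sq_nonneg (w j))
        have h2 : m j * wstar j ^ 2 * (w j ^ 2 * (φ j / m j)) = w j ^ 2 * (φ j * wstar j ^ 2) := by
          have := (hm j).ne'
          field_simp
        rw [mul_pow, h2]
        rwa [neg_sq] at h1)
    refine hcs.trans (mul_le_of_le_one_left ?_ ?_)
    · exact Finset.sum_nonneg fun j _ => mul_nonneg (sq_nonneg _) (div_nonneg (hφ0 j) (hm j).le)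
    · have := h.ellipsoid
      rwa [sqNorm_diagonal] at this
  · calc _ ≤ ∑ τ ∈ Finset.range N,
          (2 * σ ^ 2 + 2 * ψ * (meanSqErr n P lam wstar δ γ (1 - β) β τ).toReal) *
            ∑ j, lam j * (w j ^ 2 * V j) := by
          refine Finset.sum_le_sum fun τ hτ => mul_le_mul_of_nonneg_left ?_ (by positivity)
          refine Finset.sum_le_sum fun j _ => mul_le_mul_of_nonneg_left ?_ (hlam j)
          rw [mul_pow]
          exact mul_le_mul_of_nonneg_left (hV j τ (Finset.mem_range.1 hτ)) (sq_nonneg _)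
      _ ≤ (4 * σ ^ 2 + 24 * ψ * R) * n * ∑ j, lam j * (w j ^ 2 * V j) := by
          rw [← Finset.sum_mul]
          exact mul_le_mul_of_nonneg_right hsum (Finset.sum_nonneg fun j _ =>
            mul_nonneg (hlam j) (mul_nonneg (sq_nonneg _) (hV0 j)))
      _ = _ := by
          rw [Finset.mul_sum]
          exact Finset.sum_congr rfl fun j _ => by ring

end Risk

/-! ### The Gaussian response model -/

/-- The conditional law `N(⟨h, x⟩, v)` of the response given the covariate. -/
def gaussKernel {d : ℕ} (h : Fin d → ℝ) (v : NNReal) : Kernel (Fin d → ℝ) ℝ where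
  toFun x := gaussianReal (h ⬝ᵥ x) v
  measurable' := by
    have h1 : Measurable fun x : Fin d → ℝ => (h ⬝ᵥ x, v) := by
      simp only [dotProduct]; fun_prop
    exact measurable_gaussianReal.comp h1

lemma gaussKernel_apply {d : ℕ} (h : Fin d → ℝ) (v : NNReal) (x : Fin d → ℝ) :
    gaussKernel h v x = gaussianReal (h ⬝ᵥ x) v := rfl

instance {d : ℕ} (h : Fin d → ℝ) (v : NNReal) : IsMarkovKernel (gaussKernel h v) :=
  ⟨fun x => by rw [gaussKernel_apply]; infer_instance⟩

/-- Replace the conditional law of the response by `N(⟨h, x⟩, v)`. -/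
def gaussLaw {d : ℕ} (P : Measure (Obs d)) (h : Fin d → ℝ) (v : NNReal) : Measure (Obs d) :=
  P.fst ⊗ₘ gaussKernel h v

section GaussLaw

variable {d : ℕ} {P : Measure (Obs d)} [IsProbabilityMeasure P] {h : Fin d → ℝ} {v : NNReal}

instance : IsProbabilityMeasure (gaussLaw P h v) := by unfold gaussLaw; infer_instance

lemma fst_gaussLaw : (gaussLaw P h v).fst = P.fst := Measure.fst_compProd _ _

/-- The response is ⟨h, x⟩ plus noise independent of x, so mixed moments factor. -/
lemma gaussLaw_eq_map : gaussLaw P h v =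
    (P.fst.prod (gaussianReal 0 v)).map fun q => (q.1, h ⬝ᵥ q.1 + q.2) := by
  have hm : Measurable fun q : (Fin d → ℝ) × ℝ => (q.1, h ⬝ᵥ q.1 + q.2) := by
    simp only [dotProduct]; fun_prop
  refine Measure.ext_of_lintegral _ fun f hf => ?_
  rw [gaussLaw, Measure.lintegral_compProd hf, lintegral_map hf hm,
    lintegral_prod (fun q : (Fin d → ℝ) × ℝ => f (q.1, h ⬝ᵥ q.1 + q.2)) (hf.comp hm).aemeasurable]
  refine lintegral_congr fun x => ?_
  rw [gaussKernel_apply]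
  have : gaussianReal (h ⬝ᵥ x) v = (gaussianReal 0 v).map (h ⬝ᵥ x + ·) := by
    rw [gaussianReal_map_const_add, zero_add]
  rw [this, lintegral_map (by fun_prop) (by fun_prop)]

lemma integrable_of_fst_eq {P P' : Measure (Obs d)} (he : P.fst = P'.fst) {G : (Fin d → ℝ) → ℝ}
    (hG : Measurable G) (hi : Integrable (fun z => G z.1) P) :
    Integrable (fun z => G z.1) P' := by
  have h1 : Integrable G P.fst := (integrable_map_measure hG.aestronglyMeasurable
    measurable_fst.aemeasurable).2 hi
  rw [he] at h1
  exact (integrable_map_measure hG.aestronglyMeasurable measurable_fst.aemeasurable).1 h1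

lemma integral_fst_eq (P : Measure (Obs d)) {G : (Fin d → ℝ) → ℝ} (hG : Measurable G) :
    ∫ z, G z.1 ∂P = ∫ x, G x ∂P.fst :=
  (integral_map measurable_fst.aemeasurable hG.aestronglyMeasurable).symm

lemma memLp_of_fst_eq {P P' : Measure (Obs d)} (he : P.fst = P'.fst) {G : (Fin d → ℝ) → ℝ}
    (hG : Measurable G) (hi : MemLp (fun z => G z.1) 2 P) :
    MemLp (fun z => G z.1) 2 P' := by
  have h1 : MemLp G 2 P.fst := (memLp_map_measure_iff hG.aestronglyMeasurable
    measurable_fst.aemeasurable).2 hi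
  rw [he] at h1
  exact (memLp_map_measure_iff hG.aestronglyMeasurable measurable_fst.aemeasurable).1 h1

lemma matExp_eq_of_fst_eq {P P' : Measure (Obs d)} (he : P.fst = P'.fst)
    {F : (Fin d → ℝ) → Matrix (Fin d) (Fin d) ℝ} (hF : ∀ i j, Measurable fun x => F x i j) :
    matExp P (fun z => F z.1) = matExp P' (fun z => F z.1) := by
  ext i j
  simp only [matExp, of_apply]
  rw [integral_fst_eq P (hF i j), integral_fst_eq P' (hF i j), he]

lemma hasCovariance_gaussLaw {A : Matrix (Fin d) (Fin d) ℝ} (hP : HasCovariance P A) :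
    HasCovariance (gaussLaw P h v) A where
  prob := inferInstance
  memLp_x i := memLp_of_fst_eq (G := fun x => x i) fst_gaussLaw.symm (by fun_prop) (hP.memLp_x i)
  memLp_y := by
    have hm : Measurable fun q : (Fin d → ℝ) × ℝ => (q.1, h ⬝ᵥ q.1 + q.2) := by
      simp only [dotProduct]; fun_prop
    rw [gaussLaw_eq_map, memLp_map_measure_iff measurable_snd.aestronglyMeasurable hm.aemeasurable]
    have hG : Measurable fun x : Fin d → ℝ => h ⬝ᵥ x := by simp only [dotProduct]; fun_prop
    have h1 : MemLp (fun x : Fin d → ℝ => h ⬝ᵥ x) 2 P.fst :=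
      (memLp_map_measure_iff hG.aestronglyMeasurable measurable_fst.aemeasurable).2
        (hP.memLp_dotProduct h)
    have h2 : MemLp (fun x : ℝ => x) 2 (gaussianReal 0 v) := memLp_id_gaussianReal 2
    exact (h1.comp_fst _).add (h2.comp_snd _)
  cov := by
    rw [matExp_eq_of_fst_eq (P' := P) fst_gaussLaw (F := fun x => vecMulVec x x), hP.cov]
    intro i j
    simp only [vecMulVec_apply]
    fun_prop

lemma integral_gaussLaw_eq {G : Obs d → ℝ} (hG : Measurable G) :
    ∫ z, G z ∂gaussLaw P h v =
      ∫ q, G (q.1, h ⬝ᵥ q.1 + q.2) ∂(P.fst.prod (gaussianReal 0 v)) := by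
  have hm : Measurable fun q : (Fin d → ℝ) × ℝ => (q.1, h ⬝ᵥ q.1 + q.2) := by
    simp only [dotProduct]; fun_prop
  rw [gaussLaw_eq_map, integral_map hm.aemeasurable hG.aestronglyMeasurable]

omit [IsProbabilityMeasure P] in
lemma integral_sq_gaussianReal_zero : ∫ x, x ^ 2 ∂gaussianReal 0 v = v := by
  have := variance_fun_id_gaussianReal (μ := 0) (v := v)
  rw [variance_eq_integral (by fun_prop)] at this
  simpa using this

lemma popRisk_gaussLaw {A : Matrix (Fin d) (Fin d) ℝ} (hP : HasCovariance P A) (u : Fin d → ℝ) :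
    popRisk (gaussLaw P h v) u = 1 / 2 * (sqNorm A (h - u) + v) := by
  rw [popRisk, integral_gaussLaw_eq (by simp only [dotProduct]; fun_prop)]
  congr 1
  have hG : Measurable fun x : Fin d → ℝ => (h - u) ⬝ᵥ x := by simp only [dotProduct]; fun_prop
  have h1 : MemLp (fun x : Fin d → ℝ => (h - u) ⬝ᵥ x) 2 P.fst :=
    (memLp_map_measure_iff hG.aestronglyMeasurable measurable_fst.aemeasurable).2
      (hP.memLp_dotProduct (h - u))
  have h2 : MemLp (fun x : ℝ => x) 2 (gaussianReal 0 v) := memLp_id_gaussianReal 2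
  have i1 : Integrable (fun q : (Fin d → ℝ) × ℝ => ((h - u) ⬝ᵥ q.1) ^ 2)
      (P.fst.prod (gaussianReal 0 v)) := h1.integrable_sq.comp_fst _
  have i2 : Integrable (fun q : (Fin d → ℝ) × ℝ => q.2 ^ 2)
      (P.fst.prod (gaussianReal 0 v)) := h2.integrable_sq.comp_snd _
  have i3 : Integrable (fun q : (Fin d → ℝ) × ℝ => ((h - u) ⬝ᵥ q.1) * q.2)
      (P.fst.prod (gaussianReal 0 v)) :=
    (h1.integrable (by norm_num)).mul_prod (h2.integrable (by norm_num))
  have e : ∀ q : (Fin d → ℝ) × ℝ, (h ⬝ᵥ q.1 + q.2 - u ⬝ᵥ q.1) ^ 2 =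
      ((h - u) ⬝ᵥ q.1) ^ 2 + 2 * (((h - u) ⬝ᵥ q.1) * q.2) + q.2 ^ 2 := by
    intro q; rw [sub_dotProduct]; ring
  have i12 : Integrable (fun q : (Fin d → ℝ) × ℝ => ((h - u) ⬝ᵥ q.1) ^ 2
      + 2 * (((h - u) ⬝ᵥ q.1) * q.2)) (P.fst.prod (gaussianReal 0 v)) := i1.add (i3.const_mul 2)
  simp only [e]
  rw [integral_add i12 i2, integral_add i1 (i3.const_mul 2), integral_const_mul,
    integral_prod_mul (fun x : Fin d → ℝ => (h - u) ⬝ᵥ x) (fun y : ℝ => y),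
    integral_id_gaussianReal, integral_fun_fst (fun x : Fin d → ℝ => ((h - u) ⬝ᵥ x) ^ 2),
    integral_fun_snd (fun y : ℝ => y ^ 2), integral_sq_gaussianReal_zero]
  have h3 := hP.integral_sq (h - u)
  rw [integral_fst_eq P (G := fun x => ((h - u) ⬝ᵥ x) ^ 2) (hG.pow_const 2)] at h3
  rw [h3]
  simp

lemma sqNorm_sub_self (A : Matrix (Fin d) (Fin d) ℝ) : sqNorm A (h - h) = 0 := by
  simp [sqNorm]

omit [IsProbabilityMeasure P] in
/-- Replacing the conditional law of the response by `N(⟨h, x⟩, σ²)` keeps a pair of laws in the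
problem class. -/
lemma MemClass.replace_gaussLaw {σ ψ : ℝ} {M S T : Matrix (Fin d) (Fin d) ℝ} {Q : Measure (Obs d)}
    {wstar : Fin d → ℝ} (hmem : MemClass σ ψ M S T P Q wstar) (hM : sqNorm M h ≤ 1)
    (hv : (v : ℝ) = σ ^ 2)
    (hS : ∀ u, 0 ≤ sqNorm S u) (hT : ∀ u, 0 ≤ sqNorm T u) :
    MemClass σ ψ M S T (gaussLaw P h v) (gaussLaw Q h v) h := by
  have := hmem.source.prob
  have := hmem.target.prob
  have hm : ∀ i, Measurable fun x : Fin d → ℝ => x i := fun i => by fun_prop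
  have hmem2 : ∀ i, MemLp (fun x : Fin d → ℝ => x i) 2 P.fst := fun i =>
    (memLp_map_measure_iff (hm i).aestronglyMeasurable measurable_fst.aemeasurable).2
      (hmem.source.memLp_x i)
  have h2 : MemLp (fun x : ℝ => x) 2 (gaussianReal 0 v) := memLp_id_gaussianReal 2
  have hmap : Measurable fun q : (Fin d → ℝ) × ℝ => (q.1, h ⬝ᵥ q.1 + q.2) := by
    simp only [dotProduct]; fun_prop
  refine ⟨hasCovariance_gaussLaw hmem.source, hasCovariance_gaussLaw hmem.target,
    ⟨gaussKernel h v, inferInstance, ?_, ?_⟩, hM, ?_, ?_, ?_, ?_, ?_, ?_⟩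
  · rw [fst_gaussLaw]; rfl
  · rw [fst_gaussLaw]; rfl
  · intro u
    rw [popRisk_gaussLaw hmem.source, popRisk_gaussLaw hmem.source, sqNorm_sub_self]
    linarith [hS (h - u)]
  · intro u
    rw [popRisk_gaussLaw hmem.target, popRisk_gaussLaw hmem.target, sqNorm_sub_self]
    linarith [hT (h - u)]
  · intro i
    exact integrable_of_fst_eq (G := fun x => x i ^ 4) fst_gaussLaw.symm (by fun_prop)
      (hmem.fourth_integrable i)
  · intro A hA
    rw [matExp_eq_of_fst_eq (P' := P) fst_gaussLaw
      (F := fun x => vecMulVec x x * A * vecMulVec x x)]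
    · exact hmem.fourth_moment A hA
    · intro i j
      simp only [Matrix.mul_apply, vecMulVec_apply]
      fun_prop
  · intro i
    rw [gaussLaw_eq_map, integrable_map_measure _ hmap.aemeasurable]
    · have := (hmem2 i).integrable_sq.mul_prod h2.integrable_sq
      refine this.congr (ae_of_all _ fun q => ?_)
      simp only [Function.comp]
      rw [dotProduct_comm h, add_sub_cancel_left, mul_comm]
    · refine Measurable.aestronglyMeasurable ?_
      simp only [dotProduct]
      fun_prop
  · have e : matExp (gaussLaw P h v)
        (fun z => (z.2 - z.1 ⬝ᵥ h) ^ 2 • vecMulVec z.1 z.1) = σ ^ 2 • S := by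
      rw [← hmem.source.cov]
      ext i j
      simp only [matExp, Matrix.smul_apply, of_apply, vecMulVec_apply, smul_eq_mul]
      rw [integral_gaussLaw_eq (G := fun z => (z.2 - z.1 ⬝ᵥ h) ^ 2 * (z.1 i * z.1 j))]
      · have e2 : ∀ q : (Fin d → ℝ) × ℝ, (h ⬝ᵥ q.1 + q.2 - q.1 ⬝ᵥ h) ^ 2 * (q.1 i * q.1 j)
            = (q.1 i * q.1 j) * q.2 ^ 2 := by
          intro q; rw [dotProduct_comm h, add_sub_cancel_left, mul_comm]
        simp only [e2]
        rw [integral_prod_mul (fun x : Fin d → ℝ => x i * x j) (fun y : ℝ => y ^ 2),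
          integral_sq_gaussianReal_zero, hv,
          integral_fst_eq P (G := fun x => x i * x j) (by fun_prop), mul_comm]
      · simp only [dotProduct]
        fun_prop
    rw [e, sub_self]
    exact PosSemidef.zero

/-- Log-likelihood ratio of `gaussLaw P h v` against `gaussLaw P 0 v`. -/
def logLik (h : Fin d → ℝ) (v : NNReal) (z : Obs d) : ℝ :=
  (h ⬝ᵥ z.1) * z.2 / v - (h ⬝ᵥ z.1) ^ 2 / (2 * v)

lemma measurable_logLik (h : Fin d → ℝ) (v : NNReal) : Measurable (logLik h v) := by
  unfold logLik; simp only [dotProduct]; fun_prop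

/-- The regressor 0 serves as a common reference: the laws for h and -h then have explicit densities
on one probability space. -/
lemma gaussLaw_eq_withDensity (hv : v ≠ 0) : gaussLaw P h v =
    (gaussLaw P 0 v).withDensity fun z => ENNReal.ofReal (Real.exp (logLik h v z)) := by
  have hm : Measurable fun z : Obs d => ENNReal.ofReal (Real.exp (logLik h v z)) :=
    (measurable_logLik h v).exp.ennreal_ofReal
  refine Measure.ext_of_lintegral _ fun f hf => ?_
  rw [lintegral_withDensity_eq_lintegral_mul _ hm hf, gaussLaw, gaussLaw,
    Measure.lintegral_compProd hf, Measure.lintegral_compProd (hm.mul hf)]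
  refine lintegral_congr fun x => ?_
  have hmx : Measurable fun y : ℝ => (x, y) := by fun_prop
  rw [gaussKernel_apply, gaussKernel_apply, gaussianReal_of_var_ne_zero _ hv,
    gaussianReal_of_var_ne_zero _ hv,
    lintegral_withDensity_eq_lintegral_mul _ (measurable_gaussianPDF _ _)
      (g := fun y => f (x, y)) (hf.comp hmx),
    lintegral_withDensity_eq_lintegral_mul _ (measurable_gaussianPDF _ _)
      (g := fun y => ((fun z => ENNReal.ofReal (Real.exp (logLik h v z))) * f) (x, y))
      ((hm.mul hf).comp hmx)]
  refine lintegral_congr fun y => ?_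
  have hv' : (v : ℝ) ≠ 0 := by exact_mod_cast hv
  simp only [Pi.mul_apply]
  rw [← mul_assoc]
  congr 1
  rw [gaussianPDF, gaussianPDF, ← ENNReal.ofReal_mul (gaussianPDFReal_nonneg _ _ _)]
  congr 1
  rw [gaussianPDFReal, gaussianPDFReal, mul_assoc (√_)⁻¹, ← Real.exp_add, logLik, zero_dotProduct]
  congr 2
  field_simp
  ring

end GaussLaw

/-! ### Product densities and the two-point lower bound -/

lemma lintegral_pi_prod {n : ℕ} {X : Type*} [MeasurableSpace X] (P : Measure X)
    [IsProbabilityMeasure P] {f : Fin n → X → ℝ≥0∞} (hf : ∀ i, Measurable (f i)) :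
    ∫⁻ D, ∏ i, f i (D i) ∂(Measure.pi fun _ : Fin n => P) = ∏ i, ∫⁻ x, f i x ∂P := by
  have hi : iIndepFun (fun i (D : Fin n → X) => f i (D i)) (Measure.pi fun _ : Fin n => P) :=
    iIndepFun_pi fun i => (hf i).aemeasurable
  refine (lintegral_prod_eq_prod_lintegral_of_indepFun Finset.univ _ hi
    fun i => (hf i).comp (measurable_pi_apply i)).trans ?_
  refine Finset.prod_congr rfl fun i _ => ?_
  exact (measurePreserving_eval (fun _ : Fin n => P) i).lintegral_comp (hf i)

lemma pi_withDensity {n : ℕ} {X : Type*} [MeasurableSpace X] (P : Measure X)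
    [IsProbabilityMeasure P] {f : X → ℝ≥0∞} (hf : Measurable f)
    [IsProbabilityMeasure (P.withDensity f)] :
    (Measure.pi fun _ : Fin n => P.withDensity f) =
      (Measure.pi fun _ : Fin n => P).withDensity fun D => ∏ i, f (D i) := by
  refine Measure.pi_eq fun s hs => ?_
  rw [withDensity_apply _ (MeasurableSet.univ_pi hs), ← lintegral_indicator
    (MeasurableSet.univ_pi hs)]
  have e : ∀ D : Fin n → X, (Set.univ.pi s).indicator (fun D => ∏ i, f (D i)) D
      = ∏ i, (s i).indicator f (D i) := by
    intro D
    by_cases hD : D ∈ Set.univ.pi s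
    · rw [Set.indicator_of_mem hD]
      exact Finset.prod_congr rfl fun i _ => (Set.indicator_of_mem (hD i trivial) f).symm
    · rw [Set.indicator_of_notMem hD]
      simp only [Set.mem_pi, Set.mem_univ, true_implies, not_forall] at hD
      obtain ⟨i, hi⟩ := hD
      exact (Finset.prod_eq_zero (Finset.mem_univ i) (Set.indicator_of_notMem hi f)).symm
  simp only [e]
  rw [lintegral_pi_prod P fun i => hf.indicator (hs i)]
  refine Finset.prod_congr rfl fun i _ => ?_
  rw [lintegral_indicator (hs i), withDensity_apply _ (hs i)]

section TwoPoint

variable {d : ℕ} {P : Measure (Obs d)} [IsProbabilityMeasure P] {h : Fin d → ℝ} {v : NNReal}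

lemma pi_gaussLaw (hv : v ≠ 0) (n : ℕ) : (Measure.pi fun _ : Fin n => gaussLaw P h v) =
    (Measure.pi fun _ : Fin n => gaussLaw P 0 v).withDensity fun D =>
      ENNReal.ofReal (Real.exp (∑ i, logLik h v (D i))) := by
  have hm : Measurable fun z : Obs d => ENNReal.ofReal (Real.exp (logLik h v z)) :=
    (measurable_logLik h v).exp.ennreal_ofReal
  have e := gaussLaw_eq_withDensity (P := P) (h := h) hv
  have : IsProbabilityMeasure
      ((gaussLaw P 0 v).withDensity fun z => ENNReal.ofReal (Real.exp (logLik h v z))) := by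
    rw [← e]; infer_instance
  rw [e, pi_withDensity _ hm]
  congr 1
  ext D
  rw [Real.exp_sum, ENNReal.ofReal_prod_of_nonneg fun i _ => (Real.exp_pos _).le]

/-- The Hellinger affinity of one observation under `h` and `-h`. -/
lemma affinity_ge {A : Matrix (Fin d) (Fin d) ℝ} (hP : HasCovariance P A) (hv : v ≠ 0) :
    ENNReal.ofReal (1 - sqNorm A h / (2 * v)) ≤
      ∫⁻ z, ENNReal.ofReal (Real.exp (-((h ⬝ᵥ z.1) ^ 2 / (2 * v)))) ∂gaussLaw P 0 v := by
  have hc := hasCovariance_gaussLaw (h := 0) (v := v) hP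
  have hm : Measurable fun z : Obs d => Real.exp (-((h ⬝ᵥ z.1) ^ 2 / (2 * v))) := by
    simp only [dotProduct]; fun_prop
  have hv0 : (0 : ℝ) < v := by positivity
  have hint : Integrable (fun z : Obs d => Real.exp (-((h ⬝ᵥ z.1) ^ 2 / (2 * v))))
      (gaussLaw P 0 v) := by
    refine (integrable_const (1 : ℝ)).mono' hm.aestronglyMeasurable (ae_of_all _ fun z => ?_)
    rw [Real.norm_of_nonneg (Real.exp_pos _).le]
    exact Real.exp_le_one_iff.2 (by have : 0 ≤ (h ⬝ᵥ z.1) ^ 2 / (2 * v) := by positivity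
                                    linarith)
  rw [← ofReal_integral_eq_lintegral_ofReal hint (ae_of_all _ fun z => (Real.exp_pos _).le)]
  refine ENNReal.ofReal_le_ofReal ?_
  have i1 : Integrable (fun z : Obs d => (h ⬝ᵥ z.1) ^ 2 / (2 * v)) (gaussLaw P 0 v) :=
    (hc.memLp_dotProduct h).integrable_sq.div_const _
  calc 1 - sqNorm A h / (2 * v) = ∫ z, (1 - (h ⬝ᵥ z.1) ^ 2 / (2 * v)) ∂gaussLaw P 0 v := by
        rw [integral_sub (integrable_const _) i1, integral_div, hc.integral_sq]
        simp
    _ ≤ _ := integral_mono ((integrable_const _).sub i1) hint fun z => by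
        have := Real.add_one_le_exp (-((h ⬝ᵥ z.1) ^ 2 / (2 * v)))
        simp only
        linarith

/-- The affinity is multiplicative over observations, and Bernoulli's inequality gives (1 - q)ⁿ ≥ 1
- nq ≥ 1/2 with q = ‖h‖_A² / (2v). -/
lemma affinity_pi_ge {A : Matrix (Fin d) (Fin d) ℝ} (hP : HasCovariance P A) (hv : v ≠ 0) {n : ℕ}
    (hA : 0 ≤ sqNorm A h) (hn : n * sqNorm A h ≤ v) :
    ENNReal.ofReal (1 / 2) ≤
      ∫⁻ D, ∏ i : Fin n, ENNReal.ofReal (Real.exp (-((h ⬝ᵥ (D i).1) ^ 2 / (2 * v))))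
        ∂(Measure.pi fun _ : Fin n => gaussLaw P 0 v) := by
  have hv0 : (0 : ℝ) < v := by positivity
  have hm : Measurable fun z : Obs d =>
      ENNReal.ofReal (Real.exp (-((h ⬝ᵥ z.1) ^ 2 / (2 * v)))) := by
    simp only [dotProduct]; fun_prop
  refine le_of_le_of_eq ?_ (lintegral_pi_prod (gaussLaw P 0 v) (f := fun _ : Fin n =>
    fun z : Obs d => ENNReal.ofReal (Real.exp (-((h ⬝ᵥ z.1) ^ 2 / (2 * v))))) fun _ => hm).symm
  rw [Finset.prod_const, Finset.card_univ, Fintype.card_fin]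
  refine le_trans ?_ (pow_le_pow_left' (affinity_ge (h := h) hP hv) n)
  rcases Nat.eq_zero_or_pos n with rfl | hn0
  · simp only [pow_zero]
    rw [← ENNReal.ofReal_one]
    exact ENNReal.ofReal_le_ofReal (by norm_num)
  · have hn1 : (1 : ℝ) ≤ n := by exact_mod_cast hn0
    have hq : n * (sqNorm A h / (2 * v)) ≤ 1 / 2 := by
      rw [← mul_div_assoc, div_le_iff₀ (by positivity)]
      linarith
    have hq0 : 0 ≤ sqNorm A h / (2 * v) := by positivity
    have hq1 : sqNorm A h / (2 * v) ≤ 1 / 2 := by nlinarith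
    rw [← ENNReal.ofReal_pow (by linarith)]
    refine ENNReal.ofReal_le_ofReal ?_
    have := one_add_mul_le_pow (a := -(sqNorm A h / (2 * v))) (by linarith) n
    rw [← sub_eq_add_neg] at this
    linarith

/-- The overlap of the laws of `n` observations under `h` and `-h`. -/
lemma overlap_ge {A : Matrix (Fin d) (Fin d) ℝ} (hP : HasCovariance P A) (hv : v ≠ 0) {n : ℕ}
    (hA : 0 ≤ sqNorm A h) (hn : n * sqNorm A h ≤ v) :
    ENNReal.ofReal (1 / 8) ≤ ∫⁻ D, ENNReal.ofReal (min (Real.exp (∑ i, logLik h v (D i)))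
      (Real.exp (∑ i, logLik (-h) v (D i)))) ∂(Measure.pi fun _ : Fin n => gaussLaw P 0 v) := by
  set π₀ := Measure.pi fun _ : Fin n => gaussLaw P 0 v with hπ
  have hv0 : (0 : ℝ) < v := by positivity
  have hlm : ∀ h : Fin d → ℝ, Measurable fun D : Fin n → Obs d => ∑ i, logLik h v (D i) := fun h =>
    Finset.measurable_sum _ fun i _ => (measurable_logLik h v).comp (measurable_pi_apply i)
  have hone : ∀ h : Fin d → ℝ,
      ∫⁻ D, ENNReal.ofReal (Real.exp (∑ i, logLik h v (D i))) ∂π₀ = 1 := by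
    intro h
    have h1 := pi_gaussLaw (P := P) (h := h) hv n
    have h2 : (Measure.pi fun _ : Fin n => gaussLaw P h v) Set.univ = 1 := measure_univ
    rwa [h1, withDensity_apply _ MeasurableSet.univ, setLIntegral_univ] at h2
  have haff := affinity_pi_ge (n := n) hP hv hA hn
  rw [← hπ] at haff
  -- With a², b² the two likelihood ratios, this is ab/2 ≤ min(a², b²) + (a² + b²)/16. The left side
  -- integrates to at least 1/4 and the last term to 1/8, leaving an overlap of 1/8. In the product
  -- ab the linear parts of the log-likelihoods cancel.
  have hpt : ∀ D : Fin n → Obs d,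
      ENNReal.ofReal (1 / 2) *
        ∏ i : Fin n, ENNReal.ofReal (Real.exp (-((h ⬝ᵥ (D i).1) ^ 2 / (2 * v)))) ≤
      ENNReal.ofReal (min (Real.exp (∑ i, logLik h v (D i))) (Real.exp (∑ i, logLik (-h) v (D i))))
      + (ENNReal.ofReal (1 / 16) * ENNReal.ofReal (Real.exp (∑ i, logLik h v (D i)))
        + ENNReal.ofReal (1 / 16) * ENNReal.ofReal (Real.exp (∑ i, logLik (-h) v (D i)))) := by
    intro D
    set a := Real.exp ((∑ i, logLik h v (D i)) / 2) with ha
    set b := Real.exp ((∑ i, logLik (-h) v (D i)) / 2) with hb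
    have ea : Real.exp (∑ i, logLik h v (D i)) = a ^ 2 := by
      rw [ha, ← Real.exp_nat_mul]; congr 1; push_cast; ring
    have eb : Real.exp (∑ i, logLik (-h) v (D i)) = b ^ 2 := by
      rw [hb, ← Real.exp_nat_mul]; congr 1; push_cast; ring
    have eab : ∏ i : Fin n, ENNReal.ofReal (Real.exp (-((h ⬝ᵥ (D i).1) ^ 2 / (2 * v))))
        = ENNReal.ofReal (a * b) := by
      rw [← ENNReal.ofReal_prod_of_nonneg fun i _ => (Real.exp_pos _).le, ← Real.exp_sum, ha, hb,
        ← Real.exp_add, ← add_div, ← Finset.sum_add_distrib, Finset.sum_div]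
      congr 3
      ext i
      simp only [logLik, neg_dotProduct]
      ring
    have ha0 : 0 < a := Real.exp_pos _
    have hb0 : 0 < b := Real.exp_pos _
    rw [ea, eb, eab, ← ENNReal.ofReal_mul (by norm_num), ← ENNReal.ofReal_mul (by norm_num),
      ← ENNReal.ofReal_mul (by norm_num), ← ENNReal.ofReal_add (by positivity) (by positivity),
      ← ENNReal.ofReal_add (by positivity) (by positivity)]
    refine ENNReal.ofReal_le_ofReal ?_
    rcases min_choice (a ^ 2) (b ^ 2) with hm | hm <;> rw [hm]
    · nlinarith [sq_nonneg (a - b / 4)]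
    · nlinarith [sq_nonneg (b - a / 4)]
  have hI := lintegral_mono (μ := π₀) hpt
  have hmm : ∀ h : Fin d → ℝ, Measurable fun D : Fin n → Obs d =>
      ENNReal.ofReal (Real.exp (∑ i, logLik h v (D i))) := fun h => (hlm h).exp.ennreal_ofReal
  have hadd : Measurable fun D : Fin n → Obs d =>
      ENNReal.ofReal (1 / 16) * ENNReal.ofReal (Real.exp (∑ i, logLik h v (D i)))
        + ENNReal.ofReal (1 / 16) * ENNReal.ofReal (Real.exp (∑ i, logLik (-h) v (D i))) :=
    ((hmm h).const_mul _).add ((hmm (-h)).const_mul _)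
  rw [lintegral_const_mul' _ _ ENNReal.ofReal_ne_top, lintegral_add_right _ hadd,
    lintegral_add_left ((hmm h).const_mul _), lintegral_const_mul _ (hmm h),
    lintegral_const_mul _ (hmm (-h)), hone, hone, mul_one,
    ← ENNReal.ofReal_add (by norm_num) (by norm_num)] at hI
  have h3 : ENNReal.ofReal (1 / 4) ≤ _ := le_trans (le_trans (le_of_eq (by
    rw [← ENNReal.ofReal_mul (by norm_num)]; norm_num))
    (mul_le_mul_right haff (ENNReal.ofReal (1 / 2)))) hI
  have h4 : ENNReal.ofReal (1 / 4) = ENNReal.ofReal (1 / 8) + ENNReal.ofReal (1 / 16 + 1 / 16) := by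
    rw [← ENNReal.ofReal_add (by norm_num) (by norm_num)]; norm_num
  rw [h4] at h3
  exact (ENNReal.add_le_add_iff_right ENNReal.ofReal_ne_top).1 h3

end TwoPoint

/-- Two-point lower bound for the minimax risk in a rank-one direction. -/
theorem MemClass.minimaxRisk_ge {d n : ℕ} {σ ψ : ℝ} {M S : Matrix (Fin d) (Fin d) ℝ}
    {w : Fin d → ℝ} {P Q : Measure (Obs d)} {wstar : Fin d → ℝ}
    (hmem : MemClass σ ψ M S (vecMulVec w w) P Q wstar) (hσ : 0 < σ)
    (hS : ∀ u, 0 ≤ sqNorm S u) {h : Fin d → ℝ} (hM : sqNorm M h ≤ 1)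
    (hn : n * sqNorm S h ≤ σ ^ 2) :
    ENNReal.ofReal ((w ⬝ᵥ h) ^ 2 / 8) ≤ minimaxRisk σ ψ M S (vecMulVec w w) n := by
  have := hmem.source.prob
  set v : NNReal := ⟨σ ^ 2, sq_nonneg σ⟩ with hvdef
  have hvv : (v : ℝ) = σ ^ 2 := rfl
  have hv : v ≠ 0 := by
    intro h0
    have : (v : ℝ) = 0 := by rw [h0]; rfl
    rw [hvv] at this
    exact (pow_pos hσ 2).ne' this
  have hneg : ∀ A : Matrix (Fin d) (Fin d) ℝ, sqNorm A (-h) = sqNorm A h := by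
    intro A; simp [sqNorm, mulVec_neg]
  have hT : ∀ u, 0 ≤ sqNorm (vecMulVec w w) u := fun u => by
    rw [sqNorm_vecMulVec]; exact sq_nonneg _
  have hplus := hmem.replace_gaussLaw (h := h) hM hvv hS hT
  have hminus := hmem.replace_gaussLaw (h := -h) (by rwa [hneg]) hvv hS hT
  refine le_iInf fun e => ?_
  have := e.prob
  have hle : ∀ {P' Q' : Measure (Obs d)} {w' : Fin d → ℝ},
      MemClass σ ψ M S (vecMulVec w w) P' Q' w' →
      ∫⁻ D, ENNReal.ofReal (sqNorm (vecMulVec w w) (e.toFun D - w'))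
        ∂((Measure.pi fun _ : Fin n => P').prod e.law)
        ≤ randWorstRisk σ ψ M S (vecMulVec w w) e := by
    intro P' Q' w' h'
    unfold randWorstRisk
    exact le_iSup_of_le P' (le_iSup_of_le Q' (le_iSup_of_le w' (le_iSup_of_le h' le_rfl)))
  have h1 := hle hplus
  have h2 := hle hminus
  set π₀ := Measure.pi fun _ : Fin n => gaussLaw P 0 v with hπ
  have hlm : ∀ h : Fin d → ℝ, Measurable fun D : Fin n → Obs d =>
      ENNReal.ofReal (Real.exp (∑ i, logLik h v (D i))) := fun h =>
    (Finset.measurable_sum _ fun i _ => (measurable_logLik h v).comp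
      (measurable_pi_apply i)).exp.ennreal_ofReal
  have hloss : ∀ u : Fin d → ℝ, Measurable fun D : (Fin n → Obs d) × e.Ξ =>
      ENNReal.ofReal (sqNorm (vecMulVec w w) (e.toFun D - u)) := by
    intro u
    have hmf := e.measurable
    simp only [sqNorm_vecMulVec, dotProduct]
    refine Measurable.ennreal_ofReal (Measurable.pow_const ?_ 2)
    exact Finset.measurable_sum _ fun j _ =>
      (((measurable_pi_apply j).comp hmf).sub_const (u j)).const_mul (w j)
  have hchange : ∀ u h' : Fin d → ℝ,
      ∫⁻ D, ENNReal.ofReal (sqNorm (vecMulVec w w) (e.toFun D - u))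
        ∂((Measure.pi fun _ : Fin n => gaussLaw P h' v).prod e.law)
      = ∫⁻ D, ENNReal.ofReal (Real.exp (∑ i, logLik h' v (D.1 i))) *
          ENNReal.ofReal (sqNorm (vecMulVec w w) (e.toFun D - u)) ∂(π₀.prod e.law) := by
    intro u h'
    rw [lintegral_prod _ (hloss u).aemeasurable, lintegral_prod
      (fun D : (Fin n → Obs d) × e.Ξ => ENNReal.ofReal (Real.exp (∑ i, logLik h' v (D.1 i))) *
          ENNReal.ofReal (sqNorm (vecMulVec w w) (e.toFun D - u)))
      (((hlm h').comp measurable_fst).mul (hloss u)).aemeasurable, pi_gaussLaw hv,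
      lintegral_withDensity_eq_lintegral_mul _ (hlm h') (hloss u).lintegral_prod_right']
    refine lintegral_congr fun D => ?_
    simp only [Pi.mul_apply]
    rw [← lintegral_const_mul' _ _ ENNReal.ofReal_ne_top]
  rw [hchange] at h1 h2
  have hover := overlap_ge (h := h) (n := n) hmem.source hv (hS h) (by rw [hvv]; exact hn)
  have hmin : Measurable fun D : Fin n → Obs d => ENNReal.ofReal
      (min (Real.exp (∑ i, logLik h v (D i))) (Real.exp (∑ i, logLik (-h) v (D i)))) := by
    have hl : ∀ h : Fin d → ℝ, Measurable fun D : Fin n → Obs d =>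
        Real.exp (∑ i, logLik h v (D i)) := fun h =>
      (Finset.measurable_sum _ fun i _ => (measurable_logLik h v).comp
        (measurable_pi_apply i)).exp
    exact ((hl h).min (hl (-h))).ennreal_ofReal
  -- With x = w·ŵ and y = w·h, the two losses satisfy (x - y)² + (x + y)² ≥ 2y²; they are weighted
  -- by the smaller of the two densities.
  have hkey : ENNReal.ofReal (2 * (w ⬝ᵥ h) ^ 2) * ENNReal.ofReal (1 / 8) ≤
      2 * randWorstRisk σ ψ M S (vecMulVec w w) e := by
    calc ENNReal.ofReal (2 * (w ⬝ᵥ h) ^ 2) * ENNReal.ofReal (1 / 8)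
        ≤ ENNReal.ofReal (2 * (w ⬝ᵥ h) ^ 2) * ∫⁻ D, ENNReal.ofReal
          (min (Real.exp (∑ i, logLik h v (D i))) (Real.exp (∑ i, logLik (-h) v (D i)))) ∂π₀ :=
          mul_le_mul_right hover _
      _ = ∫⁻ D, ENNReal.ofReal (2 * (w ⬝ᵥ h) ^ 2) * ENNReal.ofReal
          (min (Real.exp (∑ i, logLik h v (D.1 i))) (Real.exp (∑ i, logLik (-h) v (D.1 i))))
            ∂(π₀.prod e.law) := by
          rw [lintegral_const_mul' _ _ ENNReal.ofReal_ne_top, lintegral_prod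
            (fun D : (Fin n → Obs d) × e.Ξ => ENNReal.ofReal (min
              (Real.exp (∑ i, logLik h v (D.1 i))) (Real.exp (∑ i, logLik (-h) v (D.1 i)))))
            (hmin.comp measurable_fst).aemeasurable]
          simp only [lintegral_const, measure_univ, mul_one]
      _ ≤ ∫⁻ D, (ENNReal.ofReal (Real.exp (∑ i, logLik h v (D.1 i))) *
          ENNReal.ofReal (sqNorm (vecMulVec w w) (e.toFun D - h))
          + ENNReal.ofReal (Real.exp (∑ i, logLik (-h) v (D.1 i))) *
          ENNReal.ofReal (sqNorm (vecMulVec w w) (e.toFun D - -h))) ∂(π₀.prod e.law) := by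
          refine lintegral_mono fun D => ?_
          have ha := Real.exp_pos (∑ i, logLik h v (D.1 i))
          have hb := Real.exp_pos (∑ i, logLik (-h) v (D.1 i))
          simp only [sqNorm_vecMulVec]
          rw [← ENNReal.ofReal_mul (by positivity), ← ENNReal.ofReal_mul ha.le,
            ← ENNReal.ofReal_mul hb.le, ← ENNReal.ofReal_add (by positivity) (by positivity)]
          refine ENNReal.ofReal_le_ofReal ?_
          rw [dotProduct_sub, dotProduct_sub, dotProduct_neg]
          generalize Real.exp (∑ i, logLik h v (D.1 i)) = a at *
          generalize Real.exp (∑ i, logLik (-h) v (D.1 i)) = b at *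
          generalize w ⬝ᵥ e.toFun D = x
          generalize w ⬝ᵥ h = y
          have t1 := mul_le_mul_of_nonneg_right (min_le_left a b) (sq_nonneg (x - y))
          have t2 := mul_le_mul_of_nonneg_right (min_le_right a b) (sq_nonneg (x - -y))
          have t3 : 0 ≤ min a b * x ^ 2 := mul_nonneg (le_min ha.le hb.le) (sq_nonneg x)
          nlinarith
      _ ≤ _ := by
          have hml : Measurable fun D : (Fin n → Obs d) × e.Ξ =>
              ENNReal.ofReal (Real.exp (∑ i, logLik h v (D.1 i))) *
                ENNReal.ofReal (sqNorm (vecMulVec w w) (e.toFun D - h)) :=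
            ((hlm h).comp measurable_fst).mul (hloss h)
          rw [lintegral_add_left hml, two_mul]
          exact add_le_add h1 h2
  have h5 : ENNReal.ofReal (2 * (w ⬝ᵥ h) ^ 2) * ENNReal.ofReal (1 / 8)
      = 2 * ENNReal.ofReal ((w ⬝ᵥ h) ^ 2 / 8) := by
    rw [← ENNReal.ofReal_mul (by positivity), show (2 : ℝ≥0∞) = ENNReal.ofReal 2 by simp,
      ← ENNReal.ofReal_mul (by norm_num)]
    congr 1; ring
  rw [h5] at hkey
  exact (ENNReal.mul_le_mul_iff_right (by norm_num) (by norm_num)).1 hkey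

/-- The modulus of continuity form of the lower bound for diagonal matrices. -/
theorem MemClass.minimaxRisk_diagonal_ge {d n : ℕ} {σ ψ : ℝ} {lam m w : Fin d → ℝ}
    {P Q : Measure (Obs d)} {wstar : Fin d → ℝ}
    (hmem : MemClass σ ψ (diagonal m) (diagonal lam) (vecMulVec w w) P Q wstar) (hσ : 0 < σ)
    (hlam : ∀ j, 0 < lam j) (hm : ∀ j, 0 < m j) :
    ENNReal.ofReal (min 1 (σ ^ 2) / 8 * ∑ j, w j ^ 2 / (m j + n * lam j)) ≤
      minimaxRisk σ ψ (diagonal m) (diagonal lam) (vecMulVec w w) n := by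
  set A := ∑ j, w j ^ 2 / (m j + n * lam j) with hA
  have hden : ∀ j, 0 < m j + n * lam j := fun j =>
    add_pos_of_pos_of_nonneg (hm j) (mul_nonneg n.cast_nonneg (hlam j).le)
  have hA0 : 0 ≤ A := Finset.sum_nonneg fun j _ => div_nonneg (sq_nonneg _) (hden j).le
  rcases hA0.eq_or_lt with hA1 | hA1
  · rw [← hA1]; simp
  set t := √(min 1 (σ ^ 2)) with ht
  have ht0 : 0 ≤ min 1 (σ ^ 2) := le_min zero_le_one (sq_nonneg σ)
  have ht2 : t ^ 2 = min 1 (σ ^ 2) := Real.sq_sqrt ht0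
  -- The equality case of Cauchy–Schwarz: h maximizes w·h under ‖h‖_M² + n‖h‖_S² ≤ t². The choice t²
  -- = min(1, σ²) meets both constraints of the two-point bound.
  set h : Fin d → ℝ := fun j => t / √A * (w j / (m j + n * lam j)) with hh
  have hsA : √A ^ 2 = A := Real.sq_sqrt hA0
  have hsA0 : 0 < √A := Real.sqrt_pos.2 hA1
  have hsum : sqNorm (diagonal m) h + n * sqNorm (diagonal lam) h = t ^ 2 := by
    rw [sqNorm_diagonal, sqNorm_diagonal, Finset.mul_sum, ← Finset.sum_add_distrib]
    have : ∀ j, m j * h j ^ 2 + n * (lam j * h j ^ 2)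
        = t ^ 2 / A * (w j ^ 2 / (m j + n * lam j)) := by
      intro j
      have h1 := (hden j).ne'
      simp only [hh, mul_pow, div_pow, hsA]
      field_simp
    simp only [this]
    rw [← Finset.mul_sum, ← hA]
    field_simp
  have hwh : w ⬝ᵥ h = t * √A := by
    have : ∀ j, w j * h j = t / √A * (w j ^ 2 / (m j + n * lam j)) := by
      intro j; simp only [hh]; ring
    simp only [dotProduct, this]
    rw [← Finset.mul_sum, ← hA]
    nth_rewrite 2 [← hsA]
    field_simp
  have hM0 : 0 ≤ sqNorm (diagonal m) h := by
    rw [sqNorm_diagonal]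
    exact Finset.sum_nonneg fun j _ => mul_nonneg (hm j).le (sq_nonneg _)
  have hS : ∀ u, 0 ≤ sqNorm (diagonal lam) u := fun u => by
    rw [sqNorm_diagonal]
    exact Finset.sum_nonneg fun j _ => mul_nonneg (hlam j).le (sq_nonneg _)
  have hnS : 0 ≤ n * sqNorm (diagonal lam) h := mul_nonneg n.cast_nonneg (hS h)
  have := hmem.minimaxRisk_ge (n := n) hσ hS (h := h)
    (by linarith [min_le_left 1 (σ ^ 2)]) (by linarith [min_le_right 1 (σ ^ 2)])
  refine le_trans (ENNReal.ofReal_le_ofReal (le_of_eq ?_)) this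
  rw [hwh, mul_pow, hsA, ht2]
  ring

/-! ### Sums of power laws -/

section PowerSums

lemma exists_sum_powerLaw_le {q : ℝ} (hq : 1 < q) :
    ∃ Z : ℝ, 0 < Z ∧ ∀ d : ℕ, ∑ j : Fin d, ((j : ℝ) + 1) ^ (-q) ≤ Z := by
  have hs : Summable fun n : ℕ => ((n : ℝ) + 1) ^ (-q) := by
    have := (summable_nat_add_iff 1).2 (Real.summable_nat_rpow.2 (by linarith : -q < -1))
    simpa using this
  have h0 : ∀ n : ℕ, 0 ≤ ((n : ℝ) + 1) ^ (-q) := fun n => by positivity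
  have h1 : 0 ≤ ∑' n : ℕ, ((n : ℝ) + 1) ^ (-q) := tsum_nonneg h0
  refine ⟨∑' n : ℕ, ((n : ℝ) + 1) ^ (-q) + 1, by linarith, fun d => ?_⟩
  rw [Fin.sum_univ_eq_sum_range (fun n : ℕ => ((n : ℝ) + 1) ^ (-q))]
  have := hs.sum_le_tsum (Finset.range d) fun i _ => h0 i
  linarith

/-- This is the comparison with ∫ x^(-p) over [t, t+1], obtained without integrals by applying 1 + x
≤ eˣ twice. -/
lemma rpow_neg_succ_le {p t : ℝ} (hp : 1 < p) (ht : 0 < t) :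
    (t + 1) ^ (-p) ≤ (t ^ (1 - p) - (t + 1) ^ (1 - p)) / (p - 1) := by
  have hu : 0 < t + 1 := by linarith
  rw [le_div_iff₀ (by linarith)]
  have h1 : t / (t + 1) ≤ Real.exp (-(1 / (t + 1))) := by
    have := Real.add_one_le_exp (-(1 / (t + 1)))
    have e : -(1 / (t + 1)) + 1 = t / (t + 1) := by field_simp; ring
    rwa [e] at this
  have h2 := Real.rpow_le_rpow_of_nonpos (by positivity) h1 (by linarith : 1 - p ≤ 0)
  rw [← Real.exp_mul, Real.div_rpow ht.le hu.le] at h2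
  have h3 := Real.add_one_le_exp (-(1 / (t + 1)) * (1 - p))
  have h4 := h3.trans h2
  rw [le_div_iff₀ (by positivity)] at h4
  have h5 : (t + 1) ^ (1 - p) = (t + 1) * (t + 1) ^ (-p) := by
    rw [show 1 - p = 1 + -p by ring, Real.rpow_add hu, Real.rpow_one]
  have h6 : (-(1 / (t + 1)) * (1 - p) + 1) * (t + 1) ^ (1 - p)
      = (p - 1) * (t + 1) ^ (-p) + (t + 1) ^ (1 - p) := by
    rw [h5]; field_simp; ring
  rw [h6] at h4
  linarith

/-- Tail sums of power laws. -/
lemma sum_tail_le {p B : ℝ} (hp : 1 < p) (hB : 2 ≤ B) (d : ℕ) :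
    ∑ j : Fin d, (if B < (j : ℝ) + 1 then ((j : ℝ) + 1) ^ (-p) else 0)
      ≤ (2 ^ (p - 1) / (p - 1)) * B ^ (1 - p) := by
  -- A telescoping bound; the maximum keeps the expression constant until the indices pass B.
  have key : ∀ d : ℕ, ∑ j : Fin d, (if B < (j : ℝ) + 1 then ((j : ℝ) + 1) ^ (-p) else 0)
      ≤ ((B - 1) ^ (1 - p) - (max (d : ℝ) (B - 1)) ^ (1 - p)) / (p - 1) := by
    intro d
    rw [Fin.sum_univ_eq_sum_range (fun j : ℕ => if B < (j : ℝ) + 1 then ((j : ℝ) + 1) ^ (-p) else 0)]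
    induction d with
    | zero => simp [max_eq_right (by linarith : (0 : ℝ) ≤ B - 1)]
    | succ d ih =>
      rw [Finset.sum_range_succ]
      have hp1 : 0 < p - 1 := by linarith
      split_ifs with h
      · have h1 : B - 1 < d := by linarith
        have hd : (0 : ℝ) < d := by linarith
        rw [max_eq_left h1.le] at ih
        push_cast
        rw [max_eq_left (by linarith)]
        have h2 := rpow_neg_succ_le hp hd
        have e : ((B - 1) ^ (1 - p) - ((d : ℝ) + 1) ^ (1 - p)) / (p - 1) =
            ((B - 1) ^ (1 - p) - (d : ℝ) ^ (1 - p)) / (p - 1)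
            + ((d : ℝ) ^ (1 - p) - ((d : ℝ) + 1) ^ (1 - p)) / (p - 1) := by ring
        rw [e]
        exact add_le_add ih h2
      · rw [add_zero]
        refine ih.trans (div_le_div_of_nonneg_right ?_ hp1.le)
        have h3 : max (d : ℝ) (B - 1) ≤ max ((d + 1 : ℕ) : ℝ) (B - 1) :=
          max_le_max_right _ (by push_cast; linarith)
        have h4 := Real.rpow_le_rpow_of_nonpos (lt_max_of_lt_right (by linarith)) h3
          (by linarith : 1 - p ≤ 0)
        linarith
  have hp1 : 0 < p - 1 := by linarith
  refine (key d).trans ?_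
  have h1 : 0 ≤ (max (d : ℝ) (B - 1)) ^ (1 - p) :=
    Real.rpow_nonneg (le_max_of_le_right (by linarith)) _
  have h2 : (B - 1) ^ (1 - p) ≤ (B / 2) ^ (1 - p) :=
    Real.rpow_le_rpow_of_nonpos (by linarith) (by linarith) (by linarith)
  have h3 : (B / 2) ^ (1 - p) = 2 ^ (p - 1) * B ^ (1 - p) := by
    rw [Real.div_rpow (by linarith) (by norm_num), div_eq_mul_inv, ← Real.rpow_neg (by norm_num),
      mul_comm]
    congr 2; ring
  rw [div_mul_eq_mul_div, ← h3]
  exact div_le_div_of_nonneg_right (by linarith) hp1.le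

/-- A block of indices just below `B` contributes at least `B / 4` terms. -/
lemma block_le_sum {d : ℕ} {B c : ℝ} (hB : 4 ≤ B) (hd : B < d) {f : Fin d → ℝ} (hf : ∀ j, 0 ≤ f j)
    (hc : 0 ≤ c) (h : ∀ j : Fin d, B / 2 ≤ (j : ℝ) + 1 → (j : ℝ) + 1 ≤ B → c ≤ f j) :
    B / 4 * c ≤ ∑ j, f j := by
  set k := ⌊B⌋₊ with hk
  have hkB : (k : ℝ) ≤ B := Nat.floor_le (by linarith)
  have hBk : B < k + 1 := Nat.lt_floor_add_one B
  have hkd : k ≤ d := by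
    have : (k : ℝ) < d := lt_of_le_of_lt hkB hd
    exact_mod_cast this.le
  have h2 : ((k / 2 : ℕ) : ℝ) ≤ k / 2 := Nat.cast_div_le
  have h3 : (k : ℝ) ≤ 2 * ((k / 2 : ℕ) : ℝ) + 1 := by
    have : k ≤ 2 * (k / 2) + 1 := by omega
    exact_mod_cast this
  rw [Finset.sum_fin_eq_sum_range]
  have hsub : Finset.Ico (k / 2) k ⊆ Finset.range d := fun i hi =>
    Finset.mem_range.2 ((Finset.mem_Ico.1 hi).2.trans_le hkd)
  refine le_trans ?_ (Finset.sum_le_sum_of_subset_of_nonneg hsub fun i _ _ => ?_)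
  · have hle : ∀ i ∈ Finset.Ico (k / 2) k, c ≤ if h : i < d then f ⟨i, h⟩ else 0 := by
      intro i hi
      obtain ⟨hi1, hi2⟩ := Finset.mem_Ico.1 hi
      rw [dif_pos (hi2.trans_le hkd)]
      -- Even with k / 2 rounded down, i + 1 ≥ (k + 1)/2 > B/2, so the index lies in the block.
      have a1 : ((k / 2 : ℕ) : ℝ) ≤ i := by exact_mod_cast hi1
      have a2 : (i : ℝ) + 1 ≤ k := by exact_mod_cast hi2
      exact h _ (by simp only; linarith) (by simp only; linarith)
    have := Finset.card_nsmul_le_sum _ _ _ hle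
    rw [nsmul_eq_mul, Nat.card_Ico, Nat.cast_sub (Nat.div_le_self k 2)] at this
    refine le_trans (mul_le_mul_of_nonneg_right ?_ hc) this
    linarith
  · split_ifs
    · exact hf _
    · exact le_rfl

end PowerSums

/-! ### Unresolved directions against the block at the resolution -/

section Comparison

variable {a s r c₁ c₂ : ℝ}

/-- Directions below the resolution `n ^ (-1/s)` of the sample are dominated by the directions at
the resolution. -/
lemma exists_tail_le_block (ha : 1 < a) (hs : 0 < s) (hr : 1 / a - 2 < r) (hc₁ : 0 < c₁)
    (hc₂ : 0 < c₂) : ∃ C : ℝ, 0 < C ∧ ∀ (d n : ℕ) (lam m w : Fin d → ℝ),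
      Comparable c₁ c₂ lam (powerLaw d (-a)) →
      Comparable c₁ c₂ m (fun i => lam i ^ (1 - s)) →
      Comparable c₁ c₂ w (powerLaw d (-((1 + r) * a / 2))) →
      4 ≤ c₁ ^ (1 / a) * (n : ℝ) ^ (1 / (a * s)) →
      n * ((n : ℝ) ^ (1 / s - 1)) ^ 2 * ∑ j, (if n * lam j ^ s < 1 then w j ^ 2 * lam j else 0)
        ≤ C * ∑ j, w j ^ 2 / (m j + n * lam j) := by
  have ha0 : 0 < a := by linarith
  set q := (1 + r) * a with hq
  set p := q + a with hpdef
  -- The condition r > 1/a - 2 says exactly that w_j² λ_j ≍ j^(-p) is summable.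
  have hp : 1 < p := by
    have h1 := mul_lt_mul_of_pos_right hr ha0
    have h2 : (1 / a - 2) * a = 1 - 2 * a := by field_simp
    rw [h2] at h1
    rw [hpdef, hq]; linarith
  have hcq : 0 < min 1 ((2 : ℝ) ^ q) := lt_min one_pos (by positivity)
  set D := c₂ * 2 ^ a / c₁ with hD
  have hD0 : 0 < D := by positivity
  have hp1 : 0 < p - 1 := by linarith
  refine ⟨(c₂ ^ 3 * (2 ^ (p - 1) / (p - 1)) / c₁) /
    (c₁ ^ 2 * min 1 (2 ^ q) / ((c₂ + 1) * D) / 4), by positivity, ?_⟩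
  intro d n lam m w hlam hm hw hn
  have hn0 : (0 : ℝ) < n := by
    rcases Nat.eq_zero_or_pos n with rfl | h
    · rw [Nat.cast_zero, Real.zero_rpow (by positivity), mul_zero] at hn
      linarith
    · exact_mod_cast h
  set N : ℝ := (n : ℝ) with hN
  -- B solves c₁ B^(-a) = n^(-1/s), so every index up to B is resolved.
  set B := c₁ ^ (1 / a) * N ^ (1 / (a * s)) with hB
  have hB0 : 0 < B := by linarith
  have hjp : ∀ j : Fin d, (0 : ℝ) < (j : ℝ) + 1 := fun j => by positivity
  have hlam1 : ∀ j : Fin d, c₁ * ((j : ℝ) + 1) ^ (-a) ≤ lam j := fun j => (hlam j).1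
  have hlam2 : ∀ j : Fin d, lam j ≤ c₂ * ((j : ℝ) + 1) ^ (-a) := fun j => (hlam j).2
  have hlam0 : ∀ j, 0 < lam j := fun j =>
    lt_of_lt_of_le (mul_pos hc₁ (Real.rpow_pos_of_pos (hjp j) _)) (hlam1 j)
  have hm0 : ∀ j, 0 < m j := fun j =>
    lt_of_lt_of_le (mul_pos hc₁ (Real.rpow_pos_of_pos (hlam0 j) _)) (hm j).1
  have hwsq : ∀ j : Fin d, (((j : ℝ) + 1) ^ (-((1 + r) * a / 2))) ^ 2 = ((j : ℝ) + 1) ^ (-q) := by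
    intro j
    rw [← Real.rpow_natCast, ← Real.rpow_mul (hjp j).le]
    congr 1; rw [hq]; push_cast; ring
  have hw0 : ∀ j : Fin d, 0 < ((j : ℝ) + 1) ^ (-((1 + r) * a / 2)) := fun j =>
    Real.rpow_pos_of_pos (hjp j) _
  have hw1 : ∀ j : Fin d, c₁ ^ 2 * ((j : ℝ) + 1) ^ (-q) ≤ w j ^ 2 := by
    intro j
    rw [← hwsq, ← mul_pow]
    exact pow_le_pow_left₀ (mul_pos hc₁ (hw0 j)).le (hw j).1 2
  have hw2 : ∀ j : Fin d, w j ^ 2 ≤ c₂ ^ 2 * ((j : ℝ) + 1) ^ (-q) := by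
    intro j
    rw [← hwsq, ← mul_pow]
    exact pow_le_pow_left₀ ((mul_pos hc₁ (hw0 j)).le.trans (hw j).1) (hw j).2 2
  have hBa : B ^ (-a) = N ^ (-(1 / s)) / c₁ := by
    rw [hB, Real.mul_rpow (by positivity) (by positivity), ← Real.rpow_mul hc₁.le,
      ← Real.rpow_mul hn0.le, show 1 / a * -a = -1 by field_simp,
      show 1 / (a * s) * -a = -(1 / s) by field_simp, Real.rpow_neg_one]
    ring
  have hNs : (N ^ (-(1 / s))) ^ s = 1 / N := by
    rw [← Real.rpow_mul hn0.le, show -(1 / s) * s = -1 by field_simp, Real.rpow_neg_one, one_div]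
  have hNN : N * N ^ (-(1 / s)) * N ^ (1 / s - 1) = 1 := by
    rw [mul_assoc, ← Real.rpow_add hn0]
    nth_rewrite 1 [← Real.rpow_one N]
    rw [← Real.rpow_add hn0, show (1 : ℝ) + (-(1 / s) + (1 / s - 1)) = 0 by ring, Real.rpow_zero]
  have hJ : ∀ j : Fin d, (j : ℝ) + 1 ≤ B → 1 ≤ N * lam j ^ s := by
    intro j hj
    have h1 : B ^ (-a) ≤ ((j : ℝ) + 1) ^ (-a) :=
      Real.rpow_le_rpow_of_nonpos (hjp j) hj (by linarith)
    have h2 : N ^ (-(1 / s)) ≤ lam j := by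
      have := (mul_le_mul_of_nonneg_left h1 hc₁.le).trans (hlam1 j)
      rwa [hBa, mul_div_cancel₀ _ hc₁.ne'] at this
    have h3 := Real.rpow_le_rpow (by positivity) h2 hs.le
    rw [hNs, div_le_iff₀ hn0] at h3
    linarith
  have hden : ∀ j, 0 < m j + N * lam j := fun j => by
    have := hm0 j
    have := hlam0 j
    positivity
  have hA0 : ∀ j, 0 ≤ w j ^ 2 / (m j + N * lam j) := fun j =>
    div_nonneg (sq_nonneg _) (hden j).le
  by_cases hne : ∃ j, N * lam j ^ s < 1
  swap
  · push Not at hne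
    have : ∑ j, (if N * lam j ^ s < 1 then w j ^ 2 * lam j else 0) = 0 :=
      Finset.sum_eq_zero fun j _ => if_neg (not_lt.2 (hne j))
    rw [this, mul_zero]
    exact mul_nonneg (by positivity) (Finset.sum_nonneg fun j _ => hA0 j)
  obtain ⟨j₀, hj₀⟩ := hne
  -- One unresolved direction forces d > B, so the block below B fits into the index set, uniformly
  -- in d.
  have hBd : B < d := by
    have h1 : B < (j₀ : ℝ) + 1 := by
      by_contra hcon
      linarith [hJ j₀ (not_lt.1 hcon)]
    have h2 : ((j₀ : ℕ) : ℝ) + 1 ≤ d := by exact_mod_cast j₀.2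
    linarith
  have hupper : ∑ j, (if N * lam j ^ s < 1 then w j ^ 2 * lam j else 0)
      ≤ c₂ ^ 3 * ((2 ^ (p - 1) / (p - 1)) * B ^ (1 - p)) := by
    refine le_trans ?_ (mul_le_mul_of_nonneg_left (sum_tail_le hp (by linarith) d) (by positivity))
    rw [Finset.mul_sum]
    refine Finset.sum_le_sum fun j _ => ?_
    by_cases h1 : N * lam j ^ s < 1
    · have h2 : B < (j : ℝ) + 1 := by
        by_contra hcon
        linarith [hJ j (not_lt.1 hcon)]
      rw [if_pos h1, if_pos h2]
      have h3 : ((j : ℝ) + 1) ^ (-p) = ((j : ℝ) + 1) ^ (-q) * ((j : ℝ) + 1) ^ (-a) := by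
        rw [← Real.rpow_add (hjp j)]; congr 1; rw [hpdef]; ring
      rw [h3]
      calc w j ^ 2 * lam j ≤ (c₂ ^ 2 * ((j : ℝ) + 1) ^ (-q)) * (c₂ * ((j : ℝ) + 1) ^ (-a)) :=
            mul_le_mul (hw2 j) (hlam2 j) (hlam0 j).le (by positivity)
        _ = _ := by ring
    · rw [if_neg h1]
      split_ifs
      · positivity
      · simp
  have hlower : B / 4 * (c₁ ^ 2 * min 1 (2 ^ q) / ((c₂ + 1) * D) * B ^ (-q) * N ^ (1 / s - 1))
      ≤ ∑ j, w j ^ 2 / (m j + N * lam j) := by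
    refine block_le_sum hn hBd hA0 (by positivity) fun j hj1 hj2 => ?_
    have h1 := hJ j hj2
    have hmle : m j ≤ c₂ * (N * lam j) := by
      refine (hm j).2.trans ?_
      have h2 : lam j ^ (1 - s) ≤ N * lam j := by
        rw [Real.rpow_sub (hlam0 j), Real.rpow_one,
          div_le_iff₀ (Real.rpow_pos_of_pos (hlam0 j) _)]
        nlinarith [hlam0 j]
      exact mul_le_mul_of_nonneg_left h2 hc₂.le
    have hlamle : lam j ≤ D * N ^ (-(1 / s)) := by
      have h2 : ((j : ℝ) + 1) ^ (-a) ≤ (B / 2) ^ (-a) :=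
        Real.rpow_le_rpow_of_nonpos (by linarith) hj1 (by linarith)
      have h3 : (B / 2) ^ (-a) = 2 ^ a * (N ^ (-(1 / s)) / c₁) := by
        rw [Real.div_rpow hB0.le (by norm_num), hBa, Real.rpow_neg (by norm_num : (0 : ℝ) ≤ 2) a,
          div_inv_eq_mul, mul_comm]
      refine (hlam2 j).trans ((mul_le_mul_of_nonneg_left h2 hc₂.le).trans (le_of_eq ?_))
      rw [h3, hD]; ring
    have hdle : m j + N * lam j ≤ (c₂ + 1) * D * (N * N ^ (-(1 / s))) := by
      have h2 : N * lam j ≤ N * (D * N ^ (-(1 / s))) := mul_le_mul_of_nonneg_left hlamle hn0.le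
      have h3 := mul_le_mul_of_nonneg_left h2 (by linarith : 0 ≤ c₂ + 1)
      linarith
    -- The exponent q = (1 + r)a may be negative, in which case w_j² is smallest at the lower end of
    -- the block; hence the factor min(1, 2^q).
    have hwle : c₁ ^ 2 * (min 1 (2 ^ q) * B ^ (-q)) ≤ w j ^ 2 := by
      refine le_trans (mul_le_mul_of_nonneg_left ?_ (by positivity)) (hw1 j)
      rcases le_total 0 q with hq0 | hq0
      · have h2 : B ^ (-q) ≤ ((j : ℝ) + 1) ^ (-q) :=
          Real.rpow_le_rpow_of_nonpos (hjp j) hj2 (by linarith)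
        exact (mul_le_of_le_one_left (by positivity) (min_le_left _ _)).trans h2
      · have h2 : (B / 2) ^ (-q) ≤ ((j : ℝ) + 1) ^ (-q) :=
          Real.rpow_le_rpow (by linarith) hj1 (by linarith)
        have h3 : (B / 2) ^ (-q) = 2 ^ q * B ^ (-q) := by
          rw [Real.div_rpow hB0.le (by norm_num), Real.rpow_neg (by norm_num : (0 : ℝ) ≤ 2) q,
            div_inv_eq_mul, mul_comm]
        rw [h3] at h2
        exact (mul_le_mul_of_nonneg_right (min_le_right _ _) (by positivity)).trans h2
    rw [le_div_iff₀ (hden j)]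
    refine le_trans (mul_le_mul_of_nonneg_left hdle (by positivity)) (le_trans (le_of_eq ?_) hwle)
    have h5 : c₁ ^ 2 * min 1 (2 ^ q) / ((c₂ + 1) * D) * B ^ (-q) * N ^ (1 / s - 1) *
        ((c₂ + 1) * D * (N * N ^ (-(1 / s))))
        = c₁ ^ 2 * (min 1 (2 ^ q) * B ^ (-q)) * (N * N ^ (-(1 / s)) * N ^ (1 / s - 1)) := by
      field_simp
    rw [h5, hNN, mul_one]
  have hBp : B ^ (1 - p) = B * B ^ (-q) * B ^ (-a) := by
    nth_rewrite 2 [← Real.rpow_one B]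
    rw [← Real.rpow_add hB0, ← Real.rpow_add hB0]
    congr 1; rw [hpdef]; ring
  calc N * (N ^ (1 / s - 1)) ^ 2 * ∑ j, (if N * lam j ^ s < 1 then w j ^ 2 * lam j else 0)
      ≤ N * (N ^ (1 / s - 1)) ^ 2 * (c₂ ^ 3 * ((2 ^ (p - 1) / (p - 1)) * B ^ (1 - p))) :=
        mul_le_mul_of_nonneg_left hupper (by positivity)
    _ = (c₂ ^ 3 * (2 ^ (p - 1) / (p - 1)) / c₁) * (B * B ^ (-q) * N ^ (1 / s - 1)) *
          (N * N ^ (-(1 / s)) * N ^ (1 / s - 1)) := by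
        rw [hBp, hBa]; ring
    _ = (c₂ ^ 3 * (2 ^ (p - 1) / (p - 1)) / c₁) /
        (c₁ ^ 2 * min 1 (2 ^ q) / ((c₂ + 1) * D) / 4) *
        (B / 4 * (c₁ ^ 2 * min 1 (2 ^ q) / ((c₂ + 1) * D) * B ^ (-q) * N ^ (1 / s - 1))) := by
        rw [hNN]
        have := hcq.ne'
        field_simp
    _ ≤ _ := mul_le_mul_of_nonneg_left hlower (by positivity)

end Comparison

/-! ### Number and length of the stages -/

section Schedule

variable {n : ℕ}

lemma cast_eq_exp_log (hl : 15 ≤ Real.log n) : (n : ℝ) = Real.exp (Real.log n) := by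
  refine (Real.exp_log ?_).symm
  rcases Nat.eq_zero_or_pos n with rfl | h
  · norm_num at hl
  · exact_mod_cast h

lemma three_mul_log_le (hl : 15 ≤ Real.log n) : 3 * Real.log n ≤ n := by
  have h := Real.quadratic_le_exp_of_nonneg (by linarith : 0 ≤ Real.log n)
  rw [← cast_eq_exp_log hl] at h
  nlinarith

lemma numStages_pos (hl : 15 ≤ Real.log n) : 0 < numStages n := by
  have h := three_mul_log_le hl
  have : (2 : ℝ) ≤ n := by linarith
  exact Nat.log_pos (by norm_num) (by exact_mod_cast this)

lemma numStages_le (hl : 15 ≤ Real.log n) : (numStages n : ℝ) ≤ 3 / 2 * Real.log n := by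
  have h := three_mul_log_le hl
  have hn : (0 : ℝ) < n := by linarith
  have h1 : 2 ^ numStages n ≤ n := Nat.pow_log_le_self 2 (by rintro rfl; simp at hn)
  have h2 : ((2 : ℝ) ^ numStages n) ≤ n := by exact_mod_cast h1
  have h3 := Real.log_le_log (by positivity) h2
  rw [Real.log_pow] at h3
  have h4 := Real.log_two_gt_d9
  have h5 : (0 : ℝ) ≤ numStages n := Nat.cast_nonneg _
  nlinarith

lemma le_stageLen (hl : 15 ≤ Real.log n) : (n : ℝ) / (3 * Real.log n) ≤ stageLen n := by
  have h := three_mul_log_le hl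
  have hL : (0 : ℝ) < numStages n := by exact_mod_cast numStages_pos hl
  have h1 : (n : ℝ) < numStages n * (stageLen n + 1 : ℕ) := by
    exact_mod_cast Nat.lt_mul_div_succ n (numStages_pos hl)
  push_cast at h1
  have h2 := numStages_le hl
  have hK : (0 : ℝ) ≤ stageLen n := Nat.cast_nonneg _
  have h3 : (numStages n : ℝ) * (stageLen n + 1) ≤ 3 / 2 * Real.log n * (stageLen n + 1) :=
    mul_le_mul_of_nonneg_right h2 (by linarith)
  rw [div_le_iff₀ (by linarith)]
  have h4 : 3 / 2 * Real.log n ≤ 3 / 2 * Real.log n * stageLen n := by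
    refine le_mul_of_one_le_right (by linarith) ?_
    by_contra hcon
    have h5 : stageLen n < 1 := by
      have := not_le.1 hcon
      exact_mod_cast this
    have h6 : stageLen n = 0 := by omega
    rw [h6, Nat.cast_zero] at h1
    linarith
  linarith

lemma stageLen_pos (hl : 15 ≤ Real.log n) : 0 < stageLen n := by
  have h := three_mul_log_le hl
  have h1 : (0 : ℝ) < n / (3 * Real.log n) := div_pos (by linarith) (by linarith)
  exact_mod_cast h1.trans_le (le_stageLen hl)

/-- From n < 2^(L+1), where L is the number of stages. -/
lemma sq_le_pow_numStages (hl : 15 ≤ Real.log n) : (n : ℝ) ^ 2 ≤ 16 * 4 ^ (numStages n - 1) := by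
  obtain ⟨k, hk⟩ := Nat.exists_eq_succ_of_ne_zero (numStages_pos hl).ne'
  have h1 : n < 2 ^ (numStages n + 1) := Nat.lt_pow_succ_log_self (by norm_num) n
  have h2 : (n : ℝ) ≤ 2 ^ (numStages n + 1) := by exact_mod_cast h1.le
  have h3 := pow_le_pow_left₀ (Nat.cast_nonneg n) h2 2
  refine h3.trans (le_of_eq ?_)
  rw [hk]
  simp only [Nat.succ_eq_add_one, Nat.add_sub_cancel]
  rw [show (4 : ℝ) = 2 ^ 2 by norm_num, ← pow_mul, ← pow_mul]
  ring

/-- A stage has length at least n/(3 ln n), so the exponent is at least (ln n)²/3, and this is at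
least 5 ln n because ln n ≥ 15. -/
lemma stage_contraction_le (hl : 15 ≤ Real.log n) {β : ℝ} (hβ : β = Real.log n ^ 3 / n)
    (hβ1 : β ≤ 1) : (1 - β) ^ stageLen n * (n : ℝ) ^ 5 ≤ 1 := by
  have hn : (0 : ℝ) < n := by linarith [three_mul_log_le hl]
  have hl0 : 0 < Real.log n := by linarith
  have h1 : 5 * Real.log n ≤ β * stageLen n := by
    have h2 := mul_le_mul_of_nonneg_left (le_stageLen hl) (by rw [hβ]; positivity : 0 ≤ β)
    have h3 : β * (n / (3 * Real.log n)) = Real.log n ^ 2 / 3 := by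
      rw [hβ]; field_simp
    rw [h3] at h2
    nlinarith
  have h4 : (1 - β) ^ stageLen n ≤ Real.exp (-(5 * Real.log n)) := by
    calc (1 - β) ^ stageLen n ≤ (Real.exp (-β)) ^ stageLen n :=
          pow_le_pow_left₀ (by linarith) (Real.one_sub_le_exp_neg β) _
      _ = Real.exp (-(β * stageLen n)) := by rw [← Real.exp_nat_mul]; congr 1; ring
      _ ≤ _ := Real.exp_le_exp.2 (by linarith)
  have h5 : (n : ℝ) ^ 5 = Real.exp (5 * Real.log n) := by
    conv_lhs => rw [cast_eq_exp_log hl]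
    rw [← Real.exp_nat_mul]; norm_num
  rw [h5]
  calc _ ≤ Real.exp (-(5 * Real.log n)) * Real.exp (5 * Real.log n) :=
        mul_le_mul_of_nonneg_right h4 (Real.exp_pos _).le
    _ = 1 := by rw [← Real.exp_add]; simp

end Schedule

/-! ### Consequences of the tuning in one direction -/

/-- The tuning of accelerated SGD that attains the minimax rate up to logarithms; `X` is the
ratio of the two step sizes. -/
structure Tuned (s c₂ g : ℝ) (n : ℕ) (β δ γ X : ℝ) : Prop where
  s_pos : 0 < s
  c₂_pos : 0 < c₂
  log_ge : 15 ≤ Real.log n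
  g_pos : 0 < g
  g_le : g ≤ 1
  g_mul_le : g * c₂ ≤ 1
  one_le_ratio : 1 ≤ X
  size : 4 * Real.log n ^ 3 * X ≤ n
  beta_eq : β = Real.log n ^ 3 / n
  gamma_eq : γ = g * (n : ℝ) ^ (1 / s - 1)
  gamma_eq_mul : γ = δ * X
  delta_pos : 0 < δ
  delta_le : δ ≤ g

namespace Tuned

variable {s c₂ g β δ γ X lam : ℝ} {n : ℕ}

lemma log_pos (h : Tuned s c₂ g n β δ γ X) : 0 < Real.log n := by linarith [h.log_ge]

lemma n_pos (h : Tuned s c₂ g n β δ γ X) : (0 : ℝ) < n := by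
  linarith [three_mul_log_le h.log_ge, h.log_ge]

lemma ratio_le (h : Tuned s c₂ g n β δ γ X) : X ≤ n / 4 := by
  have h1 : 1 ≤ Real.log n ^ 3 := one_le_pow₀ (by linarith [h.log_ge])
  have := mul_le_mul_of_nonneg_right h1 (by linarith [h.one_le_ratio] : 0 ≤ X)
  linarith [h.size]

lemma beta_pos (h : Tuned s c₂ g n β δ γ X) : 0 < β := by
  rw [h.beta_eq]
  exact div_pos (pow_pos h.log_pos 3) h.n_pos

lemma n_mul_beta (h : Tuned s c₂ g n β δ γ X) : n * β = Real.log n ^ 3 := by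
  rw [h.beta_eq, mul_div_cancel₀ _ h.n_pos.ne']

lemma ratio_mul_beta (h : Tuned s c₂ g n β δ γ X) : 4 * X * β ≤ 1 := by
  rw [h.beta_eq, ← mul_div_assoc, div_le_one h.n_pos]
  linarith [h.size]

lemma inv_beta_le (h : Tuned s c₂ g n β δ γ X) : 1 / β ≤ n := by
  rw [div_le_iff₀ h.beta_pos, h.n_mul_beta]
  exact one_le_pow₀ (by linarith [h.log_ge])

lemma beta_le (h : Tuned s c₂ g n β δ γ X) : β ≤ 1 / 4 := by
  have h1 := mul_le_mul_of_nonneg_right h.one_le_ratio h.beta_pos.le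
  linarith [h.ratio_mul_beta]

lemma delta_lam (h : Tuned s c₂ g n β δ γ X) (hl : 0 < lam) (hl' : lam ≤ c₂) : δ * lam ≤ 1 :=
  (mul_le_mul h.delta_le hl' hl.le h.g_pos.le).trans h.g_mul_le

lemma gamma_lam (h : Tuned s c₂ g n β δ γ X) (hl : 0 < lam) (hl' : lam ≤ c₂) :
    γ * lam ≤ n / 4 := by
  have h1 := mul_le_mul_of_nonneg_right (h.delta_lam hl hl') (by linarith [h.one_le_ratio] : 0 ≤ X)
  rw [h.gamma_eq_mul]
  linarith [h.ratio_le]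

lemma stepParams (h : Tuned s c₂ g n β δ γ X) (hl : 0 < lam) (hl' : lam ≤ c₂) :
    StepParams β δ γ lam where
  beta_pos := h.beta_pos
  beta_le := by linarith [h.beta_le]
  delta_pos := h.delta_pos
  delta_le := by rw [h.gamma_eq_mul]; exact le_mul_of_one_le_right h.delta_pos.le h.one_le_ratio
  momentum := by
    have := mul_le_mul_of_nonneg_left h.ratio_mul_beta h.delta_pos.le
    rw [h.gamma_eq_mul]; linarith
  lam_pos := hl
  delta_lam := h.delta_lam hl hl'

lemma gamma_pos (h : Tuned s c₂ g n β δ γ X) : 0 < γ := by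
  rw [h.gamma_eq]
  exact mul_pos h.g_pos (Real.rpow_pos_of_pos h.n_pos _)

lemma contraction_nonneg (h : Tuned s c₂ g n β δ γ X) : 0 ≤ (1 - β) ^ stageLen n :=
  pow_nonneg (by linarith [h.beta_le]) _

lemma contraction_le (h : Tuned s c₂ g n β δ γ X) : (1 - β) ^ stageLen n * (n : ℝ) ^ 5 ≤ 1 :=
  stage_contraction_le h.log_ge h.beta_eq (by linarith [h.beta_le])

lemma contraction_mul_le (h : Tuned s c₂ g n β δ γ X) : (1 - β) ^ stageLen n * (n : ℝ) ^ 4 ≤ 1 := by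
  have h1 : (1 : ℝ) ≤ n := by linarith [three_mul_log_le h.log_ge, h.log_ge]
  have h2 : (n : ℝ) ^ 4 ≤ (n : ℝ) ^ 5 := pow_le_pow_right₀ h1 (by norm_num)
  exact (mul_le_mul_of_nonneg_left h2 h.contraction_nonneg).trans h.contraction_le

lemma gamma_lam_div_beta (h : Tuned s c₂ g n β δ γ X) (hl : 0 < lam) (hl' : lam ≤ c₂) :
    γ * lam / β ≤ (n : ℝ) ^ 2 / 4 := by
  rw [div_eq_mul_one_div]
  have := mul_le_mul (h.gamma_lam hl hl') h.inv_beta_le (by have := h.beta_pos; positivity)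
    (by positivity)
  refine this.trans (le_of_eq (by ring))

lemma stage_contraction_mul_le (h : Tuned s c₂ g n β δ γ X) (hl : 0 < lam) (hl' : lam ≤ c₂) :
    (n : ℝ) ^ 2 * ((1 - β) ^ stageLen n * (γ * lam / β)) ≤ 1 / 4 := by
  have h1 := mul_le_mul_of_nonneg_left (h.gamma_lam_div_beta hl hl')
    (mul_nonneg (sq_nonneg (n : ℝ)) h.contraction_nonneg)
  have h2 := h.contraction_mul_le
  nlinarith

lemma bias_sum_le (h : Tuned s c₂ g n β δ γ X) (hl : 0 < lam) (hl' : lam ≤ c₂) :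
    2 * n + 3 / β + n * ((1 - β) ^ stageLen n * (3 / 2 * (γ * lam / β))) ≤ 6 * n := by
  have h1 := h.inv_beta_le
  have h2 := h.stage_contraction_mul_le hl hl'
  have h3 : (1 : ℝ) ≤ n := by linarith [three_mul_log_le h.log_ge, h.log_ge]
  have h4 : 0 ≤ (1 - β) ^ stageLen n * (γ * lam / β) :=
    mul_nonneg h.contraction_nonneg (div_nonneg (mul_nonneg h.gamma_pos.le hl.le) h.beta_pos.le)
  have h5 : n * ((1 - β) ^ stageLen n * (γ * lam / β)) ≤
      (n : ℝ) ^ 2 * ((1 - β) ^ stageLen n * (γ * lam / β)) :=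
    mul_le_mul_of_nonneg_right (by nlinarith) h4
  have e : 3 / β = 3 * (1 / β) := by ring
  have e2 : n * ((1 - β) ^ stageLen n * (3 / 2 * (γ * lam / β)))
    = 3 / 2 * (n * ((1 - β) ^ stageLen n * (γ * lam / β))) := by ring
  rw [e, e2]
  linarith

/-- Interpolation min(x, y) ≤ x^θ y^(1-θ) between the two costs of a kick. With u = j^(-a), the
factor u^θ is summable when aθ > 1, and the part from β gives n^(-(1-θ)) to compensate the ratio X.
-/
lemma stability_term_le (h : Tuned s c₂ g n β δ γ X) (hl : 0 < lam) {θ u : ℝ} (hθ : 0 < θ)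
    (hθ1 : θ < 1) (hu : 0 < u) (hu1 : u ≤ 1) (hlu : lam ≤ c₂ * u) :
    32 * (δ * lam) + (32 + 288 * (n * β)) * min (γ * lam) (2 * β * γ / δ)
      + lam ^ 2 * (n * ((1 - β) ^ stageLen n * (2 * γ * δ / β)))
      ≤ 33 * g * c₂ * u + 640 * Real.log n ^ 6 * X * (n : ℝ) ^ (-(1 - θ)) * u ^ θ := by
  have hn := h.n_pos
  have hlog := h.log_ge
  have hβ := h.beta_pos
  have hδ := h.delta_pos
  have hX : 0 < X := by linarith [h.one_le_ratio]
  have hl' : lam ≤ c₂ := hlu.trans (mul_le_of_le_one_right h.c₂_pos.le hu1)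
  have h1 : δ * lam ≤ g * c₂ * u := by
    rw [mul_assoc]
    exact mul_le_mul h.delta_le hlu hl.le h.g_pos.le
  have hδu : δ * lam ≤ u := h1.trans (mul_le_of_le_one_left hu.le h.g_mul_le)
  have h3 : lam ^ 2 * (n * ((1 - β) ^ stageLen n * (2 * γ * δ / β))) ≤ δ * lam := by
    have h4 := h.stage_contraction_mul_le hl hl'
    have h5 : (1 : ℝ) ≤ n := by linarith [three_mul_log_le h.log_ge]
    have h6 : 0 ≤ (1 - β) ^ stageLen n * (γ * lam / β) :=
      mul_nonneg h.contraction_nonneg (div_nonneg (mul_nonneg h.gamma_pos.le hl.le) hβ.le)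
    have h7 : n * ((1 - β) ^ stageLen n * (γ * lam / β)) ≤ 1 / 4 :=
      le_trans (mul_le_mul_of_nonneg_right (by nlinarith) h6) h4
    have e : lam ^ 2 * (n * ((1 - β) ^ stageLen n * (2 * γ * δ / β)))
      = 2 * (δ * lam) * (n * ((1 - β) ^ stageLen n * (γ * lam / β))) := by ring
    rw [e]
    have := mul_le_mul_of_nonneg_left h7 (by positivity : 0 ≤ 2 * (δ * lam))
    have : 0 ≤ δ * lam := by positivity
    linarith
  have hmin : min (γ * lam) (2 * β * γ / δ)
      ≤ X * (u ^ θ * (2 * Real.log n ^ 3 * (n : ℝ) ^ (-(1 - θ)))) := by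
    have e1 : γ * lam = X * (δ * lam) := by rw [h.gamma_eq_mul]; ring
    have e2 : 2 * β * γ / δ = X * (2 * β) := by rw [h.gamma_eq_mul]; field_simp
    rw [e1, e2, ← mul_min_of_nonneg _ _ hX.le]
    refine mul_le_mul_of_nonneg_left ?_ hX.le
    have hm0 : 0 < min (δ * lam) (2 * β) := lt_min (by positivity) (by positivity)
    have e3 : min (δ * lam) (2 * β)
        = min (δ * lam) (2 * β) ^ θ * min (δ * lam) (2 * β) ^ (1 - θ) := by
      rw [← Real.rpow_add hm0]; simp
    rw [e3]
    have h4 : min (δ * lam) (2 * β) ^ θ ≤ u ^ θ :=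
      Real.rpow_le_rpow hm0.le ((min_le_left _ _).trans hδu) hθ.le
    have h5 : min (δ * lam) (2 * β) ^ (1 - θ) ≤ 2 * Real.log n ^ 3 * (n : ℝ) ^ (-(1 - θ)) := by
      refine (Real.rpow_le_rpow hm0.le (min_le_right _ _) (by linarith)).trans ?_
      rw [h.beta_eq, ← mul_div_assoc, Real.div_rpow (by positivity) hn.le, Real.rpow_neg hn.le,
        div_eq_mul_inv]
      refine mul_le_mul_of_nonneg_right ?_ (by positivity)
      have h6 : 1 ≤ 2 * Real.log n ^ 3 := by
        have : 1 ≤ Real.log n ^ 3 := one_le_pow₀ (by linarith)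
        linarith
      conv_rhs => rw [← Real.rpow_one (2 * Real.log n ^ 3)]
      exact Real.rpow_le_rpow_of_exponent_le h6 (by linarith)
    exact mul_le_mul h4 h5 (Real.rpow_nonneg hm0.le _) (by positivity)
  have h8 : 32 + 288 * (n * β) ≤ 320 * Real.log n ^ 3 := by
    rw [h.n_mul_beta]
    have : 1 ≤ Real.log n ^ 3 := one_le_pow₀ (by linarith)
    linarith
  have h9 := mul_le_mul h8 hmin (le_min (mul_nonneg h.gamma_pos.le hl.le)
    (div_nonneg (mul_nonneg (by positivity) h.gamma_pos.le) hδ.le)) (by positivity)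
  have e4 : 320 * Real.log n ^ 3 * (X * (u ^ θ * (2 * Real.log n ^ 3 * (n : ℝ) ^ (-(1 - θ)))))
    = 640 * Real.log n ^ 6 * X * (n : ℝ) ^ (-(1 - θ)) * u ^ θ := by ring
  rw [e4] at h9
  linarith

/-- Since γλ ≤ n/4 and 4^(L-1) ≥ n²/16, the quotient is at most 4/n, which is below 2β. -/
lemma last_stage_le (h : Tuned s c₂ g n β δ γ X) (hl : 0 < lam) (hl' : lam ≤ c₂) :
    γ / 4 ^ (numStages n - 1) * lam ≤ 2 * β := by
  have hn := h.n_pos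
  have h1 := sq_le_pow_numStages h.log_ge
  have h2 := h.gamma_lam hl hl'
  have h3 : (2 : ℝ) ≤ Real.log n ^ 3 := by
    have : Real.log n ≤ Real.log n ^ 3 := le_self_pow₀ (by linarith [h.log_ge]) (by norm_num)
    linarith [h.log_ge]
  rw [div_mul_eq_mul_div, div_le_iff₀ (by positivity)]
  have h4 : (4 : ℝ) / n ≤ 2 * β := by
    rw [h.beta_eq, ← mul_div_assoc]
    exact div_le_div_of_nonneg_right (by linarith) hn.le
  have h5 : (n : ℝ) / 4 = 4 / n * (n ^ 2 / 16) := by field_simp; norm_num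
  calc γ * lam ≤ 4 / n * (n ^ 2 / 16) := by rw [← h5]; exact h2
    _ ≤ 2 * β * 4 ^ (numStages n - 1) :=
        mul_le_mul h4 (by linarith) (by positivity) (by have := h.beta_pos; positivity)

/-- The base is n^(1/s), the inverse of the resolution at which nλ^s = 1. -/
lemma sample_scale (h : Tuned s c₂ g n β δ γ X) :
    ((n : ℝ) * (n : ℝ) ^ (1 / s - 1)) ^ s = n := by
  have hn := h.n_pos
  have hs := h.s_pos
  have e : (n : ℝ) * (n : ℝ) ^ (1 / s - 1) = (n : ℝ) ^ (1 / s) := by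
    conv_lhs => enter [1]; rw [← Real.rpow_one (n : ℝ)]
    rw [← Real.rpow_add hn]; congr 1; ring
  rw [e, ← Real.rpow_mul hn.le, one_div_mul_cancel hs.ne', Real.rpow_one]

/-- Noise injected in unresolved directions never leaves the slow regime. -/
lemma gamma_lam_le_of_unresolved (h : Tuned s c₂ g n β δ γ X) (hl : 0 < lam)
    (hr : n * lam ^ s < 1) : γ * lam ≤ 8 * β := by
  have hn := h.n_pos
  have hx : 0 < (n : ℝ) ^ (1 / s - 1) := Real.rpow_pos_of_pos hn _
  have h1 : (n : ℝ) * (n : ℝ) ^ (1 / s - 1) * lam < 1 := by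
    have h2 : ((n : ℝ) * (n : ℝ) ^ (1 / s - 1) * lam) ^ s < 1 := by
      rw [Real.mul_rpow (by positivity) hl.le, h.sample_scale]
      exact hr
    by_contra hcon
    exact absurd (Real.one_le_rpow (not_lt.1 hcon) h.s_pos.le) (not_le.2 h2)
  have h3 : g * ((n : ℝ) * (n : ℝ) ^ (1 / s - 1) * lam) ≤ 1 * 1 :=
    mul_le_mul h.g_le h1.le (by positivity) zero_le_one
  have h4 : (1 : ℝ) ≤ Real.log n ^ 3 := one_le_pow₀ (by linarith [h.log_ge])
  rw [h.gamma_eq, h.beta_eq, ← mul_div_assoc, le_div_iff₀ hn]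
  linarith

end Tuned

/-! ### Matching the upper bound with the minimax sum -/

section Rate

/-- Bound for the squared noiseless error after all stages, relative to the initial one. -/
def biasFactor (n : ℕ) (β γ lam : ℝ) : ℝ :=
  if 2 * β < γ * lam then 3 * ((1 - β) ^ stageLen n * (γ * lam / β)) else 4

/-- Bound for the squared final response to a unit of noise. -/
def noiseFactor (s : ℝ) (n : ℕ) (β δ γ lam : ℝ) : ℝ :=
  if n * lam ^ s < 1 then 18 * γ ^ 2
  else 18 * (8 * β / lam) ^ 2 + (1 - β) ^ stageLen n * (4 * γ * δ / β)

/-- Write λ = λ^s λ^(1-s) and bound λ^s by c₂^s; this makes the source norm subordinate to the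
ellipsoid norm. -/
lemma le_mul_of_mul_rpow_le {s c₁ c₂ lam m : ℝ} (hs : 0 < s) (hc₁ : 0 < c₁) (hc₂ : 0 < c₂)
    (hl : 0 < lam) (hl' : lam ≤ c₂) (hm : c₁ * lam ^ (1 - s) ≤ m) : lam ≤ c₂ ^ s / c₁ * m := by
  have h5 : lam = lam ^ s * lam ^ (1 - s) := by rw [← Real.rpow_add hl]; simp
  rw [div_mul_eq_mul_div, le_div_iff₀ hc₁]
  calc lam * c₁ = lam ^ s * lam ^ (1 - s) * c₁ := by rw [← h5]
    _ = lam ^ s * (c₁ * lam ^ (1 - s)) := by ring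
    _ ≤ c₂ ^ s * m := mul_le_mul (Real.rpow_le_rpow hl.le hl' hs.le) hm
        (mul_nonneg hc₁.le (Real.rpow_nonneg hl.le _)) (by positivity)

namespace Tuned

variable {s c₁ c₂ g β δ γ X lam m : ℝ} {n : ℕ}

lemma sq_final_bias_le (h : Tuned s c₂ g n β δ γ X) (hl : 0 < lam) (hl' : lam ≤ c₂) (c : ℝ) :
    (traj (1 - β) β (fun t => δ / 4 ^ (t / stageLen n)) (fun t => γ / 4 ^ (t / stageLen n))
      lam 0 (c, c) (numStages n * stageLen n)).1 ^ 2 ≤ biasFactor n β γ lam * c ^ 2 := by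
  have hp := h.stepParams hl hl'
  have hK : stageLen n ≤ numStages n * stageLen n :=
    Nat.le_mul_of_pos_left _ (numStages_pos h.log_ge)
  unfold biasFactor
  split_ifs with hh
  · have := (sq_fst_le_pot hp.beta_pos hp.beta_le _).trans
      (mul_le_mul_of_nonneg_left (hp.pot_bias_high hh c hK) zero_le_two)
    refine this.trans (le_of_eq (by ring))
  · have := (sq_fst_le_pot hp.beta_pos hp.beta_le _).trans
      (mul_le_mul_of_nonneg_left (hp.pot_bias_low (K := stageLen n) hh c
        (numStages n * stageLen n)) zero_le_two)
    refine this.trans (le_of_eq (by ring))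

lemma sq_final_noise_le (h : Tuned s c₂ g n β δ γ X) (hl : 0 < lam) (hl' : lam ≤ c₂) {τ : ℕ}
    (hτ : τ < numStages n * stageLen n) :
    (traj (1 - β) β (fun t => δ / 4 ^ (t / stageLen n)) (fun t => γ / 4 ^ (t / stageLen n))
      lam (τ + 1) (δ / 4 ^ (τ / stageLen n), γ / 4 ^ (τ / stageLen n))
      (numStages n * stageLen n)).1 ^ 2 ≤ noiseFactor s n β δ γ lam := by
  have hp := h.stepParams hl hl'
  unfold noiseFactor
  split_ifs with hr
  · have h1 : γ / 4 ^ (τ / stageLen n) ≤ γ :=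
      div_le_self h.gamma_pos.le (one_le_pow₀ (by norm_num))
    have h0 : 0 ≤ γ / 4 ^ (τ / stageLen n) := div_nonneg h.gamma_pos.le (by positivity)
    refine (hp.sq_final_kick_le hτ ((mul_le_mul_of_nonneg_right h1 hl.le).trans
      (h.gamma_lam_le_of_unresolved hl hr))).trans ?_
    exact mul_le_mul_of_nonneg_left (pow_le_pow_left₀ h0 h1 2) (by norm_num)
  · exact hp.sq_final_kick_le' (stageLen_pos h.log_ge) hτ (h.last_stage_le hl hl')

lemma noiseFactor_nonneg (h : Tuned s c₂ g n β δ γ X) : 0 ≤ noiseFactor s n β δ γ lam := by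
  have := h.beta_pos
  have := h.gamma_pos
  have := h.delta_pos
  have := h.contraction_nonneg
  unfold noiseFactor
  split_ifs <;> positivity

/-- In the fast regime the contraction beats the factor n. In the slow regime γλ ≤ 2β forces n^(1/s)
λ = O((ln n)³), so nλ is at most of order (ln n)^(3s) m, and 1/m is comparable to 1/(m + nλ) up to
logarithms. -/
lemma biasFactor_div_le (h : Tuned s c₂ g n β δ γ X) (hc₁ : 0 < c₁) (hl : 0 < lam)
    (hl' : lam ≤ c₂) (hm : c₁ * lam ^ (1 - s) ≤ m) :
    biasFactor n β γ lam / m ≤ (4 + 4 * (2 / g) ^ s / c₁ * Real.log n ^ (3 * s)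
      + 3 * c₂ ^ s / c₁) * (1 / (m + n * lam)) := by
  have hn := h.n_pos
  have hs := h.s_pos
  have hg := h.g_pos
  have hc₂ := h.c₂_pos
  have hlog := h.log_pos
  have hp0 : 0 < lam ^ (1 - s) := Real.rpow_pos_of_pos hl _
  have hm0 : 0 < m := (mul_pos hc₁ hp0).trans_le hm
  have hA : 0 ≤ 4 * (2 / g) ^ s / c₁ * Real.log n ^ (3 * s) := by positivity
  have hB : 0 ≤ 3 * c₂ ^ s / c₁ := by positivity
  rw [mul_one_div, div_le_div_iff₀ hm0 (by positivity)]
  unfold biasFactor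
  split_ifs with hh
  · set e := (1 - β) ^ stageLen n * (γ * lam / β) with he
    have he0 : 0 ≤ e := mul_nonneg h.contraction_nonneg
      (div_nonneg (mul_nonneg h.gamma_pos.le hl.le) h.beta_pos.le)
    have h1 := h.stage_contraction_mul_le hl hl'
    have hn1 : (1 : ℝ) ≤ n := by linarith [three_mul_log_le h.log_ge, h.log_ge]
    have h2 : e * n ≤ 1 := by
      have h3 : e * n ≤ (n : ℝ) ^ 2 * e := by
        rw [mul_comm]
        exact mul_le_mul_of_nonneg_right (le_self_pow₀ hn1 two_ne_zero) he0
      linarith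
    have h3 : e ≤ 1 := (le_mul_of_one_le_right he0 hn1).trans h2
    have h4 := le_mul_of_mul_rpow_le hs hc₁ hc₂ hl hl' hm
    have h6 : 3 * e * (m + n * lam) ≤ 3 * m + 3 * (c₂ ^ s / c₁ * m) := by
      have h7 : e * m ≤ m := mul_le_of_le_one_left hm0.le h3
      have h8 : e * n * lam ≤ lam := mul_le_of_le_one_left hl.le h2
      linarith
    have e1 : 3 * c₂ ^ s / c₁ * m = 3 * (c₂ ^ s / c₁ * m) := by ring
    have h9 : 0 ≤ 4 * (2 / g) ^ s / c₁ * Real.log n ^ (3 * s) * m := mul_nonneg hA hm0.le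
    rw [add_mul, add_mul, e1]
    linarith
  · have hx : 0 < (n : ℝ) ^ (1 / s - 1) := Real.rpow_pos_of_pos hn _
    have h1 : (n : ℝ) * (n : ℝ) ^ (1 / s - 1) * lam ≤ 2 / g * Real.log n ^ 3 := by
      have h2 := not_lt.1 hh
      rw [h.gamma_eq, h.beta_eq, ← mul_div_assoc, le_div_iff₀ hn] at h2
      rw [div_mul_eq_mul_div, le_div_iff₀ hg]
      linarith
    have h2 := Real.rpow_le_rpow (by positivity) h1 hs.le
    rw [Real.mul_rpow (by positivity) hl.le, h.sample_scale,
      Real.mul_rpow (by positivity) (by positivity), ← Real.rpow_natCast,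
      ← Real.rpow_mul hlog.le] at h2
    have h3 : (n : ℝ) * lam ≤ (2 / g) ^ s / c₁ * Real.log n ^ (3 * s) * m := by
      have h5 : lam = lam ^ s * lam ^ (1 - s) := by rw [← Real.rpow_add hl]; simp
      have h6 := mul_le_mul h2 hm (mul_nonneg hc₁.le hp0.le) (by positivity)
      have e : (2 / g) ^ s / c₁ * Real.log n ^ (3 * s) * m
        = ((2 / g) ^ s * Real.log n ^ (((3 : ℕ) : ℝ) * s) * m) / c₁ := by push_cast; ring
      rw [e, le_div_iff₀ hc₁]
      calc n * lam * c₁ = n * (lam ^ s * lam ^ (1 - s)) * c₁ := by rw [← h5]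
        _ = n * lam ^ s * (c₁ * lam ^ (1 - s)) := by ring
        _ ≤ _ := h6
    have e : 4 * (2 / g) ^ s / c₁ * Real.log n ^ (3 * s) * m
      = 4 * ((2 / g) ^ s / c₁ * Real.log n ^ (3 * s) * m) := by ring
    have h7 : 0 ≤ 3 * c₂ ^ s / c₁ * m := mul_nonneg hB hm0.le
    rw [add_mul, add_mul, e]
    linarith

/-- In a resolved direction nλ(β/λ)² = (ln n)⁶/(nλ), and nλ^s ≥ 1 gives m ≤ c₂nλ, so 1/(nλ) is of
order 1/(m + nλ). Unresolved directions are left as a tail term, since they can be compared with the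
minimax sum only after summation. -/
lemma noiseFactor_le (h : Tuned s c₂ g n β δ γ X) (hl : 0 < lam)
    (hl' : lam ≤ c₂) (hm0 : 0 < m) (hm : m ≤ c₂ * lam ^ (1 - s)) :
    lam * noiseFactor s n β δ γ lam * n
      ≤ 18 * (n * ((n : ℝ) ^ (1 / s - 1)) ^ 2 * (if n * lam ^ s < 1 then lam else 0))
        + (c₂ + 1) * (1152 * Real.log n ^ 6 + 4) * (1 / (m + n * lam)) := by
  have hn := h.n_pos
  have hg := h.g_pos
  have hc₂ := h.c₂_pos
  have hlog := h.log_pos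
  have hβ := h.beta_pos
  unfold noiseFactor
  split_ifs with hr
  · have h1 : γ ^ 2 ≤ ((n : ℝ) ^ (1 / s - 1)) ^ 2 := by
      refine pow_le_pow_left₀ h.gamma_pos.le ?_ 2
      rw [h.gamma_eq]
      exact mul_le_of_le_one_left (by positivity) h.g_le
    have h2 := mul_le_mul_of_nonneg_left h1 (by positivity : 0 ≤ 18 * (lam * n))
    have h3 : 0 ≤ (c₂ + 1) * (1152 * Real.log n ^ 6 + 4) * (1 / (m + n * lam)) := by positivity
    linarith
  · rw [mul_zero, mul_zero, zero_add]
    have h1 : m ≤ c₂ * (n * lam) := by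
      refine hm.trans (mul_le_mul_of_nonneg_left ?_ hc₂.le)
      rw [Real.rpow_sub hl, Real.rpow_one, div_le_iff₀ (Real.rpow_pos_of_pos hl _)]
      have := mul_le_mul_of_nonneg_left (not_lt.1 hr) hl.le
      linarith
    have h2 : 1 / ((c₂ + 1) * (n * lam)) ≤ 1 / (m + n * lam) :=
      one_div_le_one_div_of_le (by positivity) (by linarith)
    have h3 : lam * (18 * (8 * β / lam) ^ 2) * n = 1152 * Real.log n ^ 6 / (n * lam) := by
      rw [h.beta_eq]; field_simp; norm_num
    have h4 : lam * ((1 - β) ^ stageLen n * (4 * γ * δ / β)) * n ≤ 4 / (n * lam) := by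
      rw [le_div_iff₀ (by positivity)]
      have h5 := h.stage_contraction_mul_le hl hl'
      have h6 := h.delta_lam hl hl'
      have h7 : 0 ≤ (1 - β) ^ stageLen n * (γ * lam / β) := mul_nonneg h.contraction_nonneg
        (div_nonneg (mul_nonneg h.gamma_pos.le hl.le) hβ.le)
      have h8 := mul_le_mul h5 h6 (mul_nonneg h.delta_pos.le hl.le) (by norm_num)
      have e : lam * ((1 - β) ^ stageLen n * (4 * γ * δ / β)) * n * (n * lam)
        = 4 * ((n : ℝ) ^ 2 * ((1 - β) ^ stageLen n * (γ * lam / β)) * (δ * lam)) := by ring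
      rw [e]; linarith
    have h9 := mul_le_mul_of_nonneg_left h2
      (by positivity : 0 ≤ (c₂ + 1) * (1152 * Real.log n ^ 6 + 4))
    have e : (c₂ + 1) * (1152 * Real.log n ^ 6 + 4) * (1 / ((c₂ + 1) * (n * lam)))
      = 1152 * Real.log n ^ 6 / (n * lam) + 4 / (n * lam) := by field_simp
    rw [e] at h9
    refine le_trans (le_of_eq ?_) ((add_le_add h3.le h4).trans h9)
    ring

end Tuned

lemma sum_lam_mul_sq_le {d : ℕ} {s c₁ c₂ : ℝ} (hs : 0 < s) (hc₁ : 0 < c₁) (hc₂ : 0 < c₂)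
    {lam m u : Fin d → ℝ} (hl : ∀ j, 0 < lam j) (hl' : ∀ j, lam j ≤ c₂)
    (hm : ∀ j, c₁ * lam j ^ (1 - s) ≤ m j) (hu : ∑ j, m j * u j ^ 2 ≤ 1) :
    ∑ j, lam j * u j ^ 2 ≤ c₂ ^ s / c₁ := by
  have hC : 0 ≤ c₂ ^ s / c₁ := by positivity
  calc ∑ j, lam j * u j ^ 2 ≤ ∑ j, c₂ ^ s / c₁ * (m j * u j ^ 2) := by
        refine Finset.sum_le_sum fun j _ => ?_
        rw [← mul_assoc]
        refine mul_le_mul_of_nonneg_right ?_ (sq_nonneg _)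
        exact le_mul_of_mul_rpow_le hs hc₁ hc₂ (hl j) (hl' j) (hm j)
    _ ≤ c₂ ^ s / c₁ := by
        rw [← Finset.mul_sum]
        exact mul_le_of_le_one_right hC hu

/-- Accelerated SGD with a stable tuning attains the minimax rate up to a power of the logarithm. -/
theorem exists_worstRisk_asgd_le {a s r c₁ c₂ σ ψ g θ Z Zθ : ℝ} (ha : 1 < a)
    (hr : 1 / a - 2 < r) (hc₁ : 0 < c₁) (hc₂ : 0 < c₂) (hσ : 0 < σ) (hψ : 0 < ψ)
    (hs : 0 < s) (hθ : 0 < θ) (hθ1 : θ < 1) (hg : 0 < g)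
    (hZ : ∀ d : ℕ, ∑ j : Fin d, ((j : ℝ) + 1) ^ (-a) ≤ Z)
    (hZθ : ∀ d : ℕ, ∑ j : Fin d, ((j : ℝ) + 1) ^ (-(a * θ)) ≤ Zθ)
    (hgZ : 33 * g * c₂ * Z ≤ 1 / (8 * ψ)) :
    ∃ C p : ℝ, 0 < C ∧ ∀ (d n : ℕ) (β δ γ X : ℝ) (lam m w : Fin d → ℝ),
      Comparable c₁ c₂ lam (powerLaw d (-a)) →
      Comparable c₁ c₂ m (fun i => lam i ^ (1 - s)) →
      Comparable c₁ c₂ w (powerLaw d (-((1 + r) * a / 2))) →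
      Tuned s c₂ g n β δ γ X →
      640 * Real.log n ^ 6 * X * (n : ℝ) ^ (-(1 - θ)) * Zθ ≤ 1 / (8 * ψ) →
      4 ≤ c₁ ^ (1 / a) * (n : ℝ) ^ (1 / (a * s)) →
      worstRisk σ ψ (diagonal m) (diagonal lam) (vecMulVec w w)
          (fun D : Fin n → Obs d => asgd δ γ (1 - β) β D)
        ≤ ENNReal.ofReal (C * Real.log n ^ p) *
          minimaxRisk σ ψ (diagonal m) (diagonal lam) (vecMulVec w w) n := by
  obtain ⟨Ct, hCt, htail⟩ := exists_tail_le_block ha hs hr hc₁ hc₂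
  set W := 4 * σ ^ 2 + 24 * ψ * (c₂ ^ s / c₁) with hW
  have hW0 : 0 < W := by positivity
  set κ := min 1 (σ ^ 2) / 8 with hκ
  have hκ0 : 0 < κ := div_pos (lt_min one_pos (by positivity)) (by norm_num)
  set C' := 4 + 4 * (2 / g) ^ s / c₁ + 3 * c₂ ^ s / c₁ + W * (18 * Ct + (c₂ + 1) * 1156) with hC'
  -- The exponent adds (ln n)^(3s) from the bias and (ln n)⁶ from the noise, which lets one power
  -- dominate both.
  refine ⟨C' / κ, 3 * s + 6, by positivity, ?_⟩
  intro d n β δ γ X lam m w hlam hm hw h hstab hn4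
  have hjp : ∀ j : Fin d, (0 : ℝ) < (j : ℝ) + 1 := fun j => by positivity
  have hl : ∀ j, 0 < lam j := fun j =>
    lt_of_lt_of_le (mul_pos hc₁ (Real.rpow_pos_of_pos (hjp j) _)) (hlam j).1
  have hu1 : ∀ j : Fin d, ((j : ℝ) + 1) ^ (-a) ≤ 1 := fun j =>
    Real.rpow_le_one_of_one_le_of_nonpos (by simp) (by linarith)
  have hl' : ∀ j, lam j ≤ c₂ := fun j =>
    (hlam j).2.trans (mul_le_of_le_one_right hc₂.le (hu1 j))
  have hm0 : ∀ j, 0 < m j := fun j =>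
    lt_of_lt_of_le (mul_pos hc₁ (Real.rpow_pos_of_pos (hl j) _)) (hm j).1
  have hlog1 : 1 ≤ Real.log n := by linarith [h.log_ge]
  set A := ∑ j, w j ^ 2 / (m j + n * lam j) with hA
  have hA0 : 0 ≤ A := Finset.sum_nonneg fun j _ => div_nonneg (sq_nonneg _)
    (add_nonneg (hm0 j).le (mul_nonneg h.n_pos.le (hl j).le))
  have hstab' : ∑ j, (32 * (δ * lam j) + (32 + 288 * (n * β)) * min (γ * lam j) (2 * β * γ / δ)
      + lam j ^ 2 * (n * ((1 - β) ^ stageLen n * (2 * γ * δ / β)))) ≤ 1 / (4 * ψ) := by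
    have hX : 0 ≤ X := by linarith [h.one_le_ratio]
    have hlog6 : 0 ≤ Real.log n ^ 6 := pow_nonneg (by linarith) 6
    calc _ ≤ ∑ j : Fin d, (33 * g * c₂ * ((j : ℝ) + 1) ^ (-a)
          + 640 * Real.log n ^ 6 * X * (n : ℝ) ^ (-(1 - θ)) * ((j : ℝ) + 1) ^ (-(a * θ))) := by
          refine Finset.sum_le_sum fun j _ => ?_
          have := h.stability_term_le (hl j) hθ hθ1 (Real.rpow_pos_of_pos (hjp j) (-a)) (hu1 j)
            (hlam j).2
          rwa [← Real.rpow_mul (hjp j).le, neg_mul] at this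
      _ ≤ 33 * g * c₂ * Z + 640 * Real.log n ^ 6 * X * (n : ℝ) ^ (-(1 - θ)) * Zθ := by
          rw [Finset.sum_add_distrib, ← Finset.mul_sum, ← Finset.mul_sum]
          exact add_le_add (mul_le_mul_of_nonneg_left (hZ d) (by positivity))
            (mul_le_mul_of_nonneg_left (hZθ d) (by positivity))
      _ ≤ 1 / (8 * ψ) + 1 / (8 * ψ) := add_le_add hgZ hstab
      _ = 1 / (4 * ψ) := by field_simp; norm_num
  have hsum : ∑ j, w j ^ 2 * (biasFactor n β γ (lam j) / m j
      + lam j * noiseFactor s n β δ γ (lam j) * (W * n)) ≤ C' * Real.log n ^ (3 * s + 6) * A := by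
    have hlp : 1 ≤ Real.log n ^ (3 * s + 6) := Real.one_le_rpow hlog1 (by positivity)
    have hl3 : Real.log n ^ (3 * s) ≤ Real.log n ^ (3 * s + 6) :=
      Real.rpow_le_rpow_of_exponent_le hlog1 (by linarith)
    have hl6 : Real.log n ^ 6 ≤ Real.log n ^ (3 * s + 6) := by
      rw [← Real.rpow_natCast]
      exact Real.rpow_le_rpow_of_exponent_le hlog1 (by push_cast; linarith)
    set ℓ := Real.log n ^ (3 * s + 6) with hℓ
    calc _ ≤ ∑ j, ((4 + 4 * (2 / g) ^ s / c₁ * Real.log n ^ (3 * s) + 3 * c₂ ^ s / c₁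
            + W * ((c₂ + 1) * (1152 * Real.log n ^ 6 + 4))) * (w j ^ 2 / (m j + n * lam j))
          + W * (18 * (n * ((n : ℝ) ^ (1 / s - 1)) ^ 2 *
            (if n * lam j ^ s < 1 then w j ^ 2 * lam j else 0)))) := by
          refine Finset.sum_le_sum fun j _ => ?_
          have h1 := h.biasFactor_div_le hc₁ (hl j) (hl' j) (hm j).1
          have h2 := mul_le_mul_of_nonneg_left
            (h.noiseFactor_le (hl j) (hl' j) (hm0 j) (hm j).2) hW0.le
          have h3 := mul_le_mul_of_nonneg_left (add_le_add h1 h2) (sq_nonneg (w j))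
          have e : (if n * lam j ^ s < 1 then w j ^ 2 * lam j else 0)
            = w j ^ 2 * (if n * lam j ^ s < 1 then lam j else 0) := by
            split_ifs <;> simp
          rw [e]
          refine le_trans (le_of_eq (by ring)) (h3.trans (le_of_eq (by ring)))
      _ = (4 + 4 * (2 / g) ^ s / c₁ * Real.log n ^ (3 * s) + 3 * c₂ ^ s / c₁
            + W * ((c₂ + 1) * (1152 * Real.log n ^ 6 + 4))) * A
          + W * (18 * (n * ((n : ℝ) ^ (1 / s - 1)) ^ 2 *
            ∑ j, (if n * lam j ^ s < 1 then w j ^ 2 * lam j else 0))) := by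
          rw [Finset.sum_add_distrib, ← Finset.mul_sum, ← Finset.mul_sum, ← Finset.mul_sum,
            ← Finset.mul_sum]
      _ ≤ (4 * ℓ + 4 * (2 / g) ^ s / c₁ * ℓ + 3 * c₂ ^ s / c₁ * ℓ
            + W * ((c₂ + 1) * (1152 * ℓ + 4 * ℓ))) * A + W * (18 * (Ct * A * ℓ)) := by
          have h1 : 4 + 4 * (2 / g) ^ s / c₁ * Real.log n ^ (3 * s) + 3 * c₂ ^ s / c₁
              + W * ((c₂ + 1) * (1152 * Real.log n ^ 6 + 4))
              ≤ 4 * ℓ + 4 * (2 / g) ^ s / c₁ * ℓ + 3 * c₂ ^ s / c₁ * ℓ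
            + W * ((c₂ + 1) * (1152 * ℓ + 4 * ℓ)) := by
            have h2 : 3 * c₂ ^ s / c₁ ≤ 3 * c₂ ^ s / c₁ * ℓ :=
              le_mul_of_one_le_right (by positivity) hlp
            have h3 : 4 * (2 / g) ^ s / c₁ * Real.log n ^ (3 * s) ≤ 4 * (2 / g) ^ s / c₁ * ℓ :=
              mul_le_mul_of_nonneg_left hl3 (by positivity)
            have h4 : W * ((c₂ + 1) * (1152 * Real.log n ^ 6 + 4))
              ≤ W * ((c₂ + 1) * (1152 * ℓ + 4 * ℓ)) :=
              mul_le_mul_of_nonneg_left (mul_le_mul_of_nonneg_left (by linarith) (by linarith))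
                hW0.le
            linarith
          have h5 := htail d n lam m w hlam hm hw hn4
          have h6 : Ct * A ≤ Ct * A * ℓ := le_mul_of_one_le_right (by positivity) hlp
          exact add_le_add (mul_le_mul_of_nonneg_right h1 hA0)
            (mul_le_mul_of_nonneg_left (mul_le_mul_of_nonneg_left (h5.trans h6) (by norm_num))
              hW0.le)
      _ = C' * ℓ * A := by rw [hC']; ring
  -- The lower bound is built from the same member of the class whose risk is being bounded, by
  -- changing its responses. Thus nonemptiness of the class is never needed.
  refine iSup_le fun P => iSup_le fun Q => iSup_le fun wstar => iSup_le fun hmem => ?_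
  have hR : ∑ j, lam j * wstar j ^ 2 ≤ c₂ ^ s / c₁ := by
    have := hmem.ellipsoid
    rw [sqNorm_diagonal] at this
    exact sum_lam_mul_sq_le hs hc₁ hc₂ hl hl' (fun j => (hm j).1) this
  have hup := hmem.lintegral_asgd_le (w := w) (n := n) hψ hm0 (stageLen_pos h.log_ge)
    (fun j => h.stepParams (hl j) (hl' j)) hstab' (fun j => h.bias_sum_le (hl j) (hl' j)) hR
    (fun j => biasFactor n β γ (lam j)) (fun j => noiseFactor s n β δ γ (lam j))
    (fun j c => h.sq_final_bias_le (hl j) (hl' j) c)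
    (fun j τ hτ => h.sq_final_noise_le (hl j) (hl' j) hτ) (fun j => h.noiseFactor_nonneg)
  have hlow := hmem.minimaxRisk_diagonal_ge (n := n) hσ hl hm0
  refine hup.trans ((ENNReal.ofReal_le_ofReal hsum).trans ?_)
  refine le_trans (le_of_eq ?_) (mul_le_mul_right hlow _)
  rw [← ENNReal.ofReal_mul (mul_nonneg (by positivity) (Real.rpow_nonneg (by linarith) _))]
  congr 1
  change _ = C' / κ * _ * (κ * A)
  field_simp

end Rate

/-! ### Choice of the parameters -/

section Tuning

open Filter Topology

lemma eventually_log_pow_mul_rpow_le (c : ℝ) (k : ℕ) {e ε : ℝ} (he : 0 < e) (hε : 0 < ε) :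
    ∀ᶠ n : ℕ in atTop, c * Real.log n ^ k * (n : ℝ) ^ (-e) ≤ ε := by
  have h1 := (isLittleO_log_rpow_rpow_atTop (k : ℝ) he).tendsto_div_nhds_zero
  have h2 := (h1.const_mul c).comp tendsto_natCast_atTop_atTop (α := ℕ)
  rw [mul_zero] at h2
  filter_upwards [h2.eventually_le_const hε] with n hn
  simp only [Function.comp_apply, Real.rpow_natCast] at hn
  rw [Real.rpow_neg (Nat.cast_nonneg n), mul_assoc, ← div_eq_mul_inv]
  exact hn

/-- The step size of the momentum sequence. -/
def tunedGamma (s g : ℝ) (n : ℕ) : ℝ := g * (max (n : ℝ) 1) ^ (1 / s - 1)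

/-- The step size of the gradient descent sequence. -/
def tunedDelta (s g : ℝ) (n : ℕ) : ℝ := min g (tunedGamma s g n)

/-- The momentum parameter. -/
def tunedBeta (n : ℕ) : ℝ :=
  if 0 < Real.log n ^ 3 / n ∧ Real.log n ^ 3 / n < 1 then Real.log n ^ 3 / n else 1 / 2

/-- The default 1/2 serves only to keep the parameter in (0, 1) for those n where (ln n)³/n is not.
-/
lemma tunedBeta_mem (n : ℕ) : 0 < tunedBeta n ∧ tunedBeta n < 1 := by
  unfold tunedBeta
  split_ifs with h
  · exact h
  · norm_num

lemma tunedGamma_pos {s g : ℝ} (hg : 0 < g) (n : ℕ) : 0 < tunedGamma s g n :=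
  mul_pos hg (Real.rpow_pos_of_pos (by positivity) _)

lemma tunedDelta_pos {s g : ℝ} (hg : 0 < g) (n : ℕ) : 0 < tunedDelta s g n :=
  lt_min hg (tunedGamma_pos hg n)

/-- For s ≥ 1 the exponent 1/s - 1 is not positive, so γ never exceeds g and the cap on δ is
inactive. -/
lemma tunedDelta_eq_gamma {s g : ℝ} (hs : 1 ≤ s) (hg : 0 < g) (n : ℕ) :
    tunedDelta s g n = tunedGamma s g n := by
  refine min_eq_right (mul_le_of_le_one_right hg.le ?_)
  refine Real.rpow_le_one_of_one_le_of_nonpos (le_max_right _ _) ?_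
  have : 1 / s ≤ 1 := (div_le_one (by linarith)).2 hs
  linarith

lemma eventually_tuned {s c₂ g θ ε Zθ : ℝ} (hs : 0 < s) (hc₂ : 0 < c₂) (hg : 0 < g) (hg1 : g ≤ 1)
    (hgc : g * c₂ ≤ 1) (hθ : 0 < θ) (hθ1 : θ < 1) (hθs : θ < 2 - 1 / s) (hε : 0 < ε)
    (hZθ : 0 ≤ Zθ) :
    ∀ᶠ n : ℕ in atTop, ∃ X, Tuned s c₂ g n (tunedBeta n) (tunedDelta s g n) (tunedGamma s g n) X ∧
      640 * Real.log n ^ 6 * X * (n : ℝ) ^ (-(1 - θ)) * Zθ ≤ ε := by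
  -- The step ratio is X = max(1, n^(1/s-1)) ≤ n^E. The condition θ < 2 - 1/s is what yields E < 1 -
  -- θ, so that X n^(-(1-θ)) decays faster than any power of ln n grows.
  set E := max 0 (1 / s - 1) with hE
  have hE1 : E < 1 - θ := max_lt (by linarith) (by linarith)
  filter_upwards [eventually_log_pow_mul_rpow_le 4 3 (by linarith : 0 < 1 - E) one_pos,
    eventually_log_pow_mul_rpow_le (640 * Zθ) 6 (by linarith : 0 < 1 - θ - E) hε,
    (Real.tendsto_log_atTop.comp tendsto_natCast_atTop_atTop).eventually_ge_atTop 15]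
    with n h1 h2 h3
  simp only [Function.comp_apply] at h3
  have hn3 := three_mul_log_le h3
  have hn1 : (1 : ℝ) ≤ n := by linarith
  have hn : (0 : ℝ) < n := by linarith
  have hl3 : 1 ≤ Real.log n ^ 3 := one_le_pow₀ (by linarith)
  set x := (n : ℝ) ^ (1 / s - 1) with hx
  have hx0 : 0 < x := Real.rpow_pos_of_pos hn _
  have hX : max 1 x ≤ (n : ℝ) ^ E :=
    max_le (Real.one_le_rpow hn1 (le_max_left _ _))
      (Real.rpow_le_rpow_of_exponent_le hn1 (le_max_right _ _))
  have hγ : tunedGamma s g n = g * x := by rw [tunedGamma, max_eq_left hn1]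
  have hsize : 4 * Real.log n ^ 3 * max 1 x ≤ n := by
    have h4 := mul_le_mul_of_nonneg_right h1 hn.le
    rw [mul_assoc] at h4
    have e : (n : ℝ) ^ (-(1 - E)) * n = (n : ℝ) ^ E := by
      conv_lhs => enter [2]; rw [← Real.rpow_one (n : ℝ)]
      rw [← Real.rpow_add hn]; congr 1; ring
    rw [e] at h4
    have h5 := mul_le_mul_of_nonneg_left hX (by positivity : 0 ≤ 4 * Real.log n ^ 3)
    linarith
  have hβ : tunedBeta n = Real.log n ^ 3 / n := by
    refine if_pos ⟨by positivity, ?_⟩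
    rw [div_lt_one hn]
    have := mul_le_mul_of_nonneg_left (le_max_left 1 x) (by positivity : 0 ≤ 4 * Real.log n ^ 3)
    linarith
  have hδ : tunedGamma s g n = tunedDelta s g n * max 1 x := by
    rw [tunedDelta, hγ]
    rcases le_total x 1 with hx1 | hx1
    · rw [max_eq_left hx1, mul_one, min_eq_right (mul_le_of_le_one_right hg.le hx1)]
    · rw [max_eq_right hx1, min_eq_left (le_mul_of_one_le_right hg.le hx1)]
  refine ⟨max 1 x, ⟨hs, hc₂, h3, hg, hg1, hgc, le_max_left _ _, hsize, hβ, hγ, hδ,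
    tunedDelta_pos hg n, min_le_left _ _⟩, ?_⟩
  have e : (n : ℝ) ^ E * (n : ℝ) ^ (-(1 - θ)) = (n : ℝ) ^ (-(1 - θ - E)) := by
    rw [← Real.rpow_add hn]; congr 1; ring
  calc 640 * Real.log n ^ 6 * max 1 x * (n : ℝ) ^ (-(1 - θ)) * Zθ
      ≤ 640 * Real.log n ^ 6 * (n : ℝ) ^ E * (n : ℝ) ^ (-(1 - θ)) * Zθ := by gcongr
    _ = 640 * Zθ * Real.log n ^ 6 * ((n : ℝ) ^ E * (n : ℝ) ^ (-(1 - θ))) := by ring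
    _ ≤ ε := by rw [e]; exact h2

/-- The threshold on s comes from the choice of θ: summability asks for θ > 1/a and stability for θ
< 2 - 1/s. The two are compatible exactly when s > a/(2a-1). -/
theorem exists_asgd_optimal {a s r c₁ c₂ σ ψ : ℝ} (ha : 1 < a) (hr : 1 / a - 2 < r) (hc₁ : 0 < c₁)
    (hc₂ : 0 < c₂) (hσ : 0 < σ) (hψ : 0 < ψ) (hs : a / (2 * a - 1) < s) :
    ∃ g : ℝ, 0 < g ∧ RankOneOptimalUpToLog a s r c₁ c₂ σ ψ fun _ n =>
      asgd (tunedDelta s g n) (tunedGamma s g n) (1 - tunedBeta n) (tunedBeta n) := by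
  have ha0 : 0 < a := by linarith
  have ha2 : 0 < 2 * a - 1 := by linarith
  have hs0 : 0 < s := (div_pos ha0 ha2).trans hs
  have h1a : 1 / a < 1 := (div_lt_one ha0).2 ha
  have hsa : 1 / a < 2 - 1 / s := by
    rw [div_lt_iff₀ ha2] at hs
    have e : 2 - 1 / s - 1 / a = (s * (2 * a - 1) - a) / (a * s) := by field_simp; ring
    have : 0 < (s * (2 * a - 1) - a) / (a * s) := div_pos (by linarith) (by positivity)
    linarith
  obtain ⟨θ, hθ0, hθ2⟩ := exists_between (lt_min h1a hsa)
  obtain ⟨hθ1, hθs⟩ := lt_min_iff.1 hθ2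
  have hθ : 0 < θ := (one_div_pos.2 ha0).trans hθ0
  have haθ : 1 < a * θ := by
    rw [div_lt_iff₀ ha0] at hθ0
    linarith
  obtain ⟨Z, hZ0, hZ⟩ := exists_sum_powerLaw_le ha
  obtain ⟨Zθ, hZθ0, hZθ⟩ := exists_sum_powerLaw_le haθ
  -- The three bounds give γ ≤ n^(1/s-1) for n ≥ 1, then δλ ≤ 1, then half of the stability budget
  -- 1/(4ψ).
  set g := min (min 1 (1 / c₂)) (1 / (8 * ψ) / (33 * c₂ * Z)) with hg
  have hg0 : 0 < g := lt_min (lt_min one_pos (by positivity)) (by positivity)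
  have hg1 : g ≤ 1 := (min_le_left _ _).trans (min_le_left _ _)
  have hgc : g * c₂ ≤ 1 := (le_div_iff₀ hc₂).1 ((min_le_left _ _).trans (min_le_right _ _))
  have hgZ : 33 * g * c₂ * Z ≤ 1 / (8 * ψ) := by
    have := (le_div_iff₀ (by positivity)).1 (min_le_right (min 1 (1 / c₂))
      (1 / (8 * ψ) / (33 * c₂ * Z)))
    rw [← hg] at this
    linarith
  obtain ⟨C, p, hC, hrisk⟩ := exists_worstRisk_asgd_le (σ := σ) (ψ := ψ) ha hr hc₁ hc₂ hσ hψ hs0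
    hθ hθ1 hg0 hZ hZθ hgZ
  have hscale : ∀ᶠ n : ℕ in atTop, 4 ≤ c₁ ^ (1 / a) * (n : ℝ) ^ (1 / (a * s)) :=
    (((tendsto_rpow_atTop (by positivity : 0 < 1 / (a * s))).comp
      tendsto_natCast_atTop_atTop).const_mul_atTop (by positivity)).eventually_ge_atTop 4
  obtain ⟨N, hN⟩ := eventually_atTop.1 ((eventually_tuned hs0 hc₂ hg0 hg1 hgc hθ hθ1 hθs
    (by positivity : 0 < 1 / (8 * ψ)) hZθ0.le).and hscale)
  refine ⟨g, hg0, C, p, N, hC, fun d lam m w _ hlam hm hw n hn => ?_⟩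
  obtain ⟨⟨X, hX, hst⟩, h4⟩ := hN n hn
  exact hrisk d n _ _ _ X lam m w hlam hm hw hX hst h4

end Tuning

/-! ### Vanilla SGD as a special case -/

/-- If w = v, every average of the two is that same point, and with equal step sizes both sequences
make the same update; so w = v persists, whatever β is. -/
lemma asgdIter_eq_sgdIter {d n : ℕ} (γ β : ℝ) (D : Fin n → Obs d) (i : ℕ) :
    asgdIter γ γ (1 - β) β D i = (sgdIter γ D i, sgdIter γ D i) := by
  induction i with
  | zero => rfl
  | succ i ih =>
    have h1 : (1 - β) • sgdIter γ D i + (1 - (1 - β)) • sgdIter γ D i = sgdIter γ D i := by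
      rw [← add_smul]; simp
    have h2 : β • sgdIter γ D i + (1 - β) • sgdIter γ D i = sgdIter γ D i := by
      rw [← add_smul]; simp
    rw [asgdIter, sgdIter, ih]
    simp only [h1, h2]
    split_ifs <;> rfl

lemma asgd_eq_sgd {d n : ℕ} (γ β : ℝ) (D : Fin n → Obs d) : asgd γ γ (1 - β) β D = sgd γ D := by
  rw [asgd, sgd, asgdIter_eq_sgdIter]

end CovShift

end

theorem theorem6 (a s r c₁ c₂ σ ψ : ℝ) (ha : 1 < a)
    (hr : max (1 / a - 2) (1 / a - s) < r)
    (hc₁ : 0 < c₁) (hc₂ : 0 < c₂) (hσ : 0 < σ) (hψ : 1 ≤ ψ) :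
    (1 ≤ s →
      ∃ γ : ℕ → ℝ, (∀ n, 0 < γ n) ∧
        CovShift.RankOneOptimalUpToLog a s r c₁ c₂ σ ψ
          (fun _ n => CovShift.sgd (γ n))) ∧
    (a / (2 * a - 1) < s → s < 1 →
      ∃ δ γ α β : ℕ → ℝ,
        (∀ n, 0 < δ n ∧ δ n ≤ γ n ∧ 0 < α n ∧ α n < 1 ∧ 0 < β n ∧ β n < 1) ∧
        CovShift.RankOneOptimalUpToLog a s r c₁ c₂ σ ψ
          (fun _ n => CovShift.asgd (δ n) (γ n) (α n) (β n))) := by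
  have hr2 : 1 / a - 2 < r := (le_max_left _ _).trans_lt hr
  have hψ0 : 0 < ψ := by linarith
  constructor
  · intro hs
    -- As a > 1, the threshold a/(2a-1) lies below 1, so the accelerated result covers all s ≥ 1.
    have hs' : a / (2 * a - 1) < s :=
      ((div_lt_one (by linarith)).2 (by linarith)).trans_le hs
    obtain ⟨g, hg, hopt⟩ := CovShift.exists_asgd_optimal ha hr2 hc₁ hc₂ hσ hψ0 hs'
    refine ⟨CovShift.tunedGamma s g, CovShift.tunedGamma_pos hg, ?_⟩
    convert hopt using 3 with d n
    rw [CovShift.tunedDelta_eq_gamma hs hg]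
    exact funext fun D => (CovShift.asgd_eq_sgd _ _ D).symm
  · intro hs _
    obtain ⟨g, hg, hopt⟩ := CovShift.exists_asgd_optimal ha hr2 hc₁ hc₂ hσ hψ0 hs
    refine ⟨CovShift.tunedDelta s g, CovShift.tunedGamma s g, fun n => 1 - CovShift.tunedBeta n,
      CovShift.tunedBeta, fun n => ?_, hopt⟩
    have hβ := CovShift.tunedBeta_mem n
    exact ⟨CovShift.tunedDelta_pos hg n, min_le_right _ _, by linarith, by linarith, hβ.1, hβ.2⟩
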